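/- **Setting.** Let $M=J^1\tau=\mathbb R^5$ with coordinates $(x,y,z,p,q)$, contact form $U=dz-p\,dx-q\,dy$ and Cartan distribution $\mathcal C=\ker U$. A hyperbolic Monge–Ampère equation $\mathcal E$ over an open set of $M$ is $$N(z_{xx}z_{yy}-z_{xy}^2)+Az_{xx}+Bz_{xy}+Cz_{yy}+D=0,$$ with smooth coefficients depending on $(x,y,z,p,q)=(x,y,z,z_x,z_y)$ and $\Delta=B^2-4AC+4ND>0$; it is regarded as a submanifold of $J^2\tau$. Its two characteristic distributions are the plane distributions $\mathcal D^1,\mathcal D^2\subset\mathcal C$ with $\mathcal C=\mathcal D^1\oplus\mathcal D^2$, given for $N\ne0$ by $$\mathcal D^{1}=\Big\langle \partial_x+p\partial_z-\tfrac CN\partial_p+\tfrac{B-\sqrt\Delta}{2N}\partial_q,\ \partial_y+q\partial_z+\tfrac{B+\sqrt\Delta}{2N}\partial_p-\tfrac AN\partial_q\Big\rangle,$$ and by the same formula with $-\sqrt\Delta$ in place of $\sqrt\Delta$ for $\mathcal D^2$; at points with $N=0$ they are defined by continuity. Multiplying all coefficients by $-1$ does not change the equation but interchanges $\mathcal D^1$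 and $\mathcal D^2$; denote the equation with the distributions so interchanged by $\mathcal E^-$. For a distribution $\mathcal D$ let $\mathcal D^{(1)}$ be generated by all $X$ and $[X,Y]$ with $X,Y\in\mathcal D$, and $\mathcal D^{(2)}=(\mathcal D^{(1)})^{(1)}$. Put $\mathcal D^3=(\mathcal D^1)^{(1)}\cap(\mathcal D^2)^{(1)}$. Then $TM=\mathcal D^1\oplus\mathcal D^2\oplus\mathcal D^3$, with projections $\mathcal P_1,\mathcal P_2,\mathcal P_3$. Choose local frames $\mathcal D^1=\langle X_1,X_2\rangle$, $\mathcal D^2=\langle X_3,X_4\rangle$, $\mathcal D^3=\langle X_5\rangle$ with $[X_1,X_2]\equiv X_5 \bmod \mathcal D^1$ and $[X_3,X_4]\equiv -X_5\bmod\mathcal D^2$, let $[X_j,X_k]=\sum_i b^i_{jk}X_i$, and put $$\Lambda_1=b^2_{35}b^1_{45}-b^1_{35}b^2_{45},\quad \Lambda_2=b^4_{15}b^3_{25}-b^3_{15}b^4_{25},\quad \Lambda_{12}=b^3_{15}b^1_{35}+b^4_{15}b^1_{45}+b^3_{25}b^2_{35}+b^4_{25}b^2_{45},$$ $$\beta=b^1_{15}+b^2_{25}+b^3_{35}+b^4_{45},\qquad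 I^1_{\mathcal E}=\frac{\Lambda_{12}}{\Lambda_1},\quad I^2_{\mathcal E}=\frac{\Lambda_{12}}{\Lambda_2},\quad (I^3_{\mathcal E},I^4_{\mathcal E},I^5_{\mathcal E})=\Big(\frac{(X_5(\Lambda_\sigma)+\Lambda_\sigma \beta)^2}{|\Lambda_1|^3}\Big)_{\sigma=1,2,12}.$$ These functions do not depend on the choice of the frame. Write $I_{\mathcal E}=(I^1_{\mathcal E},\dots,I^5_{\mathcal E})$, let $k\in\{1,2\}$ and put $$\Omega_1=dI^1_{\mathcal E}\circ\mathcal P_1,\quad \Omega_2=dI^2_{\mathcal E}\circ\mathcal P_1,\quad \Omega_3=dI^1_{\mathcal E}\circ\mathcal P_2,\quad \Omega_4=dI^2_{\mathcal E}\circ\mathcal P_2,\quad \Omega_5=dI^k_{\mathcal E}\circ\mathcal P_3 .$$ The equation $\mathcal E$ is called *generic at* $a\in M$ if it is defined near $a$, $\dim(\mathcal D^1)^{(2)}=\dim(\mathcal D^2)^{(2)}=5$ at $a$, the forms $\Omega_1,\dots,\Omega_5$ are linearly independent at $a$ for $k=1$ and for $k=2$, and $dI^1_{\mathcal E},\dots,dI^5_{\mathcal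 E}$ are linearly independent at $a$. Two pairs $(\mathcal E,a)$ and $(\tilde{\mathcal E},\tilde a)$ are *contact equivalent* if there is a diffeomorphism $\varphi$ between neighbourhoods of $a$ and $\tilde a$ with $\varphi(a)=\tilde a$ which preserves the Cartan distribution and whose lift to $J^2\tau$ (defined on an open dense set) takes $\mathcal E$ to $\tilde{\mathcal E}$. **Theorem.** 1. Genericity is a dense condition: for every hyperbolic Monge–Ampère equation $\mathcal E$ defined near $a$, every $m$ and every $\delta>0$ there is a hyperbolic Monge–Ampère equation, generic at $a$, such that all derivatives of order $\le m$ at $a$ of its coefficient vector $(N,A,B,C,D)$ differ from those of $\mathcal E$ by less than $\delta$. 2. If $\mathcal E$ is generic at $a$, then it is generic at all points of a neighbourhood $V$ of $a$ on which $I^1_{\mathcal E},\dots,I^5_{\mathcal E}$ are smooth local coordinates, and for each $k$ there are unique functions $\Omega^i_j$ on the open set $I_{\mathcal E}(V)\subset\mathbb R^5$ such that on $V$ $$\Omega_i=\sum_{j=1}^5\Omega^i_j(I^1_{\mathcal E},\dots,I^5_{\mathcal E})\,dI^j_{\mathcal E},\qquad i=1,\dots,5;$$ these functions are smooth. 3.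 Let $\mathcal E$ be generic at $a$ and $\tilde{\mathcal E}$ generic at $\tilde a$, and fix $k\in\{1,2\}$. Then $(\mathcal E,a)$ and $(\tilde{\mathcal E},\tilde a)$ are contact equivalent if and only if, possibly after replacing $\tilde{\mathcal E}$ by $\tilde{\mathcal E}^-$ (that is, after interchanging the two characteristic distributions of $\tilde{\mathcal E}$), one has $I_{\mathcal E}(a)=I_{\tilde{\mathcal E}}(\tilde a)$ and the functions $\Omega^i_j$ of $\mathcal E$ and $\tilde\Omega^i_j$ of $\tilde{\mathcal E}$ coincide near this point of $\mathbb R^5$ for all $i,j$. -/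

import Mathlib

open Set Filter Topology
open scoped ContDiff

noncomputable section

namespace MongeAmpere

/-! ### The contact manifold of 1-jets of functions of two variables -/

/-- The space `J¹τ` of 1-jets of functions `z(x, y)`, with the standard coordinates
`(x, y, z, p, q) = (a 0, a 1, a 2, a 3, a 4)`.  It is a vector space, so it is also the tangent
space at each of its points. -/
abbrev J1 : Type := Fin 5 → ℝ

/-- The contact form `U₁ = dz - p dx - q dy` at the point `a`. -/
def contactForm (a : J1) : J1 →ₗ[ℝ] ℝ :=
  LinearMap.proj 2 - a 3 • LinearMap.proj 0 - a 4 • LinearMap.proj 1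

/-- The Cartan plane `C(a)`. -/
def cartan (a : J1) : Submodule ℝ J1 := LinearMap.ker (contactForm a)

/-- A point of `J²τ` over `a` is given by its fibre coordinates `(r, s, t)`.  This is the
corresponding plane `K = ⟨∂x + p ∂z + r ∂p + s ∂q, ∂y + q ∂z + s ∂p + t ∂q⟩` in `T_a J¹τ`. -/
def jetPlane (a : J1) (r s t : ℝ) : Submodule ℝ J1 :=
  Submodule.span ℝ {![1, 0, a 3, r, s], ![0, 1, a 4, s, t]}

/-! ### Hyperbolic Monge–Ampère equations -/

/-- A hyperbolic Monge–Ampère equation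
`N (z_xx z_yy - z_xy²) + A z_xx + B z_xy + C z_yy + D = 0` over an open set of 1-jets, with smooth
coefficient vector `coeff = (N, A, B, C, D)` and `Δ = B² - 4AC + 4ND > 0`. -/
structure HypEq where
  /-- the set of 1-jets over which the equation is given -/
  dom : Set J1
  isOpen_dom : IsOpen dom
  /-- the coefficients `(N, A, B, C, D)` -/
  coeff : J1 → Fin 5 → ℝ
  smooth : ContDiffOn ℝ ∞ coeff dom
  hyperbolic : ∀ a ∈ dom,
    0 < coeff a 2 ^ 2 - 4 * coeff a 1 * coeff a 3 + 4 * coeff a 0 * coeff a 4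

namespace HypEq

variable (E : HypEq)

/-- The coefficient `N`. -/
def N (a : J1) : ℝ := E.coeff a 0

/-- The coefficient `A`. -/
def A (a : J1) : ℝ := E.coeff a 1

/-- The coefficient `B`. -/
def B (a : J1) : ℝ := E.coeff a 2

/-- The coefficient `C`. -/
def C (a : J1) : ℝ := E.coeff a 3

/-- The coefficient `D`. -/
def D (a : J1) : ℝ := E.coeff a 4

/-- The discriminant `Δ = B² - 4AC + 4ND`. -/
def disc (a : J1) : ℝ := E.B a ^ 2 - 4 * E.A a * E.C a + 4 * E.N a * E.D a

/-- The 2-jet `(a, r, s, t)` belongs to the equation, regarded as a submanifold of `J²τ`. -/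
def Holds (a : J1) (r s t : ℝ) : Prop :=
  E.N a * (r * t - s ^ 2) + E.A a * r + E.B a * s + E.C a * t + E.D a = 0

/-- The same equation with all coefficients multiplied by `-1`.  This changes neither the
submanifold of `J²τ` nor the pair of characteristic distributions defined below; it only
interchanges the two members of that pair. -/
def neg : HypEq where
  dom := E.dom
  isOpen_dom := E.isOpen_dom
  coeff := fun a => -E.coeff a
  smooth := E.smooth.neg
  hyperbolic := fun a ha => by
    have h := E.hyperbolic a ha
    simp only [Pi.neg_apply]
    nlinarith [h]

theorem neg_holds (a : J1) (r s t : ℝ) : E.neg.Holds a r s t ↔ E.Holds a r s t := by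
  simp only [Holds, neg, N, A, B, C, D, Pi.neg_apply]
  constructor <;> intro h <;> linarith

/-- For `ε = 1` and `ε = -1`, the characteristic plane of the equation at `a`.  Where `N ≠ 0` these
are the planes `⟨X₁, X₂⟩` (`ε = 1`) and `⟨X₃, X₄⟩` (`ε = -1`) with
`X₁, X₃ = ∂x + p ∂z - (C/N) ∂p + ((B ∓ √Δ)/2N) ∂q`,
`X₂, X₄ = ∂y + q ∂z + ((B ± √Δ)/2N) ∂p - (A/N) ∂q`
(see `mem_charPlane_iff`); the equations below also make sense where `N = 0`.
See `mem_charPlane_iff_ray` for the description by 1-rays. -/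
def charPlane (ε : ℝ) (a : J1) : Submodule ℝ J1 where
  carrier := {v | contactForm a v = 0 ∧
    E.B a * v 0 - 2 * E.A a * v 1 - 2 * E.N a * v 4 = ε * √(E.disc a) * v 0 ∧
    2 * E.C a * v 0 - E.B a * v 1 + 2 * E.N a * v 3 = ε * √(E.disc a) * v 1 ∧
    2 * E.D a * v 1 + E.B a * v 3 + 2 * E.C a * v 4 = ε * √(E.disc a) * v 3 ∧
    -2 * E.D a * v 0 - 2 * E.A a * v 3 - E.B a * v 4 = ε * √(E.disc a) * v 4}
  zero_mem' := by simp
  add_mem' := by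
    rintro v w ⟨h0, h1, h2, h3, h4⟩ ⟨k0, k1, k2, k3, k4⟩
    refine ⟨by rw [map_add, h0, k0, add_zero], ?_, ?_, ?_, ?_⟩ <;>
      simp only [Pi.add_apply] <;> linarith
  smul_mem' := by
    rintro c v ⟨h0, h1, h2, h3, h4⟩
    refine ⟨by rw [map_smul, h0, smul_zero], ?_, ?_, ?_, ?_⟩ <;>
      simp only [Pi.smul_apply, smul_eq_mul]
    · linear_combination c * h1
    · linear_combination c * h2
    · linear_combination c * h3
    · linear_combination c * h4

theorem sq_sqrt_disc {a : J1} (ha : a ∈ E.dom) : √(E.disc a) ^ 2 = E.disc a :=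
  Real.sq_sqrt (E.hyperbolic a ha).le

theorem mem_charPlane_iff {ε : ℝ} (hε : ε ^ 2 = 1) {a : J1} (ha : a ∈ E.dom) (hN : E.N a ≠ 0) :
    E.charPlane ε a = Submodule.span ℝ
      {![1, 0, a 3, -(E.C a / E.N a), (E.B a - ε * √(E.disc a)) / (2 * E.N a)],
       ![0, 1, a 4, (E.B a + ε * √(E.disc a)) / (2 * E.N a), -(E.A a / E.N a)]} := by
  have hs := E.sq_sqrt_disc ha
  set d := √(E.disc a) with hd
  unfold disc at hs
  ext v
  rw [Submodule.mem_span_pair]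
  constructor
  · rintro ⟨h0, h1, h2, -, -⟩
    simp only [contactForm, LinearMap.sub_apply, LinearMap.smul_apply, LinearMap.proj_apply,
      smul_eq_mul] at h0
    refine ⟨v 0, v 1, ?_⟩
    ext i
    fin_cases i <;> simp
    · linarith
    · field_simp
      linarith
    · field_simp
      linarith
  · rintro ⟨c, e, rfl⟩
    refine ⟨by simp [contactForm]; ring, ?_, ?_, ?_, ?_⟩ <;> simp <;> rw [← hd] <;> field_simp
    · ring
    · ring
    · linear_combination -e * hs - e * d ^ 2 * hε
    · linear_combination c * hs + c * d ^ 2 * hε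

/-- A contact vector `v` which is not vertical over the `(x, y)`-plane lies in one of the two
characteristic planes if and only if its 1-ray (the line of all `(r, s, t)` such that `v` lies in the
plane of the 2-jet `(a, r, s, t)`) is tangent to the equation at some point. -/
theorem mem_charPlane_iff_ray {a : J1} (ha : a ∈ E.dom) {v : J1} (hv : v ∈ cartan a)
    (hv' : v 0 ≠ 0 ∨ v 1 ≠ 0) :
    (v ∈ E.charPlane 1 a ∨ v ∈ E.charPlane (-1) a) ↔
      ∃ r s t : ℝ, E.Holds a r s t ∧ v ∈ jetPlane a r s t ∧
        E.N a * (t * v 1 ^ 2 + r * v 0 ^ 2 - 2 * s * (-(v 0 * v 1))) +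
          E.A a * v 1 ^ 2 + E.B a * (-(v 0 * v 1)) + E.C a * v 0 ^ 2 = 0 := by
  have hs := E.sq_sqrt_disc ha
  set d := √(E.disc a) with hd
  unfold disc at hs
  have hv2 : v 2 = a 3 * v 0 + a 4 * v 1 := by
    have h : contactForm a v = 0 := hv
    simp only [contactForm, LinearMap.sub_apply, LinearMap.smul_apply, LinearMap.proj_apply,
      smul_eq_mul] at h
    linarith
  have hjet : ∀ r s t : ℝ, v ∈ jetPlane a r s t ↔
      v 3 = r * v 0 + s * v 1 ∧ v 4 = s * v 0 + t * v 1 := by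
    intro r s t
    rw [jetPlane, Submodule.mem_span_pair]
    constructor
    · rintro ⟨c, e, rfl⟩
      constructor <;> simp <;> ring
    · rintro ⟨h3, h4⟩
      refine ⟨v 0, v 1, ?_⟩
      ext i
      fin_cases i <;> simp <;> linarith
  constructor
  · intro h
    have key : ∃ μ : ℝ,
        E.B a * v 0 - 2 * E.A a * v 1 - 2 * E.N a * v 4 = μ * v 0 ∧
        2 * E.C a * v 0 - E.B a * v 1 + 2 * E.N a * v 3 = μ * v 1 ∧
        2 * E.D a * v 1 + E.B a * v 3 + 2 * E.C a * v 4 = μ * v 3 ∧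
        -2 * E.D a * v 0 - 2 * E.A a * v 3 - E.B a * v 4 = μ * v 4 := by
      rcases h with h | h
      · exact ⟨1 * d, h.2⟩
      · exact ⟨-1 * d, h.2⟩
    obtain ⟨μ, k1, k2, k3, k4⟩ := key
    by_cases h0 : v 0 = 0
    · have h1 : v 1 ≠ 0 := hv'.resolve_left (not_not.2 h0)
      rw [h0] at k1 k2
      refine ⟨0, v 3 / v 1, v 4 / v 1, ?_, ?_, ?_⟩
      · unfold Holds
        field_simp
        linear_combination (1 / 2) * v 1 * k3 - (1 / 2) * v 3 * k2
      · rw [hjet]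
        constructor <;> field_simp <;> simp [h0]
      · rw [h0]
        field_simp
        linear_combination (-1 / 2) * v 1 * k1
    · have k5 : 2 * E.N a * (v 0 * v 3 + v 1 * v 4) + 2 * E.A a * v 1 ^ 2
          - 2 * E.B a * v 0 * v 1 + 2 * E.C a * v 0 ^ 2 = 0 := by
        linear_combination v 0 * k2 - v 1 * k1
      refine ⟨(v 3 - v 4 / v 0 * v 1) / v 0, v 4 / v 0, 0, ?_, ?_, ?_⟩
      · unfold Holds
        field_simp
        linear_combination (1 / 2) * v 4 * k1 - (1 / 2) * v 0 * k4
      · rw [hjet]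
        constructor <;> field_simp <;> ring
      · field_simp
        linear_combination (1 / 2) * k5
  · rintro ⟨r, s, t, hE, hK, hT⟩
    rw [hjet] at hK
    obtain ⟨h3, h4⟩ := hK
    unfold Holds at hE
    have k5 : v 0 * (2 * E.C a * v 0 - E.B a * v 1 + 2 * E.N a * v 3) =
        v 1 * (E.B a * v 0 - 2 * E.A a * v 1 - 2 * E.N a * v 4) := by
      rw [h3, h4]
      linear_combination 2 * hT
    have key : ∃ μ : ℝ,
        E.B a * v 0 - 2 * E.A a * v 1 - 2 * E.N a * v 4 = μ * v 0 ∧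
        2 * E.C a * v 0 - E.B a * v 1 + 2 * E.N a * v 3 = μ * v 1 := by
      by_cases h0 : v 0 = 0
      · have h1 : v 1 ≠ 0 := hv'.resolve_left (not_not.2 h0)
        refine ⟨(2 * E.C a * v 0 - E.B a * v 1 + 2 * E.N a * v 3) / v 1, ?_, ?_⟩
        · field_simp
          linear_combination -k5
        · field_simp
      · refine ⟨(E.B a * v 0 - 2 * E.A a * v 1 - 2 * E.N a * v 4) / v 0, ?_, ?_⟩
        · field_simp
        · field_simp
          linear_combination k5
    obtain ⟨μ, k1, k2⟩ := key
    have k3 : 2 * E.D a * v 1 + E.B a * v 3 + 2 * E.C a * v 4 = μ * v 3 := by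
      have e : μ * v 3 = r * (μ * v 0) + s * (μ * v 1) := by rw [h3]; ring
      rw [e, ← k1, ← k2, h3, h4]
      linear_combination 2 * v 1 * hE
    have k4 : -2 * E.D a * v 0 - 2 * E.A a * v 3 - E.B a * v 4 = μ * v 4 := by
      have e : μ * v 4 = s * (μ * v 0) + t * (μ * v 1) := by rw [h4]; ring
      rw [e, ← k1, ← k2, h3, h4]
      linear_combination -2 * v 0 * hE
    have e0 : (μ ^ 2 - d ^ 2) * v 0 = 0 := by
      linear_combination (-μ - E.B a) * k1 + 2 * E.A a * k2 + 2 * E.N a * k4 - v 0 * hs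
    have e1 : (μ ^ 2 - d ^ 2) * v 1 = 0 := by
      linear_combination (-μ + E.B a) * k2 - 2 * E.C a * k1 - 2 * E.N a * k3 - v 1 * hs
    have hμ : μ ^ 2 = d ^ 2 := by
      rcases hv' with h | h
      · have := (mul_eq_zero.1 e0).resolve_right h
        linarith
      · have := (mul_eq_zero.1 e1).resolve_right h
        linarith
    have hc : contactForm a v = 0 := hv
    rcases sq_eq_sq_iff_eq_or_eq_neg.1 hμ with h | h
    · left
      subst h
      exact ⟨hc, by linarith, by linarith, by linarith, by linarith⟩
    · right
      subst h
      exact ⟨hc, by linarith, by linarith, by linarith, by linarith⟩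

end HypEq

/-! ### Distributions -/

/-- `X` is a vector field defined and smooth near `a`, and tangent to the distribution `P`. -/
def IsLocalSection (P : J1 → Submodule ℝ J1) (X : J1 → J1) (a : J1) : Prop :=
  ∃ W ∈ 𝓝 a, ContDiffOn ℝ ∞ X W ∧ ∀ y ∈ W, X y ∈ P y

/-- The distribution `P⁽¹⁾` generated by all `X` and `[X, Y]`, where `X`, `Y` are local sections
of `P`. -/
def derived (P : J1 → Submodule ℝ J1) (a : J1) : Submodule ℝ J1 :=
  Submodule.span ℝ
    ({v | ∃ X, IsLocalSection P X a ∧ v = X a} ∪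
     {v | ∃ X Y, IsLocalSection P X a ∧ IsLocalSection P Y a ∧
        v = VectorField.lieBracket ℝ X Y a})

/-- The projection of the tangent space onto `S` along `T`, if these are complementary. -/
def projAlong (S T : Submodule ℝ J1) : J1 →ₗ[ℝ] J1 :=
  open Classical in
  if h : IsCompl S T then S.projection T h else 0

namespace HypEq

variable (E : HypEq)

/-- The first characteristic distribution. -/
def D1 : J1 → Submodule ℝ J1 := E.charPlane 1

/-- The second characteristic distribution. -/
def D2 : J1 → Submodule ℝ J1 := E.charPlane (-1)

/-- The one-dimensional distribution `D³ = (D¹)⁽¹⁾ ∩ (D²)⁽¹⁾`. -/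
def D3 (a : J1) : Submodule ℝ J1 := derived E.D1 a ⊓ derived E.D2 a

/-- The projection onto `D¹` given by the decomposition `TM = D¹ ⊕ D² ⊕ D³`. -/
def Pr1 (a : J1) : J1 →ₗ[ℝ] J1 := projAlong (E.D1 a) (E.D2 a ⊔ E.D3 a)

/-- The projection onto `D²` given by the decomposition `TM = D¹ ⊕ D² ⊕ D³`. -/
def Pr2 (a : J1) : J1 →ₗ[ℝ] J1 := projAlong (E.D2 a) (E.D1 a ⊔ E.D3 a)

/-- The projection onto `D³` given by the decomposition `TM = D¹ ⊕ D² ⊕ D³`. -/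
def Pr3 (a : J1) : J1 →ₗ[ℝ] J1 := projAlong (E.D3 a) (E.D1 a ⊔ E.D2 a)

end HypEq

/-! ### Adapted frames and the five basic scalar invariants

The indices `0, …, 4` of a frame stand for the indices `1, …, 5` in the usual notation
`X₁, …, X₅`. -/

/-- `X` is, near `a`, a smooth frame with `D¹ = ⟨X₁, X₂⟩`, `D² = ⟨X₃, X₄⟩`, `D³ = ⟨X₅⟩`, normalised
by `[X₁, X₂] ≡ X₅ mod D¹` and `[X₃, X₄] ≡ -X₅ mod D²`. -/
def IsAdaptedFrame (E : HypEq) (X : Fin 5 → J1 → J1) (a : J1) : Prop :=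
  ∃ W ∈ 𝓝 a, (∀ i, ContDiffOn ℝ ∞ (X i) W) ∧ ∀ y ∈ W,
    E.D1 y = Submodule.span ℝ {X 0 y, X 1 y} ∧
    E.D2 y = Submodule.span ℝ {X 2 y, X 3 y} ∧
    E.D3 y = Submodule.span ℝ {X 4 y} ∧
    VectorField.lieBracket ℝ (X 0) (X 1) y - X 4 y ∈ E.D1 y ∧
    VectorField.lieBracket ℝ (X 2) (X 3) y + X 4 y ∈ E.D2 y

/-- The coefficient `b^i_{jk}` at `a` in `[X_j, X_k] = ∑ i, b^i_{jk} X_i`. -/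
def brk (X : Fin 5 → J1 → J1) (i j k : Fin 5) (a : J1) : ℝ :=
  ((Matrix.of fun m l => X l a m)⁻¹.mulVec (VectorField.lieBracket ℝ (X j) (X k) a)) i

/-- `Λ₁ = b²₃₅ b¹₄₅ - b¹₃₅ b²₄₅`. -/
def Lam1 (X : Fin 5 → J1 → J1) (a : J1) : ℝ :=
  brk X 1 2 4 a * brk X 0 3 4 a - brk X 0 2 4 a * brk X 1 3 4 a

/-- `Λ₂ = b⁴₁₅ b³₂₅ - b³₁₅ b⁴₂₅`. -/
def Lam2 (X : Fin 5 → J1 → J1) (a : J1) : ℝ :=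
  brk X 3 0 4 a * brk X 2 1 4 a - brk X 2 0 4 a * brk X 3 1 4 a

/-- `Λ₁₂ = b³₁₅ b¹₃₅ + b⁴₁₅ b¹₄₅ + b³₂₅ b²₃₅ + b⁴₂₅ b²₄₅`. -/
def Lam12 (X : Fin 5 → J1 → J1) (a : J1) : ℝ :=
  brk X 2 0 4 a * brk X 0 2 4 a + brk X 3 0 4 a * brk X 0 3 4 a +
    brk X 2 1 4 a * brk X 1 2 4 a + brk X 3 1 4 a * brk X 1 3 4 a

/-- `B = b¹₁₅ + b²₂₅ + b³₃₅ + b⁴₄₅`. -/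
def brkTrace (X : Fin 5 → J1 → J1) (a : J1) : ℝ :=
  brk X 0 0 4 a + brk X 1 1 4 a + brk X 2 2 4 a + brk X 3 3 4 a

/-- `(X₅(Λ) + Λ B)² / |Λ₁|³`, the square of the almost invariant
`(X₅(Λ) + Λ B) / |Λ₁|^{3/2}`. -/
def sqInv (X : Fin 5 → J1 → J1) (L : J1 → ℝ) (a : J1) : ℝ :=
  (fderiv ℝ L a (X 4 a) + L a * brkTrace X a) ^ 2 / |Lam1 X a| ^ 3

/-- The five basic invariants, computed in the frame `X`. -/
def frameInv (X : Fin 5 → J1 → J1) (a : J1) : Fin 5 → ℝ :=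
  ![Lam12 X a / Lam1 X a, Lam12 X a / Lam2 X a,
    sqInv X (Lam1 X) a, sqInv X (Lam2 X) a, sqInv X (Lam12 X) a]

namespace HypEq

variable (E : HypEq)

/-- The values `I_E = (I¹_E, …, I⁵_E)` of the five basic invariants on the equation.  They are
computed at each point in an adapted frame near this point; the result does not depend on its
choice. -/
def basicInv (a : J1) : Fin 5 → ℝ :=
  open Classical in
  if h : ∃ X, IsAdaptedFrame E X a then frameInv h.choose a else 0

/-- The differential `dIʲ_E` at `a`. -/
def dInv (j : Fin 5) (a : J1) : J1 →ₗ[ℝ] ℝ := (fderiv ℝ (fun x => E.basicInv x j) a).toLinearMap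

/-- The invariant coframe `Ω₁ = dI¹ ∘ Pr₁`, `Ω₂ = dI² ∘ Pr₁`, `Ω₃ = dI¹ ∘ Pr₂`, `Ω₄ = dI² ∘ Pr₂`,
`Ω₅ = dIᵏ ∘ Pr₃`.  There are two versions of it, with `k = 1` and `k = 2` (here `k = 0`, `1`). -/
def coframe (k : Fin 2) (a : J1) : Fin 5 → J1 →ₗ[ℝ] ℝ :=
  ![E.dInv 0 a ∘ₗ E.Pr1 a, E.dInv 1 a ∘ₗ E.Pr1 a, E.dInv 0 a ∘ₗ E.Pr2 a, E.dInv 1 a ∘ₗ E.Pr2 a,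
    E.dInv (Fin.castLE (by decide) k) a ∘ₗ E.Pr3 a]

/-- The equation is generic at the point `a`: the second derived distributions of both
characteristic distributions have dimension 5, both versions of the invariant coframe are indeed
coframes, and the five basic invariants are functionally independent on the equation. -/
structure GenericAt (a : J1) : Prop where
  mem_dom : a ∈ E.dom
  finrank_derived_D1 : Module.finrank ℝ (derived (derived E.D1) a) = 5
  finrank_derived_D2 : Module.finrank ℝ (derived (derived E.D2) a) = 5
  coframe_indep : ∀ k, LinearIndependent ℝ (E.coframe k a)
  inv_indep : LinearIndependent ℝ fun j => E.dInv j a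

/-- Near `a`, the coefficients in `Ω_i = ∑ j, Ωⁱ_j(I¹_E, …, I⁵_E) dIʲ_E` are given by the functions
`w i j` of five variables. -/
def HasCoeffFunctions (k : Fin 2) (a : J1) (w : Fin 5 → Fin 5 → (Fin 5 → ℝ) → ℝ) : Prop :=
  ∀ᶠ x in 𝓝 a, ∀ i, E.coframe k x i = ∑ j, w i j (E.basicInv x) • E.dInv j x

end HypEq

/-- The families of functions `Ωⁱ_j` of the equations `E` near `a` and `E'` near `a'` coincide: as
functions of five variables, they are defined near the same point `I_E(a) = I_{E'}(a')` and agree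
near it. -/
def SameCoeffFunctions (k : Fin 2) (E : HypEq) (a : J1) (E' : HypEq) (a' : J1) : Prop :=
  E.basicInv a = E'.basicInv a' ∧
    ∃ w w', E.HasCoeffFunctions k a w ∧ E'.HasCoeffFunctions k a' w' ∧
      ∀ᶠ y in 𝓝 (E.basicInv a), ∀ i j, w i j y = w' i j y

/-! ### Local contact equivalence -/

/-- `φ` is a local contact transformation: a diffeomorphism between open sets which preserves the
Cartan distribution. -/
def IsContact (φ : OpenPartialHomeomorph J1 J1) : Prop :=
  ContDiffOn ℝ ∞ φ φ.source ∧ ContDiffOn ℝ ∞ φ.symm φ.target ∧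
    ∀ x ∈ φ.source, (cartan x).map (fderiv ℝ φ x).toLinearMap = cartan (φ x)

/-- The lift `φ⁽¹⁾` of `φ` to `J²τ` takes `(x, r, s, t)` to `(φ x, r', s', t')`. -/
def LiftsTo (φ : OpenPartialHomeomorph J1 J1) (x : J1) (r s t r' s' t' : ℝ) : Prop :=
  (jetPlane x r s t).map (fderiv ℝ φ x).toLinearMap = jetPlane (φ x) r' s' t'

/-- The equations `E` near `a` and `E'` near `a'` are contact equivalent: there is a local contact
transformation taking `a` to `a'` whose lift to `J²τ` takes `E` to `E'`. -/
def ContactEquiv (E : HypEq) (a : J1) (E' : HypEq) (a' : J1) : Prop :=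
  ∃ φ : OpenPartialHomeomorph J1 J1, a ∈ φ.source ∧ φ a = a' ∧
    φ.source ⊆ E.dom ∧ φ.target ⊆ E'.dom ∧ IsContact φ ∧
    ∀ x ∈ φ.source, ∀ r s t r' s' t' : ℝ, LiftsTo φ x r s t r' s' t' →
      (E.Holds x r s t ↔ E'.Holds (φ x) r' s' t')

end MongeAmpere

end

open MongeAmpere

noncomputable section

namespace MongeAmpere

/-! ### Linear algebra of the Cartan plane -/

/-! For contact fields U([V, W]) = -dU(V, W), so each Cartan plane carries the symplectic form dU
(`Om`), natural up to a factor. The coefficients of the equation define a dU-self-adjoint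
endomorphism J (`jop`) of this plane with J² = Δ. Its eigenplanes for √Δ and -√Δ are D¹ and D²; they
are symplectic and orthogonal to each other. A 2-jet is a Lagrangian plane K on which dx ∧ dy does
not vanish, and the left-hand side of the equation is, up to a factor, dU(J·, ·) restricted to K.
Hence K belongs to the equation exactly when it is J-invariant, that is, when it meets D¹
(`HypEq.holds_iff`): the equation is determined by D¹.

Two adapted frames differ by 2 × 2 blocks on D¹ and D² with a common determinant l, which is also
the factor between the two fields X₅. The mixed structure functions form 2 × 2 matrices P, Q which
transform tensorially, and Λ₁ = -det P, Λ₂ = -det Q, Λ₁₂ = tr QP are all multiplied by l². The trace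
β absorbs the derivative of l, so that X₅(Λ) + Λβ is multiplied by l³. This makes the five functions
independent of the frame (`Adapted.frameInv_eq`), and all of the construction is natural under
diffeomorphisms preserving D¹ and D².

Equivalence (`contactEquiv_iff`). A contact transformation is conformally symplectic on Cartan
planes (`IsContact.conformal`). For v in D¹ and w in D² in general position, ⟨v, w⟩ is a 2-jet of
the equation; its image being a 2-jet of the other equation forces the image of D¹ to be an
eigenplane of J' (`LinearEquivalence.map_D1_le`). So characteristic planes go to characteristic
planes, possibly interchanged, with a choice constant near the point, and the coefficient functions
agree by naturality. Conversely, the invariants are coordinates, and identifying points with equal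
invariants gives a map which pulls one coframe back to the other. As D¹ and D² are common kernels of
members of the coframe, it preserves them and hence the equation.

Density (`exists_generic_near`). The frame of D¹ is perturbed by multiples f, g, h, k of the frame
of D², and conversely, with polynomials of degree d + 2. To leading order this changes P and Q by
second derivatives of these polynomials, and homogeneous polynomials of a suitable class of degree d
can be prescribed as the changes (`pderiv_leadingPoly`). If Λ₁₂² ≠ 4Λ₁Λ₂, the leading changes of Λ₁,
Λ₂, Λ₁₂ can then be prescribed as well (`eventually_exists_perturbed_Lam`). Degree 0 makes the
relative invariants non-zero, degree 1 adjusts their differentials, and degree 2 adjusts the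
differentials of the last three invariants. Each required inequality holds for small t ≠ 0 because a
polynomial in t with non-zero leading coefficient has isolated zeros. -/

theorem contactForm_apply (a v : J1) : contactForm a v = v 2 - a 3 * v 0 - a 4 * v 1 := by
  simp [contactForm]

/-- The symplectic form `dU = dx ∧ dp + dy ∧ dq`. -/
def Om (v w : J1) : ℝ := v 0 * w 3 - v 3 * w 0 + v 1 * w 4 - v 4 * w 1

/-- The coefficient vector `(N, A, B, C, D)` of the equation with characteristic plane
`⟨v, w⟩`. -/
def pluck (v w : J1) : Fin 5 → ℝ :=
  ![v 0 * w 1 - v 1 * w 0, -(v 0 * w 4 - v 4 * w 0),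
    (v 0 * w 3 - v 3 * w 0) - (v 1 * w 4 - v 4 * w 1),
    v 1 * w 3 - v 3 * w 1, v 3 * w 4 - v 4 * w 3]

/-- The endomorphism of the Cartan plane at `a` which is self-adjoint with respect to `dU` and whose
eigenspaces are the characteristic planes of the equation with coefficients `c` at `a`. -/
def jop (c : Fin 5 → ℝ) (a v : J1) : J1 :=
  ![c 2 * v 0 - 2 * c 1 * v 1 - 2 * c 0 * v 4,
    2 * c 3 * v 0 - c 2 * v 1 + 2 * c 0 * v 3,
    a 3 * (c 2 * v 0 - 2 * c 1 * v 1 - 2 * c 0 * v 4) +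
      a 4 * (2 * c 3 * v 0 - c 2 * v 1 + 2 * c 0 * v 3),
    2 * c 4 * v 1 + c 2 * v 3 + 2 * c 3 * v 4,
    -2 * c 4 * v 0 - 2 * c 1 * v 3 - c 2 * v 4]

theorem Om_add_left (u v w : J1) : Om (u + v) w = Om u w + Om v w := by simp [Om]; ring
theorem Om_add_right (u v w : J1) : Om u (v + w) = Om u v + Om u w := by simp [Om]; ring
theorem Om_smul_left (c : ℝ) (v w : J1) : Om (c • v) w = c * Om v w := by simp [Om]; ring
theorem Om_smul_right (c : ℝ) (v w : J1) : Om v (c • w) = c * Om v w := by simp [Om]; ring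
theorem Om_self (v : J1) : Om v v = 0 := by simp [Om]; ring
theorem Om_swap (v w : J1) : Om w v = -Om v w := by simp [Om]; ring

theorem jop_add (c : Fin 5 → ℝ) (a v w : J1) : jop c a (v + w) = jop c a v + jop c a w := by
  ext i; fin_cases i <;> simp [jop] <;> ring

theorem jop_smul (c : Fin 5 → ℝ) (a : J1) (s : ℝ) (v : J1) :
    jop c a (s • v) = s • jop c a v := by
  ext i; fin_cases i <;> simp [jop] <;> ring

theorem jop_neg (c : Fin 5 → ℝ) (a v : J1) : jop (-c) a v = -jop c a v := by
  ext i; fin_cases i <;> simp [jop] <;> ring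

theorem contactForm_jop (c : Fin 5 → ℝ) (a v : J1) : contactForm a (jop c a v) = 0 := by
  simp [contactForm_apply, jop]

theorem Om_jop_left (c : Fin 5 → ℝ) (a v w : J1) : Om (jop c a v) w = Om v (jop c a w) := by
  simp [Om, jop]; ring

theorem Om_jop_self (c : Fin 5 → ℝ) (a v : J1) : Om (jop c a v) v = 0 := by
  simp [Om, jop]; ring

/-- The quadratic form `B² - 4AC + 4ND`. -/
def discForm (c : Fin 5 → ℝ) : ℝ := c 2 ^ 2 - 4 * c 1 * c 3 + 4 * c 0 * c 4

theorem HypEq.disc_eq (E : HypEq) (a : J1) : E.disc a = discForm (E.coeff a) := rfl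

/-- This identifies `√Δ` with `|Om v w|` and makes an equation given by a pair of fields hyperbolic
exactly when the pair spans a symplectic plane. -/
theorem discForm_pluck (v w : J1) : discForm (pluck v w) = Om v w ^ 2 := by
  simp [discForm, pluck, Om]; ring

theorem cartan_ext {a v w : J1} (hv : contactForm a v = 0) (hw : contactForm a w = 0)
    (h0 : v 0 = w 0) (h1 : v 1 = w 1) (h3 : v 3 = w 3) (h4 : v 4 = w 4) : v = w := by
  rw [contactForm_apply] at hv hw
  ext i
  fin_cases i
  · exact h0
  · exact h1
  · simp only [Fin.reduceFinMk]; rw [h0, h1] at hv; linarith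
  · exact h3
  · exact h4

theorem jop_jop (c : Fin 5 → ℝ) {a v : J1} (hv : contactForm a v = 0) :
    jop c a (jop c a v) = discForm c • v := by
  refine cartan_ext (contactForm_jop _ _ _) (by rw [map_smul, hv, smul_zero]) ?_ ?_ ?_ ?_ <;>
    simp [jop, discForm] <;> ring

/-- The right-hand side is multiplication by `Om v w` on ⟨v, w⟩ and by `-Om v w` on its
`Om`-orthogonal complement, so both eigenplanes can be read off. -/
theorem jop_pluck {a v w u : J1} (hv : contactForm a v = 0) (hw : contactForm a w = 0)
    (hu : contactForm a u = 0) :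
    jop (pluck v w) a u = -Om v w • u + (2 : ℝ) • (Om u w • v - Om u v • w) := by
  refine cartan_ext (contactForm_jop _ _ _) (by simp [hv, hw, hu]) ?_ ?_ ?_ ?_ <;>
    simp [jop, pluck, Om] <;> ring

/-- The four coordinate equations are the components of an eigenvector equation; the remaining
component follows from the contact condition. -/
theorem HypEq.mem_charPlane (E : HypEq) {ε : ℝ} {a v : J1} :
    v ∈ E.charPlane ε a ↔
      contactForm a v = 0 ∧ jop (E.coeff a) a v = (ε * √(E.disc a)) • v := by
  constructor
  · rintro ⟨h, h0, h1, h3, h4⟩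
    exact ⟨h, cartan_ext (contactForm_jop _ _ _) (by rw [map_smul, h, smul_zero]) h0 h1 h3 h4⟩
  · rintro ⟨h, hJ⟩
    exact ⟨h, congrFun hJ 0, congrFun hJ 1, congrFun hJ 3, congrFun hJ 4⟩

theorem HypEq.sqrt_disc_pos (E : HypEq) {a : J1} (ha : a ∈ E.dom) : 0 < √(E.disc a) :=
  Real.sqrt_pos.2 (E.hyperbolic a ha)

/-- An eigenplane determines the coefficients up to a factor. Each entry is a combination of the
eigenvector equations of `v` paired with components of `w`, and conversely. -/
theorem pluck_smul_of_eigen {c : Fin 5 → ℝ} {a v w : J1} {s : ℝ}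
    (hv : jop c a v = s • v) (hw : jop c a w = s • w) : s • pluck v w = Om v w • c := by
  have v0 := congrFun hv 0
  have v1 := congrFun hv 1
  have v3 := congrFun hv 3
  have v4 := congrFun hv 4
  have w0 := congrFun hw 0
  have w1 := congrFun hw 1
  have w3 := congrFun hw 3
  have w4 := congrFun hw 4
  simp [jop] at v0 v1 v3 v4 w0 w1 w3 w4
  ext i
  fin_cases i <;> simp [pluck, Om]
  · linear_combination (-1/2) * (v0 * w 1 + w1 * v 0 - v1 * w 0 - w0 * v 1)
  · linear_combination (1/2) * (v0 * w 4 + w4 * v 0 - v4 * w 0 - w0 * v 4)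
  · linear_combination (-1/2) * (v0 * w 3 + w3 * v 0 - v3 * w 0 - w0 * v 3)
      + (1/2) * (v1 * w 4 + w4 * v 1 - v4 * w 1 - w1 * v 4)
  · linear_combination (-1/2) * (v1 * w 3 + w3 * v 1 - v3 * w 1 - w1 * v 3)
  · linear_combination (-1/2) * (v3 * w 4 + w4 * v 3 - v4 * w 3 - w3 * v 4)

theorem pluck_smul_right (c : ℝ) (v w : J1) : pluck v (c • w) = c • pluck v w := by
  ext i; fin_cases i <;> simp [pluck] <;> ring

/-- Vectors `v`, `w` of the Cartan plane span a characteristic plane if the coefficients of the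
equation are those given by `v` and `w`. -/
theorem HypEq.charPlane_eq_span (E : HypEq) {ε : ℝ} {a v w : J1} (hv : contactForm a v = 0)
    (hw : contactForm a w = 0) (hc : E.coeff a = pluck v w)
    (hε : Om v w = ε * √(E.disc a)) (h0 : Om v w ≠ 0) :
    E.charPlane ε a = Submodule.span ℝ {v, w} := by
  ext u
  rw [E.mem_charPlane, hc, ← hε, Submodule.mem_span_pair]
  constructor
  · rintro ⟨hu, h⟩
    rw [jop_pluck hv hw hu] at h
    refine ⟨Om u w / Om v w, -(Om u v / Om v w), ?_⟩
    have e : Om u w • v - Om u v • w = Om v w • u := by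
      have h2 : (2 : ℝ) • (Om u w • v - Om u v • w) = (2 : ℝ) • (Om v w • u) := by
        rw [two_smul ℝ (Om v w • u)]
        nth_rewrite 1 [← h]
        module
      exact smul_right_injective _ two_ne_zero h2
    have : u = (Om v w)⁻¹ • (Om u w • v - Om u v • w) := by
      rw [e, smul_smul, inv_mul_cancel₀ h0, one_smul]
    nth_rewrite 3 [this]
    module
  · rintro ⟨s, t, rfl⟩
    have hu : contactForm a (s • v + t • w) = 0 := by simp [hv, hw]
    refine ⟨hu, ?_⟩
    rw [jop_pluck hv hw hu]
    simp only [Om_add_left, Om_smul_left, Om_self, Om_swap v w]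
    module

/-! ### Smooth germs -/

section Smooth

variable {F G : Type*} [NormedAddCommGroup F] [NormedSpace ℝ F]
  [NormedAddCommGroup G] [NormedSpace ℝ G]

/-- `f` is smooth on a neighbourhood of `a`. -/
def SmoothAt (f : J1 → F) (a : J1) : Prop := ∀ᶠ y in 𝓝 a, ContDiffAt ℝ ∞ f y

namespace SmoothAt

variable {f g : J1 → F} {a : J1}

/-- Being `C^∞` at one point gives `C^n` neighbourhoods that may shrink with `n`. Requiring
smoothness nearby makes the notion open, so that derivatives and brackets stay inside it. -/
theorem eventually (h : SmoothAt f a) : ∀ᶠ y in 𝓝 a, SmoothAt f y :=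
  eventually_eventually_nhds.2 h

theorem contDiffAt (h : SmoothAt f a) : ContDiffAt ℝ ∞ f a := h.self_of_nhds

theorem differentiableAt (h : SmoothAt f a) : DifferentiableAt ℝ f a :=
  h.contDiffAt.differentiableAt (by simp)

theorem continuousAt (h : SmoothAt f a) : ContinuousAt f a := h.contDiffAt.continuousAt

theorem of_contDiffOn {s : Set J1} (hs : s ∈ 𝓝 a) (h : ContDiffOn ℝ ∞ f s) : SmoothAt f a := by
  filter_upwards [eventually_mem_nhds_iff.2 hs] with y hy using h.contDiffAt hy

theorem of_contDiff (h : ContDiff ℝ ∞ f) : SmoothAt f a :=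
  Eventually.of_forall fun _ => h.contDiffAt

theorem const (c : F) : SmoothAt (fun _ => c) a := of_contDiff contDiff_const

theorem congr (h : SmoothAt f a) (hg : g =ᶠ[𝓝 a] f) : SmoothAt g a := by
  filter_upwards [h, eventually_eventually_nhds.2 hg] with y hy hgy
  exact hy.congr_of_eventuallyEq hgy

theorem add (hf : SmoothAt f a) (hg : SmoothAt g a) : SmoothAt (fun x => f x + g x) a := by
  filter_upwards [hf, hg] with y h1 h2 using h1.add h2

theorem sub (hf : SmoothAt f a) (hg : SmoothAt g a) : SmoothAt (fun x => f x - g x) a := by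
  filter_upwards [hf, hg] with y h1 h2 using h1.sub h2

theorem neg (hf : SmoothAt f a) : SmoothAt (fun x => -f x) a := by
  filter_upwards [hf] with y h1 using h1.neg

theorem smul {c : J1 → ℝ} (hc : SmoothAt c a) (hf : SmoothAt f a) :
    SmoothAt (fun x => c x • f x) a := by
  filter_upwards [hc, hf] with y h1 h2 using h1.smul h2

theorem mul {c d : J1 → ℝ} (hc : SmoothAt c a) (hd : SmoothAt d a) :
    SmoothAt (fun x => c x * d x) a := by
  filter_upwards [hc, hd] with y h1 h2 using h1.mul h2

theorem pow {c : J1 → ℝ} (hc : SmoothAt c a) (n : ℕ) : SmoothAt (fun x => c x ^ n) a := by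
  filter_upwards [hc] with y h1 using h1.pow n

theorem inv {c : J1 → ℝ} (hc : SmoothAt c a) (h0 : c a ≠ 0) : SmoothAt (fun x => (c x)⁻¹) a := by
  filter_upwards [hc, hc.continuousAt.eventually_ne h0] with y h1 h2 using h1.inv h2

theorem div {c d : J1 → ℝ} (hc : SmoothAt c a) (hd : SmoothAt d a) (h0 : d a ≠ 0) :
    SmoothAt (fun x => c x / d x) a := by
  simp only [div_eq_mul_inv]
  exact hc.mul (hd.inv h0)

theorem sqrt {c : J1 → ℝ} (hc : SmoothAt c a) (h0 : c a ≠ 0) : SmoothAt (fun x => √(c x)) a := by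
  filter_upwards [hc, hc.continuousAt.eventually_ne h0] with y h1 h2 using h1.sqrt h2

theorem abs {c : J1 → ℝ} (hc : SmoothAt c a) (h0 : c a ≠ 0) : SmoothAt (fun x => |c x|) a := by
  filter_upwards [hc, hc.continuousAt.eventually_ne h0] with y h1 h2 using h1.abs h2

theorem sum {ι : Type*} {s : Finset ι} {f : ι → J1 → F} (h : ∀ i ∈ s, SmoothAt (f i) a) :
    SmoothAt (fun x => ∑ i ∈ s, f i x) a := by
  have : ∀ᶠ y in 𝓝 a, ∀ i ∈ s, ContDiffAt ℝ ∞ (f i) y := (s.eventually_all).2 h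
  filter_upwards [this] with y hy using ContDiffAt.sum hy

theorem prod {ι : Type*} {s : Finset ι} {f : ι → J1 → ℝ} (h : ∀ i ∈ s, SmoothAt (f i) a) :
    SmoothAt (fun x => ∏ i ∈ s, f i x) a := by
  have : ∀ᶠ y in 𝓝 a, ∀ i ∈ s, ContDiffAt ℝ ∞ (f i) y := (s.eventually_all).2 h
  filter_upwards [this] with y hy using contDiffAt_prod hy

theorem pi {ι : Type*} [Fintype ι] {f : J1 → ι → F} (h : ∀ i, SmoothAt (fun x => f x i) a) :
    SmoothAt f a := by
  filter_upwards [eventually_all.2 h] with y hy using contDiffAt_pi.2 hy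

theorem apply {ι : Type*} [Fintype ι] {f : J1 → ι → F} (h : SmoothAt f a) (i : ι) :
    SmoothAt (fun x => f x i) a := by
  filter_upwards [h] with y hy using contDiffAt_pi.1 hy i

theorem coord (i : Fin 5) : SmoothAt (fun x : J1 => x i) a :=
  of_contDiff (contDiff_apply ℝ ℝ i)

theorem fderiv (h : SmoothAt f a) : SmoothAt (fun x => fderiv ℝ f x) a := by
  filter_upwards [h] with y hy using hy.fderiv_right (by simp)

theorem fderiv_apply {V : J1 → J1} (h : SmoothAt f a) (hV : SmoothAt V a) :
    SmoothAt (fun x => _root_.fderiv ℝ f x (V x)) a := by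
  filter_upwards [h.fderiv, hV] with y h1 h2 using h1.clm_apply h2

theorem lieBracket {V W : J1 → J1} (hV : SmoothAt V a) (hW : SmoothAt W a) :
    SmoothAt (VectorField.lieBracket ℝ V W) a :=
  (hW.fderiv_apply hV).sub (hV.fderiv_apply hW)

end SmoothAt

end Smooth

theorem isLocalSection_iff {P : J1 → Submodule ℝ J1} {X : J1 → J1} {a : J1} :
    IsLocalSection P X a ↔ SmoothAt X a ∧ ∀ᶠ y in 𝓝 a, X y ∈ P y := by
  constructor
  · rintro ⟨W, hW, hX, hP⟩
    exact ⟨.of_contDiffOn hW hX, by filter_upwards [hW] with y hy using hP y hy⟩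
  · rintro ⟨hX, hP⟩
    refine ⟨_, inter_mem hX hP, fun y hy => ?_, fun y hy => hy.2⟩
    exact (show ContDiffAt ℝ ∞ X y from hy.1).contDiffWithinAt

/-! ### Coordinates with respect to a frame -/

/-- The coordinates of `v` in the frame `X` at `a`. -/
def coords (X : Fin 5 → J1 → J1) (a v : J1) (i : Fin 5) : ℝ :=
  ((Matrix.of fun m l => X l a m)⁻¹.mulVec v) i

theorem brk_eq_coords (X : Fin 5 → J1 → J1) (i j k : Fin 5) (a : J1) :
    brk X i j k a = coords X a (VectorField.lieBracket ℝ (X j) (X k) a) i := rfl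

/-- The determinant of the frame `X` at `a`. -/
def frameDet (X : Fin 5 → J1 → J1) (a : J1) : ℝ :=
  (Matrix.of fun m l => X l a m : Matrix (Fin 5) (Fin 5) ℝ).det

theorem frameDet_ne_zero_iff {X : Fin 5 → J1 → J1} {a : J1} :
    frameDet X a ≠ 0 ↔ LinearIndependent ℝ fun i => X i a := by
  rw [frameDet, ← Matrix.det_transpose, ← isUnit_iff_ne_zero, ← Matrix.isUnit_iff_isUnit_det,
    ← Matrix.linearIndependent_rows_iff_isUnit]
  rfl

section

variable {X : Fin 5 → J1 → J1} {a : J1}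

theorem mulVec_frame (c : Fin 5 → ℝ) :
    (Matrix.of fun m l => X l a m : Matrix (Fin 5) (Fin 5) ℝ).mulVec c = ∑ i, c i • X i a := by
  ext m
  simp [Matrix.mulVec, dotProduct, mul_comm]

theorem sum_coords (h : frameDet X a ≠ 0) (v : J1) : ∑ i, coords X a v i • X i a = v := by
  have := mulVec_frame (X := X) (a := a) (coords X a v)
  rw [← this]
  change Matrix.mulVec _ (Matrix.mulVec _ v) = v
  rw [Matrix.mulVec_mulVec, Matrix.mul_nonsing_inv _ (isUnit_iff_ne_zero.2 h), Matrix.one_mulVec]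

theorem coords_sum (h : frameDet X a ≠ 0) (c : Fin 5 → ℝ) :
    coords X a (∑ i, c i • X i a) = c := by
  rw [← mulVec_frame]
  change Matrix.mulVec _ (Matrix.mulVec _ c) = c
  rw [Matrix.mulVec_mulVec, Matrix.nonsing_inv_mul _ (isUnit_iff_ne_zero.2 h), Matrix.one_mulVec]

theorem coords_add (v w : J1) : coords X a (v + w) = coords X a v + coords X a w :=
  Matrix.mulVec_add _ _ _

theorem coords_smul (c : ℝ) (v : J1) : coords X a (c • v) = c • coords X a v :=
  Matrix.mulVec_smul _ _ _

theorem coords_neg (v : J1) : coords X a (-v) = -coords X a v := Matrix.mulVec_neg _ _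

theorem coords_sub (v w : J1) : coords X a (v - w) = coords X a v - coords X a w :=
  Matrix.mulVec_sub _ _ _

theorem coords_frame (h : frameDet X a ≠ 0) (i : Fin 5) :
    coords X a (X i a) = Pi.single i 1 := by
  rw [← coords_sum h (Pi.single i 1)]
  simp [Pi.single_apply]

/-- The coordinates as a linear map. -/
def coordsₗ (X : Fin 5 → J1 → J1) (a : J1) : J1 →ₗ[ℝ] (Fin 5 → ℝ) where
  toFun := coords X a
  map_add' := coords_add
  map_smul' := coords_smul

theorem mem_span_frame_iff (h : frameDet X a ≠ 0) (S : Set (Fin 5)) (v : J1) :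
    v ∈ Submodule.span ℝ ((fun i => X i a) '' S) ↔ ∀ i ∉ S, coords X a v i = 0 := by
  constructor
  · intro hv i hi
    induction hv using Submodule.span_induction with
    | mem x hx =>
      obtain ⟨j, hj, rfl⟩ := hx
      simp only
      rw [coords_frame h, Pi.single_eq_of_ne]
      rintro rfl
      exact hi hj
    | zero => exact congrFun (map_zero (coordsₗ X a)) i
    | add x y _ _ hx hy => rw [coords_add, Pi.add_apply, hx, hy, add_zero]
    | smul c x _ hx => rw [coords_smul, Pi.smul_apply, hx, smul_zero]
  · intro hv
    rw [← sum_coords h v]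
    refine Submodule.sum_mem _ fun i _ => ?_
    by_cases hi : i ∈ S
    · exact Submodule.smul_mem _ _ (Submodule.subset_span ⟨i, hi, rfl⟩)
    · rw [hv i hi, zero_smul]; exact zero_mem _

theorem span_frame_univ (h : frameDet X a ≠ 0) :
    Submodule.span ℝ (Set.range fun i => X i a) = ⊤ := by
  rw [eq_top_iff, ← Set.image_univ]
  intro v _
  rw [mem_span_frame_iff h]
  simp

theorem SmoothAt.det {n : ℕ} {M : J1 → Matrix (Fin n) (Fin n) ℝ}
    (h : ∀ i j, SmoothAt (fun x => M x i j) a) : SmoothAt (fun x => (M x).det) a := by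
  simp only [Matrix.det_apply']
  exact SmoothAt.sum fun σ _ => (SmoothAt.const _).mul (SmoothAt.prod fun i _ => h _ _)

theorem SmoothAt.matrix_inv {n : ℕ} {M : J1 → Matrix (Fin n) (Fin n) ℝ}
    (h : ∀ i j, SmoothAt (fun x => M x i j) a) (h0 : (M a).det ≠ 0) (i j : Fin n) :
    SmoothAt (fun x => (M x)⁻¹ i j) a := by
  simp only [Matrix.inv_def, Ring.inverse_eq_inv', Matrix.smul_apply, smul_eq_mul,
    Matrix.adjugate_apply]
  refine ((SmoothAt.det h).inv h0).mul (SmoothAt.det fun k l => ?_)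
  simp only [Matrix.updateRow_apply]
  split_ifs
  · exact SmoothAt.const _
  · exact h k l

theorem SmoothAt.frameDet (hX : ∀ i, SmoothAt (X i) a) : SmoothAt (frameDet X) a :=
  SmoothAt.det fun i j => (hX j).apply i

theorem SmoothAt.coords (hX : ∀ i, SmoothAt (X i) a) (h : MongeAmpere.frameDet X a ≠ 0)
    {V : J1 → J1} (hV : SmoothAt V a) (i : Fin 5) :
    SmoothAt (fun x => MongeAmpere.coords X x (V x) i) a := by
  simp only [MongeAmpere.coords, Matrix.mulVec, dotProduct]
  exact SmoothAt.sum fun j _ =>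
    (SmoothAt.matrix_inv (fun k l => (hX l).apply k) h i j).mul (hV.apply j)

theorem SmoothAt.brk (hX : ∀ i, SmoothAt (X i) a) (h : MongeAmpere.frameDet X a ≠ 0)
    (i j k : Fin 5) : SmoothAt (brk X i j k) a :=
  SmoothAt.coords hX h ((hX j).lieBracket (hX k)) i

theorem eventually_frameDet (hX : ∀ i, SmoothAt (X i) a) (h : frameDet X a ≠ 0) :
    ∀ᶠ y in 𝓝 a, frameDet X y ≠ 0 :=
  (SmoothAt.frameDet hX).continuousAt.eventually_ne h

end

/-! ### Brackets -/

theorem fderiv_sum_smul {ι : Type*} [Fintype ι] {c : ι → J1 → ℝ} {X : ι → J1 → J1} {a : J1}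
    (hc : ∀ i, DifferentiableAt ℝ (c i) a) (hX : ∀ i, DifferentiableAt ℝ (X i) a) (v : J1) :
    fderiv ℝ (fun x => ∑ i, c i x • X i x) a v =
      ∑ i, (c i a • fderiv ℝ (X i) a v + fderiv ℝ (c i) a v • X i a) := by
  have : HasFDerivAt (fun x => ∑ i, c i x • X i x)
      (∑ i, (c i a • fderiv ℝ (X i) a + (fderiv ℝ (c i) a).smulRight (X i a))) a :=
    HasFDerivAt.fun_sum fun i _ => (hc i).hasFDerivAt.smul (hX i).hasFDerivAt
  rw [this.fderiv]
  simp

theorem lieBracket_sum_smul_right {ι : Type*} [Fintype ι] {c : ι → J1 → ℝ} {X : ι → J1 → J1}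
    {V : J1 → J1} {a : J1}
    (hc : ∀ i, DifferentiableAt ℝ (c i) a) (hX : ∀ i, DifferentiableAt ℝ (X i) a) :
    VectorField.lieBracket ℝ V (fun x => ∑ i, c i x • X i x) a =
      ∑ i, (c i a • VectorField.lieBracket ℝ V (X i) a + fderiv ℝ (c i) a (V a) • X i a) := by
  simp only [VectorField.lieBracket]
  rw [fderiv_sum_smul hc hX, map_sum, ← Finset.sum_sub_distrib]
  refine Finset.sum_congr rfl fun i _ => ?_
  rw [map_smul]
  module

theorem lieBracket_sum_smul_left {ι : Type*} [Fintype ι] {c : ι → J1 → ℝ} {X : ι → J1 → J1}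
    {V : J1 → J1} {a : J1}
    (hc : ∀ i, DifferentiableAt ℝ (c i) a) (hX : ∀ i, DifferentiableAt ℝ (X i) a) :
    VectorField.lieBracket ℝ (fun x => ∑ i, c i x • X i x) V a =
      ∑ i, (c i a • VectorField.lieBracket ℝ (X i) V a - fderiv ℝ (c i) a (V a) • X i a) := by
  rw [VectorField.lieBracket_swap, lieBracket_sum_smul_right hc hX, ← Finset.sum_neg_distrib]
  refine Finset.sum_congr rfl fun i _ => ?_
  rw [VectorField.lieBracket_swap (V := V)]
  module

theorem lieBracket_congr {V V' W W' : J1 → J1} {a : J1} (hV : V =ᶠ[𝓝 a] V')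
    (hW : W =ᶠ[𝓝 a] W') :
    VectorField.lieBracket ℝ V W a = VectorField.lieBracket ℝ V' W' a := by
  simp only [VectorField.lieBracket, hV.fderiv_eq, hW.fderiv_eq, hV.self_of_nhds,
    hW.self_of_nhds]

/-- The value of the contact form on the bracket of two contact vector fields. -/
theorem contactForm_lieBracket {V W : J1 → J1} {a : J1} (hV : DifferentiableAt ℝ V a)
    (hW : DifferentiableAt ℝ W a) (hV0 : ∀ᶠ y in 𝓝 a, contactForm y (V y) = 0)
    (hW0 : ∀ᶠ y in 𝓝 a, contactForm y (W y) = 0) :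
    contactForm a (VectorField.lieBracket ℝ V W a) = -Om (V a) (W a) := by
  -- Differentiating the identity U(V) = 0 in the direction `u` expresses U(DV u) through the
  -- horizontal components of V; antisymmetrising gives dU.
  have key : ∀ V : J1 → J1, DifferentiableAt ℝ V a → (∀ᶠ y in 𝓝 a, contactForm y (V y) = 0) →
      ∀ u : J1, contactForm a (fderiv ℝ V a u) = u 3 * V a 0 + u 4 * V a 1 := by
    intro V hV hV0 u
    have hc : ∀ i, HasFDerivAt (fun x => V x i)
        ((ContinuousLinearMap.proj i : J1 →L[ℝ] ℝ).comp (fderiv ℝ V a)) a := fun i =>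
      (hasFDerivAt_pi'.1 hV.hasFDerivAt i)
    have hx : ∀ i, HasFDerivAt (fun x : J1 => x i) (ContinuousLinearMap.proj i : J1 →L[ℝ] ℝ) a :=
      fun i => hasFDerivAt_apply i a
    have h1 := ((hc 2).sub ((hx 3).mul (hc 0))).sub ((hx 4).mul (hc 1))
    have h0 : HasFDerivAt (fun x => V x 2 - x 3 * V x 0 - x 4 * V x 1) (0 : J1 →L[ℝ] ℝ) a := by
      refine (hasFDerivAt_const (0 : ℝ) a).congr_of_eventuallyEq ?_
      filter_upwards [hV0] with y hy
      rw [← hy, contactForm_apply]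
    have h2 := congrArg (fun L : J1 →L[ℝ] ℝ => L u) (h1.unique h0)
    simp at h2
    rw [contactForm_apply]
    linarith
  rw [VectorField.lieBracket, map_sub, key W hW hW0, key V hV hV0, Om]
  ring

/-- The derived distribution of a distribution generated by a part of a frame. -/
theorem derived_span {X : Fin 5 → J1 → J1} {a : J1} (hX : ∀ i, SmoothAt (X i) a)
    (h : frameDet X a ≠ 0) {P : J1 → Submodule ℝ J1} (S : Set (Fin 5))
    (hP : ∀ᶠ y in 𝓝 a, P y = Submodule.span ℝ ((fun i => X i y) '' S)) :
    derived P a = Submodule.span ℝ ((fun i => X i a) '' S) ⊔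
      Submodule.span ℝ {v | ∃ i ∈ S, ∃ j ∈ S, v = VectorField.lieBracket ℝ (X i) (X j) a} := by
  have hdet := eventually_frameDet hX h
  have hsec : ∀ i ∈ S, IsLocalSection P (X i) a := fun i hi =>
    isLocalSection_iff.2 ⟨hX i, by
      filter_upwards [hP] with y hy
      rw [hy]
      exact Submodule.subset_span ⟨i, hi, rfl⟩⟩
  apply le_antisymm
  · have hmem : ∀ Y, IsLocalSection P Y a → Y a ∈ Submodule.span ℝ ((fun i => X i a) '' S) :=
      fun Y hY => by
        have := (isLocalSection_iff.1 hY).2.self_of_nhds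
        rwa [hP.self_of_nhds] at this
    refine Submodule.span_le.2 ?_
    rintro v (⟨Y, hY, rfl⟩ | ⟨Y, Z, hY, hZ, rfl⟩)
    · exact Submodule.mem_sup_left (hmem Y hY)
    -- Local sections are combinations of the frame fields in `S`, and the other coefficients vanish
    -- near `a`, together with their derivatives. By the Leibniz rule only brackets of frame fields
    -- contribute beyond the distribution itself.
    · have hexp : ∀ Y, IsLocalSection P Y a → ∃ c : Fin 5 → J1 → ℝ,
          (∀ i, DifferentiableAt ℝ (c i) a) ∧ (∀ i ∉ S, ∀ᶠ y in 𝓝 a, c i y = 0) ∧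
          Y =ᶠ[𝓝 a] fun y => ∑ i, c i y • X i y := by
        intro Y hY
        obtain ⟨hs, hm⟩ := isLocalSection_iff.1 hY
        refine ⟨fun i y => coords X y (Y y) i, fun i => (SmoothAt.coords hX h hs i).differentiableAt,
          fun i hi => ?_, ?_⟩
        · filter_upwards [hm, hP, hdet] with y h1 h2 h3
          rw [h2, mem_span_frame_iff h3] at h1
          exact h1 i hi
        · filter_upwards [hdet] with y h3 using (sum_coords h3 _).symm
      obtain ⟨c, hc, hc0, hYc⟩ := hexp Y hY
      obtain ⟨e, he, he0, hZe⟩ := hexp Z hZ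
      have hXd := fun i => (hX i).differentiableAt
      have hzero : ∀ f : J1 → ℝ, (∀ᶠ y in 𝓝 a, f y = 0) → fderiv ℝ f a = 0 := fun f hf => by
        have : f =ᶠ[𝓝 a] fun _ => 0 := hf
        rw [this.fderiv_eq]
        simp
      rw [lieBracket_congr hYc hZe, lieBracket_sum_smul_right he hXd]
      refine Submodule.sum_mem _ fun j _ => Submodule.add_mem _ ?_ ?_
      · by_cases hj : j ∈ S
        · rw [lieBracket_sum_smul_left hc hXd]
          refine Submodule.smul_mem _ _ (Submodule.sum_mem _ fun i _ => Submodule.sub_mem _ ?_ ?_)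
          · by_cases hi : i ∈ S
            · exact Submodule.smul_mem _ _ (Submodule.mem_sup_right
                (Submodule.subset_span ⟨i, hi, j, hj, rfl⟩))
            · rw [(hc0 i hi).self_of_nhds, zero_smul]; exact zero_mem _
          · by_cases hi : i ∈ S
            · exact Submodule.smul_mem _ _ (Submodule.mem_sup_left
                (Submodule.subset_span ⟨i, hi, rfl⟩))
            · rw [hzero _ (hc0 i hi)]; simp
        · rw [(he0 j hj).self_of_nhds, zero_smul]; exact zero_mem _
      · by_cases hj : j ∈ S
        · exact Submodule.smul_mem _ _ (Submodule.mem_sup_left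
            (Submodule.subset_span ⟨j, hj, rfl⟩))
        · rw [hzero _ (he0 j hj)]; simp
  · refine sup_le (Submodule.span_le.2 ?_) (Submodule.span_le.2 ?_)
    · rintro _ ⟨i, hi, rfl⟩
      exact Submodule.subset_span (Or.inl ⟨X i, hsec i hi, rfl⟩)
    · rintro _ ⟨i, hi, j, hj, rfl⟩
      exact Submodule.subset_span (Or.inr ⟨X i, X j, hsec i hi, hsec j hj, rfl⟩)

/-! ### Adapted frames -/

namespace HypEq

variable {E : HypEq} {a : J1}

theorem coeff_smoothAt (ha : a ∈ E.dom) : SmoothAt E.coeff a :=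
  .of_contDiffOn (E.isOpen_dom.mem_nhds ha) E.smooth

theorem disc_smoothAt (ha : a ∈ E.dom) : SmoothAt E.disc a := by
  have h := coeff_smoothAt ha
  have h4 : SmoothAt (fun _ => (4 : ℝ)) a := SmoothAt.const 4
  exact (((h.apply 2).pow 2).sub ((h4.mul (h.apply 1)).mul (h.apply 3))).add
    ((h4.mul (h.apply 0)).mul (h.apply 4))

theorem sqrt_disc_smoothAt (ha : a ∈ E.dom) : SmoothAt (fun y => √(E.disc y)) a :=
  (disc_smoothAt ha).sqrt (E.hyperbolic a ha).ne'

theorem eventually_dom (ha : a ∈ E.dom) : ∀ᶠ y in 𝓝 a, y ∈ E.dom := E.isOpen_dom.mem_nhds ha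

/-- Since J² = Δ on the Cartan plane, (J - ε√Δ)(J + ε√Δ) = 0 there. This is the source of smooth
sections of the characteristic distributions. -/
theorem jop_add_mem {ε : ℝ} (hε : ε ^ 2 = 1) (ha : a ∈ E.dom) {u : J1}
    (hu : contactForm a u = 0) :
    jop (E.coeff a) a u + (ε * √(E.disc a)) • u ∈ E.charPlane ε a := by
  rw [mem_charPlane]
  refine ⟨by rw [map_add, contactForm_jop, map_smul, hu, smul_zero, add_zero], ?_⟩
  have e : discForm (E.coeff a) = (ε * √(E.disc a)) * (ε * √(E.disc a)) := by
    have := E.sq_sqrt_disc ha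
    rw [← E.disc_eq]
    linear_combination (-(√(E.disc a)) ^ 2) * hε - this
  rw [jop_add, jop_jop _ hu, jop_smul, e]
  module

theorem SmoothAt_jop {V : J1 → J1} {c : J1 → Fin 5 → ℝ} (hc : SmoothAt c a) (hV : SmoothAt V a) :
    SmoothAt (fun y => jop (c y) y (V y)) a := by
  have h2 : SmoothAt (fun _ => (2 : ℝ)) a := SmoothAt.const 2
  have hn : SmoothAt (fun _ => (-2 : ℝ)) a := SmoothAt.const (-2)
  have h0 := (((hc.apply 2).mul (hV.apply 0)).sub ((h2.mul (hc.apply 1)).mul (hV.apply 1))).sub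
    ((h2.mul (hc.apply 0)).mul (hV.apply 4))
  have h1 := (((h2.mul (hc.apply 3)).mul (hV.apply 0)).sub ((hc.apply 2).mul (hV.apply 1))).add
    ((h2.mul (hc.apply 0)).mul (hV.apply 3))
  refine SmoothAt.pi fun i => ?_
  fin_cases i
  · exact h0
  · exact h1
  · exact ((SmoothAt.coord 3).mul h0).add ((SmoothAt.coord 4).mul h1)
  · exact (((h2.mul (hc.apply 4)).mul (hV.apply 1)).add ((hc.apply 2).mul (hV.apply 3))).add
      ((h2.mul (hc.apply 3)).mul (hV.apply 4))
  · exact (((hn.mul (hc.apply 4)).mul (hV.apply 0)).sub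
      ((h2.mul (hc.apply 1)).mul (hV.apply 3))).sub ((hc.apply 2).mul (hV.apply 4))

theorem SmoothAt_Om {V W : J1 → J1} (hV : SmoothAt V a) (hW : SmoothAt W a) :
    SmoothAt (fun y => Om (V y) (W y)) a :=
  ((((hV.apply 0).mul (hW.apply 3)).sub ((hV.apply 3).mul (hW.apply 0))).add
    ((hV.apply 1).mul (hW.apply 4))).sub ((hV.apply 4).mul (hW.apply 1))

/-- The contact vector field with given constant components along `x`, `y`, `p`, `q`. -/
def contactLift (u : J1) (y : J1) : J1 := ![u 0, u 1, y 3 * u 0 + y 4 * u 1, u 3, u 4]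

theorem contactLift_mem (u y : J1) : contactForm y (contactLift u y) = 0 := by
  simp [contactForm_apply, contactLift]

theorem contactLift_self {u y : J1} (h : contactForm y u = 0) : contactLift u y = u :=
  cartan_ext (contactLift_mem u y) h rfl rfl rfl rfl

theorem contactLift_smoothAt (u : J1) : SmoothAt (contactLift u) a := by
  refine SmoothAt.pi fun i => ?_
  fin_cases i
  · exact SmoothAt.const _
  · exact SmoothAt.const _
  · exact ((SmoothAt.coord 3).mul (SmoothAt.const _)).add
      ((SmoothAt.coord 4).mul (SmoothAt.const _))
  · exact SmoothAt.const _
  · exact SmoothAt.const _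

/-- Each characteristic distribution has a smooth frame whose coefficient vector is that of the
equation. -/
theorem exists_pluck (ha : a ∈ E.dom) {ε : ℝ} (hε : ε ^ 2 = 1) :
    ∃ X Y : J1 → J1, SmoothAt X a ∧ SmoothAt Y a ∧ ∀ᶠ y in 𝓝 a,
      contactForm y (X y) = 0 ∧ contactForm y (Y y) = 0 ∧ E.coeff y = pluck (X y) (Y y) ∧
      Om (X y) (Y y) = ε * √(E.disc y) := by
  set Z : J1 → J1 → J1 := fun u y =>
    jop (E.coeff y) y (contactLift u y) + (ε * √(E.disc y)) • contactLift u y with hZ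
  have hs : SmoothAt (fun y => ε * √(E.disc y)) a :=
    (SmoothAt.const ε).mul (sqrt_disc_smoothAt ha)
  have hZs : ∀ u, SmoothAt (Z u) a := fun u =>
    (SmoothAt_jop (coeff_smoothAt ha) (contactLift_smoothAt u)).add
      (hs.smul (contactLift_smoothAt u))
  have hd := E.sqrt_disc_pos ha
  have hε0 : ε ≠ 0 := by rintro rfl; norm_num at hε
  -- Self-adjointness reduces the pairing of two projected fields to `2 ε √Δ * Om (Z u) w`. The two
  -- trial values `e1` and `e2` add up to `2 ε √Δ`, so they cannot both vanish.
  have hOm : ∃ u w : J1, Om (Z u a) (Z w a) ≠ 0 := by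
    have key : ∀ u w : J1, Om (Z u a) (Z w a) = 2 * (ε * √(E.disc a)) *
        Om (Z u a) (contactLift w a) := by
      intro u w
      have h1 := (E.mem_charPlane.1 (jop_add_mem hε ha (contactLift_mem u a))).2
      change jop (E.coeff a) a (Z u a) = _ • Z u a at h1
      have h2 : Om (Z u a) (Z w a) = Om (Z u a) (jop (E.coeff a) a (contactLift w a)) +
          (ε * √(E.disc a)) * Om (Z u a) (contactLift w a) := by
        rw [← Om_smul_right, ← Om_add_right]
      rw [h2, ← Om_jop_left, h1, Om_smul_left]
      ring
    have e1 : Om (Z ![1, 0, 0, 0, 0] a) (contactLift ![0, 0, 0, 1, 0] a) =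
        E.coeff a 2 + ε * √(E.disc a) := by
      simp [hZ, Om, contactLift, jop]
    have e2 : Om (Z ![0, 1, 0, 0, 0] a) (contactLift ![0, 0, 0, 0, 1] a) =
        -E.coeff a 2 + ε * √(E.disc a) := by
      simp [hZ, Om, contactLift, jop]
    have hne : ε * √(E.disc a) ≠ 0 := mul_ne_zero hε0 hd.ne'
    by_cases h : E.coeff a 2 + ε * √(E.disc a) = 0
    · refine ⟨![0, 1, 0, 0, 0], ![0, 0, 0, 0, 1], ?_⟩
      rw [key, e2]
      refine mul_ne_zero (mul_ne_zero two_ne_zero hne) fun h' => hne ?_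
      linarith
    · refine ⟨![1, 0, 0, 0, 0], ![0, 0, 0, 1, 0], ?_⟩
      rw [key, e1]
      exact mul_ne_zero (mul_ne_zero two_ne_zero hne) h
  obtain ⟨u, w, huw⟩ := hOm
  have hO := SmoothAt_Om (hZs u) (hZs w)
  -- By `pluck_smul_of_eigen` the Plücker vector of the two fields is proportional to the
  -- coefficients; this rescaling of the second field removes the factor.
  refine ⟨Z u, fun y => (ε * √(E.disc y) / Om (Z u y) (Z w y)) • Z w y, hZs u,
    (hs.div hO huw).smul (hZs w), ?_⟩
  filter_upwards [eventually_dom ha, hO.continuousAt.eventually_ne huw] with y hy hne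
  have hu := E.mem_charPlane.1 (jop_add_mem hε hy (contactLift_mem u y))
  have hw := E.mem_charPlane.1 (jop_add_mem hε hy (contactLift_mem w y))
  refine ⟨hu.1, by rw [map_smul, hw.1, smul_zero], ?_, ?_⟩
  · have := pluck_smul_of_eigen hu.2 hw.2
    change (ε * √(E.disc y)) • pluck (Z u y) (Z w y) = Om (Z u y) (Z w y) • _ at this
    rw [pluck_smul_right, div_eq_inv_mul, mul_smul, this, smul_smul, inv_mul_cancel₀ hne, one_smul]
  · rw [Om_smul_right, div_mul_cancel₀ _ hne]

theorem exists_pluck_at (ha : a ∈ E.dom) {ε : ℝ} (hε : ε ^ 2 = 1) :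
    ∃ v w : J1, contactForm a v = 0 ∧ contactForm a w = 0 ∧ E.coeff a = pluck v w ∧
      Om v w = ε * √(E.disc a) ∧ E.charPlane ε a = Submodule.span ℝ {v, w} := by
  obtain ⟨X, Y, -, -, h⟩ := exists_pluck ha hε
  obtain ⟨h1, h2, h3, h4⟩ := h.self_of_nhds
  refine ⟨_, _, h1, h2, h3, h4, E.charPlane_eq_span h1 h2 h3 h4 ?_⟩
  rw [h4]
  refine mul_ne_zero ?_ (E.sqrt_disc_pos ha).ne'
  rintro rfl
  norm_num at hε

theorem Om_ne_zero_of_span (ha : a ∈ E.dom) {ε : ℝ} (hε : ε ^ 2 = 1) {v w : J1}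
    (h : E.charPlane ε a = Submodule.span ℝ {v, w}) : Om v w ≠ 0 := by
  obtain ⟨v', w', -, -, -, hO, hs⟩ := exists_pluck_at ha hε
  have hne : Om v' w' ≠ 0 := by
    rw [hO]
    refine mul_ne_zero ?_ (E.sqrt_disc_pos ha).ne'
    rintro rfl
    norm_num at hε
  rw [h] at hs
  have hv : v' ∈ Submodule.span ℝ {v, w} := hs ▸ Submodule.subset_span (by simp)
  have hw : w' ∈ Submodule.span ℝ {v, w} := hs ▸ Submodule.subset_span (by simp)
  obtain ⟨s, t, rfl⟩ := Submodule.mem_span_pair.1 hv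
  obtain ⟨s', t', rfl⟩ := Submodule.mem_span_pair.1 hw
  intro h0
  apply hne
  simp only [Om_add_left, Om_add_right, Om_smul_left, Om_smul_right, Om_self, Om_swap v w, h0]
  ring

/-- J is self-adjoint for `Om` and the two eigenvalues differ. -/
theorem Om_eq_zero_of_mem (ha : a ∈ E.dom) {v w : J1} (hv : v ∈ E.D1 a) (hw : w ∈ E.D2 a) :
    Om v w = 0 := by
  have hv := (E.mem_charPlane.1 hv).2
  have hw := (E.mem_charPlane.1 hw).2
  have h := Om_jop_left (E.coeff a) a v w
  rw [hv, hw, Om_smul_left, Om_smul_right] at h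
  have := E.sqrt_disc_pos ha
  nlinarith

theorem disjoint_D1_D2 (ha : a ∈ E.dom) : Disjoint (E.D1 a) (E.D2 a) := by
  rw [Submodule.disjoint_def]
  intro v h1 h2
  have h1 := (E.mem_charPlane.1 h1).2
  have h2 := (E.mem_charPlane.1 h2).2
  rw [h1] at h2
  have h3 : (2 * √(E.disc a)) • v = 0 := by
    have : (1 * √(E.disc a)) • v - (-1 * √(E.disc a)) • v = 0 := sub_eq_zero.2 h2
    rw [← this]; module
  exact (smul_eq_zero.1 h3).resolve_left (mul_pos two_pos (E.sqrt_disc_pos ha)).ne'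

theorem D1_sup_D2 (ha : a ∈ E.dom) : E.D1 a ⊔ E.D2 a = cartan a := by
  apply le_antisymm
  · exact sup_le (fun v hv => hv.1) (fun v hv => hv.1)
  · intro v hv
    have hs := E.sqrt_disc_pos ha
    have h1 := jop_add_mem (E := E) (ε := 1) (by norm_num) ha hv
    have h2 := jop_add_mem (E := E) (ε := -1) (by norm_num) ha hv
    -- The decomposition 2√Δ v = (J + √Δ)v - (J - √Δ)v into eigenvectors.
    have e : v = (2 * √(E.disc a))⁻¹ • (jop (E.coeff a) a v + (1 * √(E.disc a)) • v) +
        (-(2 * √(E.disc a))⁻¹) • (jop (E.coeff a) a v + (-1 * √(E.disc a)) • v) := by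
      have : v = ((2 * √(E.disc a))⁻¹ * (2 * √(E.disc a))) • v := by
        rw [inv_mul_cancel₀ (by positivity), one_smul]
      nth_rewrite 1 [this]
      module
    rw [e]
    exact Submodule.add_mem_sup (Submodule.smul_mem _ _ h1) (Submodule.smul_mem _ _ h2)

end HypEq

/-- A smooth frame near `a` with `D¹ = ⟨X₁, X₂⟩`, `D² = ⟨X₃, X₄⟩`, normalised by
`[X₁, X₂] ≡ X₅ mod D¹` and `[X₃, X₄] ≡ -X₅ mod D²`. -/
structure Adapted (E : HypEq) (X : Fin 5 → J1 → J1) (a : J1) : Prop where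
  mem_dom : a ∈ E.dom
  smooth : ∀ i, SmoothAt (X i) a
  eventually' : ∀ᶠ y in 𝓝 a,
    E.D1 y = Submodule.span ℝ {X 0 y, X 1 y} ∧
    E.D2 y = Submodule.span ℝ {X 2 y, X 3 y} ∧
    VectorField.lieBracket ℝ (X 0) (X 1) y - X 4 y ∈ E.D1 y ∧
    VectorField.lieBracket ℝ (X 2) (X 3) y + X 4 y ∈ E.D2 y

namespace Adapted

variable {E : HypEq} {X : Fin 5 → J1 → J1} {a : J1}

theorem eventually (h : Adapted E X a) : ∀ᶠ y in 𝓝 a, Adapted E X y := by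
  filter_upwards [HypEq.eventually_dom h.mem_dom, eventually_all.2 fun i => (h.smooth i).eventually,
    eventually_eventually_nhds.2 h.eventually'] with y h1 h2 h3 using ⟨h1, h2, h3⟩

theorem D1_eq (h : Adapted E X a) : E.D1 a = Submodule.span ℝ {X 0 a, X 1 a} :=
  h.eventually'.self_of_nhds.1

theorem D2_eq (h : Adapted E X a) : E.D2 a = Submodule.span ℝ {X 2 a, X 3 a} :=
  h.eventually'.self_of_nhds.2.1

theorem mem0 (h : Adapted E X a) : X 0 a ∈ E.D1 a :=
  h.D1_eq ▸ Submodule.subset_span (by simp)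

theorem mem1 (h : Adapted E X a) : X 1 a ∈ E.D1 a :=
  h.D1_eq ▸ Submodule.subset_span (by simp)

theorem mem2 (h : Adapted E X a) : X 2 a ∈ E.D2 a :=
  h.D2_eq ▸ Submodule.subset_span (by simp)

theorem mem3 (h : Adapted E X a) : X 3 a ∈ E.D2 a :=
  h.D2_eq ▸ Submodule.subset_span (by simp)

theorem Om01 (h : Adapted E X a) : Om (X 0 a) (X 1 a) ≠ 0 :=
  HypEq.Om_ne_zero_of_span h.mem_dom (by norm_num : (1 : ℝ) ^ 2 = 1) h.D1_eq

theorem Om23 (h : Adapted E X a) : Om (X 2 a) (X 3 a) ≠ 0 :=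
  HypEq.Om_ne_zero_of_span h.mem_dom (by norm_num : (-1 : ℝ) ^ 2 = 1) h.D2_eq

theorem contactForm_lieBracket01 (h : Adapted E X a) :
    contactForm a (VectorField.lieBracket ℝ (X 0) (X 1) a) = -Om (X 0 a) (X 1 a) :=
  contactForm_lieBracket (h.smooth 0).differentiableAt (h.smooth 1).differentiableAt
    (h.eventually.mono fun _ hy => hy.mem0.1) (h.eventually.mono fun _ hy => hy.mem1.1)

theorem contactForm_lieBracket23 (h : Adapted E X a) :
    contactForm a (VectorField.lieBracket ℝ (X 2) (X 3) a) = -Om (X 2 a) (X 3 a) :=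
  contactForm_lieBracket (h.smooth 2).differentiableAt (h.smooth 3).differentiableAt
    (h.eventually.mono fun _ hy => hy.mem2.1) (h.eventually.mono fun _ hy => hy.mem3.1)

theorem contactForm4 (h : Adapted E X a) : contactForm a (X 4 a) = -Om (X 0 a) (X 1 a) := by
  have := h.eventually'.self_of_nhds.2.2.1.1
  rw [map_sub, h.contactForm_lieBracket01] at this
  linarith

theorem contactForm4' (h : Adapted E X a) : contactForm a (X 4 a) = Om (X 2 a) (X 3 a) := by
  have := h.eventually'.self_of_nhds.2.2.2.1
  rw [map_add, h.contactForm_lieBracket23] at this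
  linarith

theorem Om23_eq (h : Adapted E X a) : Om (X 2 a) (X 3 a) = -Om (X 0 a) (X 1 a) := by
  rw [← h.contactForm4', h.contactForm4]

/-- The contact form isolates the fifth coefficient, D¹ ∩ D² = 0 separates the two pairs, and `Om`
is non-degenerate on each characteristic plane. -/
theorem linearIndependent (h : Adapted E X a) : LinearIndependent ℝ fun i => X i a := by
  rw [Fintype.linearIndependent_iff]
  intro c hc
  rw [Fin.sum_univ_five] at hc
  have h4 : c 4 = 0 := by
    have := congrArg (contactForm a) hc
    simp only [map_add, map_smul, h.mem0.1, h.mem1.1, h.mem2.1, h.mem3.1, h.contactForm4,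
      smul_eq_mul, mul_zero, zero_add, map_zero] at this
    exact (mul_eq_zero.1 this).resolve_right (neg_ne_zero.2 h.Om01)
  rw [h4, zero_smul, add_zero] at hc
  have h1 : c 0 • X 0 a + c 1 • X 1 a = -(c 2 • X 2 a + c 3 • X 3 a) := by
    rw [eq_neg_iff_add_eq_zero, ← hc]; abel
  have m1 : c 0 • X 0 a + c 1 • X 1 a ∈ E.D1 a :=
    Submodule.add_mem _ (Submodule.smul_mem _ _ h.mem0) (Submodule.smul_mem _ _ h.mem1)
  have m2 : c 2 • X 2 a + c 3 • X 3 a ∈ E.D2 a :=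
    Submodule.add_mem _ (Submodule.smul_mem _ _ h.mem2) (Submodule.smul_mem _ _ h.mem3)
  have z1 : c 0 • X 0 a + c 1 • X 1 a = 0 :=
    Submodule.disjoint_def.1 (HypEq.disjoint_D1_D2 h.mem_dom) _ m1
      (h1 ▸ Submodule.neg_mem _ m2)
  have z2 : c 2 • X 2 a + c 3 • X 3 a = 0 := by
    rw [z1, zero_eq_neg] at h1; exact h1
  have key : ∀ (s t : ℝ) (v w : J1), Om v w ≠ 0 → s • v + t • w = 0 → s = 0 ∧ t = 0 := by
    intro s t v w hO hz
    have e1 : Om (s • v + t • w) w = 0 := by rw [hz]; simp [Om]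
    have e2 : Om (s • v + t • w) v = 0 := by rw [hz]; simp [Om]
    simp only [Om_add_left, Om_smul_left, Om_self, Om_swap v w] at e1 e2
    constructor
    · exact (mul_eq_zero.1 (by linarith : s * Om v w = 0)).resolve_right hO
    · exact (mul_eq_zero.1 (by linarith : t * Om v w = 0)).resolve_right hO
  obtain ⟨h0, h1⟩ := key _ _ _ _ h.Om01 z1
  obtain ⟨h2, h3⟩ := key _ _ _ _ h.Om23 z2
  intro i
  fin_cases i <;> assumption

theorem frameDet_ne (h : Adapted E X a) : frameDet X a ≠ 0 :=
  frameDet_ne_zero_iff.2 h.linearIndependent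

theorem span01 (y : J1) :
    Submodule.span ℝ {X 0 y, X 1 y} = Submodule.span ℝ ((fun i => X i y) '' {0, 1}) := by
  rw [Set.image_pair]

theorem span23 (y : J1) :
    Submodule.span ℝ {X 2 y, X 3 y} = Submodule.span ℝ ((fun i => X i y) '' {2, 3}) := by
  rw [Set.image_pair]

theorem mem_D1_iff (h : Adapted E X a) {v : J1} :
    v ∈ E.D1 a ↔ coords X a v 2 = 0 ∧ coords X a v 3 = 0 ∧ coords X a v 4 = 0 := by
  rw [h.D1_eq, span01, mem_span_frame_iff h.frameDet_ne]
  constructor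
  · intro H; exact ⟨H 2 (by decide), H 3 (by decide), H 4 (by decide)⟩
  · rintro ⟨h2, h3, h4⟩ i hi
    fin_cases i <;> simp_all

theorem mem_D2_iff (h : Adapted E X a) {v : J1} :
    v ∈ E.D2 a ↔ coords X a v 0 = 0 ∧ coords X a v 1 = 0 ∧ coords X a v 4 = 0 := by
  rw [h.D2_eq, span23, mem_span_frame_iff h.frameDet_ne]
  constructor
  · intro H; exact ⟨H 0 (by decide), H 1 (by decide), H 4 (by decide)⟩
  · rintro ⟨h2, h3, h4⟩ i hi
    fin_cases i <;> simp_all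

/-- The first derived distribution of `D¹`. -/
theorem derived_D1 (h : Adapted E X a) :
    derived E.D1 a = Submodule.span ℝ ((fun i => X i a) '' {0, 1, 4}) := by
  rw [derived_span h.smooth h.frameDet_ne {0, 1}
    (h.eventually'.mono fun y hy => by rw [hy.1, span01])]
  have hb := h.eventually'.self_of_nhds.2.2.1
  rw [h.D1_eq, span01] at hb
  have hle : Submodule.span ℝ ((fun i => X i a) '' {0, 1}) ≤
      Submodule.span ℝ ((fun i => X i a) '' {0, 1, 4}) :=
    Submodule.span_mono (Set.image_mono (by intro i; simp; tauto))
  have h01 : VectorField.lieBracket ℝ (X 0) (X 1) a ∈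
      Submodule.span ℝ ((fun i => X i a) '' {0, 1, 4}) := by
    rw [← sub_add_cancel (VectorField.lieBracket ℝ (X 0) (X 1) a) (X 4 a)]
    exact Submodule.add_mem _ (hle hb) (Submodule.subset_span ⟨4, by simp, rfl⟩)
  apply le_antisymm
  · refine sup_le hle (Submodule.span_le.2 ?_)
    rintro _ ⟨i, hi, j, hj, rfl⟩
    rcases hi with rfl | rfl <;> rcases hj with rfl | rfl
    · rw [VectorField.lieBracket_self]; exact zero_mem _
    · exact h01
    · rw [VectorField.lieBracket_swap]; exact Submodule.neg_mem _ h01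
    · rw [VectorField.lieBracket_self]; exact zero_mem _
  · refine Submodule.span_le.2 ?_
    rintro _ ⟨i, hi, rfl⟩
    rcases hi with rfl | rfl | rfl
    · exact Submodule.mem_sup_left (Submodule.subset_span ⟨0, by simp, rfl⟩)
    · exact Submodule.mem_sup_left (Submodule.subset_span ⟨1, by simp, rfl⟩)
    · simp only
      rw [← sub_sub_cancel (VectorField.lieBracket ℝ (X 0) (X 1) a) (X 4 a)]
      exact Submodule.sub_mem _
        (Submodule.mem_sup_right (Submodule.subset_span ⟨0, by simp, 1, by simp, rfl⟩))
        (Submodule.mem_sup_left hb)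

/-- The first derived distribution of `D²`. -/
theorem derived_D2 (h : Adapted E X a) :
    derived E.D2 a = Submodule.span ℝ ((fun i => X i a) '' {2, 3, 4}) := by
  rw [derived_span h.smooth h.frameDet_ne {2, 3}
    (h.eventually'.mono fun y hy => by rw [hy.2.1, span23])]
  have hb := h.eventually'.self_of_nhds.2.2.2
  rw [h.D2_eq, span23] at hb
  have hle : Submodule.span ℝ ((fun i => X i a) '' {2, 3}) ≤
      Submodule.span ℝ ((fun i => X i a) '' {2, 3, 4}) :=
    Submodule.span_mono (Set.image_mono (by intro i; simp; tauto))
  have h01 : VectorField.lieBracket ℝ (X 2) (X 3) a ∈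
      Submodule.span ℝ ((fun i => X i a) '' {2, 3, 4}) := by
    rw [← add_sub_cancel_right (VectorField.lieBracket ℝ (X 2) (X 3) a) (X 4 a)]
    exact Submodule.sub_mem _ (hle hb) (Submodule.subset_span ⟨4, by simp, rfl⟩)
  apply le_antisymm
  · refine sup_le hle (Submodule.span_le.2 ?_)
    rintro _ ⟨i, hi, j, hj, rfl⟩
    rcases hi with rfl | rfl <;> rcases hj with rfl | rfl
    · rw [VectorField.lieBracket_self]; exact zero_mem _
    · exact h01
    · rw [VectorField.lieBracket_swap]; exact Submodule.neg_mem _ h01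
    · rw [VectorField.lieBracket_self]; exact zero_mem _
  · refine Submodule.span_le.2 ?_
    rintro _ ⟨i, hi, rfl⟩
    rcases hi with rfl | rfl | rfl
    · exact Submodule.mem_sup_left (Submodule.subset_span ⟨2, by simp, rfl⟩)
    · exact Submodule.mem_sup_left (Submodule.subset_span ⟨3, by simp, rfl⟩)
    · simp only
      rw [← add_sub_cancel_left (VectorField.lieBracket ℝ (X 2) (X 3) a) (X 4 a)]
      exact Submodule.sub_mem _ (Submodule.mem_sup_left hb)
        (Submodule.mem_sup_right (Submodule.subset_span ⟨2, by simp, 3, by simp, rfl⟩))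

/-- The condition on D³ in `IsAdaptedFrame` is automatic, which is why `Adapted` omits it. -/
theorem D3_eq (h : Adapted E X a) : E.D3 a = Submodule.span ℝ {X 4 a} := by
  have : ({X 4 a} : Set J1) = (fun i => X i a) '' {4} := by simp
  rw [HypEq.D3, h.derived_D1, h.derived_D2, this]
  ext v
  rw [Submodule.mem_inf, mem_span_frame_iff h.frameDet_ne, mem_span_frame_iff h.frameDet_ne,
    mem_span_frame_iff h.frameDet_ne]
  constructor
  · rintro ⟨h1, h2⟩ i hi
    by_cases h' : i ∈ ({0, 1, 4} : Set (Fin 5))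
    · refine h2 i fun h'' => hi ?_
      fin_cases i <;> simp_all
    · exact h1 i h'
  · intro H
    constructor <;> intro i hi <;> exact H i (by rintro rfl; simp at hi)

theorem isAdaptedFrame (h : Adapted E X a) : IsAdaptedFrame E X a := by
  refine ⟨{y | Adapted E X y ∧ ∀ i, ContDiffAt ℝ ∞ (X i) y},
    inter_mem h.eventually (eventually_all.2 h.smooth), fun i y hy => (hy.2 i).contDiffWithinAt,
    fun y hy => ?_⟩
  obtain ⟨h1, h2, h3, h4⟩ := hy.1.eventually'.self_of_nhds
  exact ⟨h1, h2, hy.1.D3_eq, h3, h4⟩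

end Adapted

theorem IsAdaptedFrame.adapted {E : HypEq} {X : Fin 5 → J1 → J1} {a : J1}
    (h : IsAdaptedFrame E X a) (ha : a ∈ E.dom) : Adapted E X a := by
  obtain ⟨W, hW, hX, h⟩ := h
  refine ⟨ha, fun i => .of_contDiffOn hW (hX i), ?_⟩
  filter_upwards [hW] with y hy
  obtain ⟨h1, h2, -, h3, h4⟩ := h y hy
  exact ⟨h1, h2, h3, h4⟩

/-- Completion of frames of the characteristic distributions to an adapted frame. -/
theorem exists_adapted_extension {E : HypEq} {Z : Fin 4 → J1 → J1} {a : J1} (ha : a ∈ E.dom)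
    (hZ : ∀ i, SmoothAt (Z i) a)
    (h : ∀ᶠ y in 𝓝 a, E.D1 y = Submodule.span ℝ {Z 0 y, Z 1 y} ∧
      E.D2 y = Submodule.span ℝ {Z 2 y, Z 3 y} ∧ Om (Z 2 y) (Z 3 y) = -Om (Z 0 y) (Z 1 y)) :
    Adapted E ![Z 0, Z 1, Z 2, Z 3, fun y =>
      VectorField.lieBracket ℝ (Z 0) (Z 1) y - (2 * √(E.disc y))⁻¹ •
        (jop (E.coeff y) y (VectorField.lieBracket ℝ (Z 0) (Z 1) y +
          VectorField.lieBracket ℝ (Z 2) (Z 3) y) + (1 * √(E.disc y)) •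
            (VectorField.lieBracket ℝ (Z 0) (Z 1) y +
              VectorField.lieBracket ℝ (Z 2) (Z 3) y))] a := by
  have hs := HypEq.sqrt_disc_smoothAt ha
  have b01 := (hZ 0).lieBracket (hZ 1)
  have b23 := (hZ 2).lieBracket (hZ 3)
  have hm : ∀ᶠ y in 𝓝 a, Z 0 y ∈ E.D1 y ∧ Z 1 y ∈ E.D1 y ∧ Z 2 y ∈ E.D2 y ∧ Z 3 y ∈ E.D2 y := by
    filter_upwards [h] with y hy
    rw [hy.1, hy.2.1]
    refine ⟨?_, ?_, ?_, ?_⟩ <;> exact Submodule.subset_span (by simp)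
  have h2s : SmoothAt (fun y => (2 * √(E.disc y))⁻¹) a :=
    ((SmoothAt.const 2).mul hs).inv (mul_pos two_pos (E.sqrt_disc_pos ha)).ne'
  have h1s : SmoothAt (fun y => 1 * √(E.disc y)) a := (SmoothAt.const 1).mul hs
  refine ⟨ha, ?_, ?_⟩
  · intro i
    fin_cases i
    · exact hZ 0
    · exact hZ 1
    · exact hZ 2
    · exact hZ 3
    · exact b01.sub (h2s.smul ((HypEq.SmoothAt_jop (HypEq.coeff_smoothAt ha) (b01.add b23)).add
        (h1s.smul (b01.add b23))))
  · filter_upwards [h, HypEq.eventually_dom ha, hm.eventually_nhds,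
      eventually_all.2 fun i => (hZ i).eventually] with y ⟨h1, h2, h3⟩ hy hmy hZy
    refine ⟨h1, h2, ?_⟩
    -- The normalisation `Om (Z 2) (Z 3) = -Om (Z 0) (Z 1)` cancels the transversal parts, so b + b'
    -- is a contact vector. The fifth field is b minus the D¹-component of b + b', and this equals
    -- the D²-component minus b'; both congruences follow.
    have hU : contactForm y (VectorField.lieBracket ℝ (Z 0) (Z 1) y +
        VectorField.lieBracket ℝ (Z 2) (Z 3) y) = 0 := by
      rw [map_add,
        contactForm_lieBracket (hZy 0).differentiableAt (hZy 1).differentiableAt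
          (hmy.mono fun _ h => h.1.1) (hmy.mono fun _ h => h.2.1.1),
        contactForm_lieBracket (hZy 2).differentiableAt (hZy 3).differentiableAt
          (hmy.mono fun _ h => h.2.2.1.1) (hmy.mono fun _ h => h.2.2.2.1), h3]
      ring
    set b := VectorField.lieBracket ℝ (Z 0) (Z 1) y
    set b' := VectorField.lieBracket ℝ (Z 2) (Z 3) y
    have e1 := HypEq.jop_add_mem (E := E) (ε := 1) (by norm_num) hy hU
    have e2 := HypEq.jop_add_mem (E := E) (ε := -1) (by norm_num) hy hU
    constructor
    · change b - (b - _) ∈ E.D1 y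
      rw [sub_sub_cancel]
      exact Submodule.smul_mem _ _ e1
    · change b' + (b - _) ∈ E.D2 y
      have hp : (2 * √(E.disc y)) ≠ 0 := (mul_pos two_pos (E.sqrt_disc_pos hy)).ne'
      have : b' + (b - (2 * √(E.disc y))⁻¹ • (jop (E.coeff y) y (b + b') +
          (1 * √(E.disc y)) • (b + b'))) = (-(2 * √(E.disc y))⁻¹) •
          (jop (E.coeff y) y (b + b') + (-1 * √(E.disc y)) • (b + b')) := by
        have e : b' + b = ((2 * √(E.disc y))⁻¹ * (2 * √(E.disc y))) • (b + b') := by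
          rw [inv_mul_cancel₀ hp, one_smul, add_comm]
        rw [← add_sub_assoc, e]
        module
      rw [this]
      exact Submodule.smul_mem _ _ e2

/-- Near each point there is an adapted frame whose first two fields have the coefficients of the
equation as coefficient vector. -/
theorem exists_adapted {E : HypEq} {a : J1} (ha : a ∈ E.dom) :
    ∃ X, Adapted E X a ∧ ∀ᶠ y in 𝓝 a, E.coeff y = pluck (X 0 y) (X 1 y) ∧
      E.coeff y = pluck (X 2 y) (X 3 y) ∧ Om (X 0 y) (X 1 y) = √(E.disc y) ∧
      Om (X 2 y) (X 3 y) = -√(E.disc y) := by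
  obtain ⟨X0, X1, s0, s1, h1⟩ := HypEq.exists_pluck ha (by norm_num : (1 : ℝ) ^ 2 = 1)
  obtain ⟨X2, X3, s2, s3, h2⟩ := HypEq.exists_pluck ha (by norm_num : (-1 : ℝ) ^ 2 = 1)
  refine ⟨_, exists_adapted_extension (Z := ![X0, X1, X2, X3]) ha ?_ ?_, ?_⟩
  · intro i; fin_cases i <;> assumption
  · filter_upwards [h1, h2, HypEq.eventually_dom ha] with y ⟨a1, a2, a3, a4⟩ ⟨b1, b2, b3, b4⟩ hy
    have hp := E.sqrt_disc_pos hy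
    refine ⟨E.charPlane_eq_span a1 a2 a3 a4 ?_, E.charPlane_eq_span b1 b2 b3 b4 ?_, ?_⟩
    · change Om (X0 y) (X1 y) ≠ 0
      rw [a4]; linarith
    · change Om (X2 y) (X3 y) ≠ 0
      rw [b4]; linarith
    · simp only [Matrix.cons_val]
      rw [a4, b4]; ring
  · filter_upwards [h1, h2] with y ⟨a1, a2, a3, a4⟩ ⟨b1, b2, b3, b4⟩
    simp only [Matrix.cons_val]
    exact ⟨a3, b3, by rw [a4, one_mul], by rw [b4]; ring⟩

/-! ### Independence of the adapted frame -/

/-- The coefficients of the frame `Y` with respect to the frame `X`. -/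
def transition (X Y : Fin 5 → J1 → J1) (i j : Fin 5) (y : J1) : ℝ := coords X y (Y j y) i

theorem coords_sum_smul {ι : Type*} [Fintype ι] {X : Fin 5 → J1 → J1} {a : J1} (c : ι → ℝ)
    (v : ι → J1) (k : Fin 5) :
    coords X a (∑ i, c i • v i) k = ∑ i, c i * coords X a (v i) k := by
  change coordsₗ X a _ k = _
  rw [map_sum, Finset.sum_apply]
  refine Finset.sum_congr rfl fun l _ => ?_
  rw [map_smul]
  rfl

theorem coords_transition {X Y : Fin 5 → J1 → J1} {a : J1} (hY : frameDet Y a ≠ 0) (v : J1)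
    (k : Fin 5) : coords X a v k = ∑ l, transition X Y k l a * coords Y a v l := by
  nth_rewrite 1 [← sum_coords hY v]
  rw [coords_sum_smul]
  exact Finset.sum_congr rfl fun l _ => mul_comm _ _

theorem fderiv_eq_zero_of_eventually {f : J1 → ℝ} {a : J1} (h : ∀ᶠ y in 𝓝 a, f y = 0) :
    fderiv ℝ f a = 0 := by
  have : f =ᶠ[𝓝 a] fun _ => 0 := h
  rw [this.fderiv_eq]
  simp

namespace Adapted

variable {E : HypEq} {X Y : Fin 5 → J1 → J1} {a : J1}

theorem transition_smooth (hX : Adapted E X a) (hY : Adapted E Y a) (i j : Fin 5) :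
    SmoothAt (transition X Y i j) a :=
  SmoothAt.coords hX.smooth hX.frameDet_ne (hY.smooth j) i

theorem transition_zero01 (hX : Adapted E X a) (hY : Adapted E Y a) :
    ∀ k ∈ ({2, 3, 4} : Set (Fin 5)), ∀ j ∈ ({0, 1} : Set (Fin 5)), transition X Y k j a = 0 := by
  intro k hk j hj
  have h0 := hX.mem_D1_iff.1 hY.mem0
  have h1 := hX.mem_D1_iff.1 hY.mem1
  rcases hk with rfl | rfl | rfl <;> rcases hj with rfl | rfl
  exacts [h0.1, h1.1, h0.2.1, h1.2.1, h0.2.2, h1.2.2]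

theorem transition_zero23 (hX : Adapted E X a) (hY : Adapted E Y a) :
    ∀ k ∈ ({0, 1, 4} : Set (Fin 5)), ∀ j ∈ ({2, 3} : Set (Fin 5)), transition X Y k j a = 0 := by
  intro k hk j hj
  have h0 := hX.mem_D2_iff.1 hY.mem2
  have h1 := hX.mem_D2_iff.1 hY.mem3
  rcases hk with rfl | rfl | rfl <;> rcases hj with rfl | rfl
  exacts [h0.1, h1.1, h0.2.1, h1.2.1, h0.2.2, h1.2.2]

theorem frame4_eq (hX : Adapted E X a) (hY : Adapted E Y a) :
    Y 4 a = transition X Y 4 4 a • X 4 a := by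
  have h : Y 4 a ∈ Submodule.span ℝ {X 4 a} := by
    rw [← hX.D3_eq, hY.D3_eq]; exact Submodule.mem_span_singleton_self _
  obtain ⟨c, hc⟩ := Submodule.mem_span_singleton.1 h
  rw [transition, ← hc, coords_smul, coords_frame hX.frameDet_ne]
  simp

theorem frame_eq_sum (hX : Adapted E X a) (j : Fin 5) :
    Y j a = ∑ i, transition X Y i j a • X i a := (sum_coords hX.frameDet_ne _).symm

theorem transition4_ne (hX : Adapted E X a) (hY : Adapted E Y a) : transition X Y 4 4 a ≠ 0 := by
  intro h
  have h1 := hX.frame4_eq hY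
  rw [h, zero_smul] at h1
  exact hY.linearIndependent.ne_zero 4 h1

theorem frame01_eq (hX : Adapted E X a) (hY : Adapted E Y a) {j : Fin 5}
    (hj : j ∈ ({0, 1} : Set (Fin 5))) :
    Y j a = transition X Y 0 j a • X 0 a + transition X Y 1 j a • X 1 a := by
  have z := hX.transition_zero01 hY
  rw [hX.frame_eq_sum (Y := Y) j, Fin.sum_univ_five, z 2 (by simp) j hj, z 3 (by simp) j hj,
    z 4 (by simp) j hj]
  simp

theorem frame23_eq (hX : Adapted E X a) (hY : Adapted E Y a) {j : Fin 5}
    (hj : j ∈ ({2, 3} : Set (Fin 5))) :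
    Y j a = transition X Y 2 j a • X 2 a + transition X Y 3 j a • X 3 a := by
  have z := hX.transition_zero23 hY
  rw [hX.frame_eq_sum (Y := Y) j, Fin.sum_univ_five, z 0 (by simp) j hj, z 1 (by simp) j hj,
    z 4 (by simp) j hj]
  simp

/-- In both frames the contact form takes the value -`Om` of the first two fields on the fifth.
Comparing the two frames gives the determinant. -/
theorem det01 (hX : Adapted E X a) (hY : Adapted E Y a) :
    transition X Y 0 0 a * transition X Y 1 1 a - transition X Y 0 1 a * transition X Y 1 0 a =
      transition X Y 4 4 a := by
  have h := hY.contactForm4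
  rw [hX.frame4_eq hY, map_smul, hX.contactForm4, hX.frame01_eq hY (j := 0) (by simp),
    hX.frame01_eq hY (j := 1) (by simp)] at h
  simp only [Om_add_left, Om_add_right, Om_smul_left, Om_smul_right, Om_self, smul_eq_mul,
    Om_swap (X 0 a) (X 1 a)] at h
  refine mul_right_cancel₀ hX.Om01 ?_
  linarith

theorem det23 (hX : Adapted E X a) (hY : Adapted E Y a) :
    transition X Y 2 2 a * transition X Y 3 3 a - transition X Y 2 3 a * transition X Y 3 2 a =
      transition X Y 4 4 a := by
  have h := hY.contactForm4'
  rw [hX.frame4_eq hY, map_smul, hX.contactForm4', hX.frame23_eq hY (j := 2) (by simp),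
    hX.frame23_eq hY (j := 3) (by simp)] at h
  simp only [Om_add_left, Om_add_right, Om_smul_left, Om_smul_right, Om_self, smul_eq_mul,
    Om_swap (X 2 a) (X 3 a)] at h
  refine mul_right_cancel₀ hX.Om23 ?_
  linarith

/-- Expanding `Y j` and `Y 4` in the frame `X`, the derivative of the factor of `X 4` only affects
the component along `X 4`; this is why `k ≠ 4` is required. -/
theorem brk_transition (hX : Adapted E X a) (hY : Adapted E Y a) (j : Fin 5) {k : Fin 5}
    (hk : k ≠ 4) :
    ∑ l, transition X Y k l a * brk Y l j 4 a =
      transition X Y 4 4 a * (∑ i, transition X Y i j a * brk X k i 4 a -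
        fderiv ℝ (transition X Y k j) a (X 4 a)) := by
  simp only [brk_eq_coords Y]
  rw [← coords_transition hY.frameDet_ne]
  have e1 : Y j =ᶠ[𝓝 a] fun y => ∑ i, transition X Y i j y • X i y := by
    filter_upwards [hX.eventually] with y hy using hy.frame_eq_sum j
  have e2 : Y 4 =ᶠ[𝓝 a] fun y => transition X Y 4 4 y • X 4 y := by
    filter_upwards [hX.eventually, hY.eventually] with y hy hy' using hy.frame4_eq hy'
  have hd : ∀ i j, DifferentiableAt ℝ (transition X Y i j) a := fun i j =>
    (hX.transition_smooth hY i j).differentiableAt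
  rw [lieBracket_congr e1 EventuallyEq.rfl,
    lieBracket_sum_smul_left (fun i => hd i j) (fun i => (hX.smooth i).differentiableAt)]
  have e3 : ∀ i, VectorField.lieBracket ℝ (X i) (Y 4) a =
      transition X Y 4 4 a • VectorField.lieBracket ℝ (X i) (X 4) a +
        fderiv ℝ (transition X Y 4 4) a (X i a) • X 4 a := fun i => by
    rw [lieBracket_congr EventuallyEq.rfl e2,
      VectorField.lieBracket_smul_right (hd 4 4) (hX.smooth 4).differentiableAt, add_comm]
  have hc : ∀ i, coords X a (X i a) k = if k = i then 1 else 0 := fun i => by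
    rw [coords_frame hX.frameDet_ne, Pi.single_apply]
  have e4 : ∀ i, transition X Y i j a • VectorField.lieBracket ℝ (X i) (Y 4) a -
      fderiv ℝ (transition X Y i j) a (Y 4 a) • X i a =
      (transition X Y i j a * transition X Y 4 4 a) • VectorField.lieBracket ℝ (X i) (X 4) a +
      ((transition X Y i j a * fderiv ℝ (transition X Y 4 4) a (X i a)) • X 4 a -
        (transition X Y 4 4 a * fderiv ℝ (transition X Y i j) a (X 4 a)) • X i a) := fun i => by
    rw [e3, hX.frame4_eq hY, map_smul, smul_eq_mul]
    module
  simp only [e4]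
  rw [Finset.sum_add_distrib, Finset.sum_sub_distrib, coords_add, coords_sub, Pi.add_apply,
    Pi.sub_apply, coords_sum_smul, coords_sum_smul, coords_sum_smul, mul_sub, Finset.mul_sum]
  simp only [hc, if_neg hk, ← brk_eq_coords]
  simp only [mul_zero, Finset.sum_const_zero, zero_sub, mul_ite, mul_one, Finset.sum_ite_eq,
    Finset.mem_univ, if_true]
  rw [sub_eq_add_neg]
  congr 1
  refine Finset.sum_congr rfl fun i _ => ?_
  ring

/-- The mixed structure functions in two adapted frames. -/
theorem brk_eq01 (hX : Adapted E X a) (hY : Adapted E Y a) {j : Fin 5}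
    (hj : j ∈ ({2, 3} : Set (Fin 5))) :
    brk Y 0 j 4 a = transition X Y 1 1 a *
        (transition X Y 2 j a * brk X 0 2 4 a + transition X Y 3 j a * brk X 0 3 4 a) -
      transition X Y 0 1 a *
        (transition X Y 2 j a * brk X 1 2 4 a + transition X Y 3 j a * brk X 1 3 4 a) ∧
    brk Y 1 j 4 a = transition X Y 0 0 a *
        (transition X Y 2 j a * brk X 1 2 4 a + transition X Y 3 j a * brk X 1 3 4 a) -
      transition X Y 1 0 a *
        (transition X Y 2 j a * brk X 0 2 4 a + transition X Y 3 j a * brk X 0 3 4 a) := by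
  have h0 := hX.brk_transition hY j (k := 0) (by decide)
  have h1 := hX.brk_transition hY j (k := 1) (by decide)
  have z := hX.transition_zero23 hY
  have z' := hX.transition_zero23 hY
  -- The off-diagonal blocks vanish on a neighbourhood, so no derivative term survives. With
  -- diagonal blocks A on D¹ and C on D², the mixed matrix P becomes adj(A) P C, the adjugate
  -- arising from l A⁻¹ with l = det A.
  have w : ∀ k ∈ ({0, 1, 4} : Set (Fin 5)), fderiv ℝ (transition X Y k j) a = 0 := fun k hk =>
    fderiv_eq_zero_of_eventually (by
      filter_upwards [hX.eventually, hY.eventually] with y h h' using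
        h.transition_zero23 h' k hk j hj)
  have z04 : transition X Y 0 4 a = 0 := by
    rw [transition, hX.frame4_eq hY, coords_smul, coords_frame hX.frameDet_ne]; simp
  have z14 : transition X Y 1 4 a = 0 := by
    rw [transition, hX.frame4_eq hY, coords_smul, coords_frame hX.frameDet_ne]; simp
  simp only [Fin.sum_univ_five, z 0 (by simp) 2 (by simp), z 0 (by simp) 3 (by simp),
    z 1 (by simp) 2 (by simp), z 1 (by simp) 3 (by simp), z 0 (by simp) j hj, z 1 (by simp) j hj,
    z 4 (by simp) j hj, w 0 (by simp), w 1 (by simp), z04, z14,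
    zero_apply] at h0 h1
  have hd := hX.det01 hY
  constructor <;> refine mul_left_cancel₀ (hX.transition4_ne hY) ?_
  · rw [← hd] at h0 h1 ⊢
    linear_combination transition X Y 1 1 a * h0 - transition X Y 0 1 a * h1
  · rw [← hd] at h0 h1 ⊢
    linear_combination transition X Y 0 0 a * h1 - transition X Y 1 0 a * h0

theorem brk_eq23 (hX : Adapted E X a) (hY : Adapted E Y a) {j : Fin 5}
    (hj : j ∈ ({0, 1} : Set (Fin 5))) :
    brk Y 2 j 4 a = transition X Y 3 3 a *
        (transition X Y 0 j a * brk X 2 0 4 a + transition X Y 1 j a * brk X 2 1 4 a) -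
      transition X Y 2 3 a *
        (transition X Y 0 j a * brk X 3 0 4 a + transition X Y 1 j a * brk X 3 1 4 a) ∧
    brk Y 3 j 4 a = transition X Y 2 2 a *
        (transition X Y 0 j a * brk X 3 0 4 a + transition X Y 1 j a * brk X 3 1 4 a) -
      transition X Y 3 2 a *
        (transition X Y 0 j a * brk X 2 0 4 a + transition X Y 1 j a * brk X 2 1 4 a) := by
  have h0 := hX.brk_transition hY j (k := 2) (by decide)
  have h1 := hX.brk_transition hY j (k := 3) (by decide)
  have z := hX.transition_zero01 hY
  have w : ∀ k ∈ ({2, 3, 4} : Set (Fin 5)), fderiv ℝ (transition X Y k j) a = 0 := fun k hk =>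
    fderiv_eq_zero_of_eventually (by
      filter_upwards [hX.eventually, hY.eventually] with y h h' using
        h.transition_zero01 h' k hk j hj)
  have z04 : transition X Y 2 4 a = 0 := by
    rw [transition, hX.frame4_eq hY, coords_smul, coords_frame hX.frameDet_ne]; simp
  have z14 : transition X Y 3 4 a = 0 := by
    rw [transition, hX.frame4_eq hY, coords_smul, coords_frame hX.frameDet_ne]; simp
  simp only [Fin.sum_univ_five, z 2 (by simp) 0 (by simp), z 2 (by simp) 1 (by simp),
    z 3 (by simp) 0 (by simp), z 3 (by simp) 1 (by simp), z 2 (by simp) j hj, z 3 (by simp) j hj,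
    z 4 (by simp) j hj, w 2 (by simp), w 3 (by simp), z04, z14,
    zero_apply] at h0 h1
  have hd := hX.det23 hY
  constructor <;> refine mul_left_cancel₀ (hX.transition4_ne hY) ?_
  · rw [← hd] at h0 h1 ⊢
    linear_combination transition X Y 3 3 a * h0 - transition X Y 2 3 a * h1
  · rw [← hd] at h0 h1 ⊢
    linear_combination transition X Y 2 2 a * h1 - transition X Y 3 2 a * h0

/-- `Lam1` is minus the determinant of the mixed block, and the two factors adj(A) and C both have
determinant `transition X Y 4 4`. -/
theorem Lam1_transition (hX : Adapted E X a) (hY : Adapted E Y a) :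
    Lam1 Y a = transition X Y 4 4 a ^ 2 * Lam1 X a := by
  have h2 := hX.brk_eq01 hY (j := 2) (by simp)
  have h3 := hX.brk_eq01 hY (j := 3) (by simp)
  simp only [Lam1]
  rw [h2.1, h2.2, h3.1, h3.2, sq]
  nth_rewrite 1 [← hX.det01 hY]
  rw [← hX.det23 hY]
  ring

theorem Lam2_transition (hX : Adapted E X a) (hY : Adapted E Y a) :
    Lam2 Y a = transition X Y 4 4 a ^ 2 * Lam2 X a := by
  have h2 := hX.brk_eq23 hY (j := 0) (by simp)
  have h3 := hX.brk_eq23 hY (j := 1) (by simp)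
  simp only [Lam2]
  rw [h2.1, h2.2, h3.1, h3.2, sq]
  nth_rewrite 1 [← hX.det01 hY]
  rw [← hX.det23 hY]
  ring

/-- `Lam12` is the trace of the product of the two mixed blocks. The outer factors cancel
cyclically, leaving det A det C. -/
theorem Lam12_transition (hX : Adapted E X a) (hY : Adapted E Y a) :
    Lam12 Y a = transition X Y 4 4 a ^ 2 * Lam12 X a := by
  have h0 := hX.brk_eq23 hY (j := 0) (by simp)
  have h1 := hX.brk_eq23 hY (j := 1) (by simp)
  have h2 := hX.brk_eq01 hY (j := 2) (by simp)
  have h3 := hX.brk_eq01 hY (j := 3) (by simp)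
  simp only [Lam12]
  rw [h0.1, h0.2, h1.1, h1.2, h2.1, h2.2, h3.1, h3.2, sq]
  nth_rewrite 1 [← hX.det01 hY]
  rw [← hX.det23 hY]
  ring

theorem fderiv_det {p q r s l : J1 → ℝ} (hp : DifferentiableAt ℝ p a)
    (hq : DifferentiableAt ℝ q a) (hr : DifferentiableAt ℝ r a) (hs : DifferentiableAt ℝ s a)
    (h : ∀ᶠ y in 𝓝 a, p y * s y - q y * r y = l y) (v : J1) :
    fderiv ℝ l a v = p a * fderiv ℝ s a v + s a * fderiv ℝ p a v -
      (q a * fderiv ℝ r a v + r a * fderiv ℝ q a v) := by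
  have e : l =ᶠ[𝓝 a] fun y => p y * s y - q y * r y := by
    filter_upwards [h] with y hy using hy.symm
  have := (hp.hasFDerivAt.mul hs.hasFDerivAt).sub (hq.hasFDerivAt.mul hr.hasFDerivAt)
  rw [e.fderiv_eq]
  have h2 : fderiv ℝ (fun y => p y * s y - q y * r y) a = _ := this.fderiv
  rw [h2]
  simp

/-- By Jacobi's formula the logarithmic derivative of a block has trace X₅(l)/l. Each of the two
blocks therefore contributes -X₅(l), whence the factor 2. -/
theorem brkTrace_transition (hX : Adapted E X a) (hY : Adapted E Y a) :
    brkTrace Y a = transition X Y 4 4 a * brkTrace X a -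
      2 * fderiv ℝ (transition X Y 4 4) a (X 4 a) := by
  have b00 := hX.brk_transition hY 0 (k := 0) (by decide)
  have b10 := hX.brk_transition hY 0 (k := 1) (by decide)
  have b01 := hX.brk_transition hY 1 (k := 0) (by decide)
  have b11 := hX.brk_transition hY 1 (k := 1) (by decide)
  have b22 := hX.brk_transition hY 2 (k := 2) (by decide)
  have b32 := hX.brk_transition hY 2 (k := 3) (by decide)
  have b23 := hX.brk_transition hY 3 (k := 2) (by decide)
  have b33 := hX.brk_transition hY 3 (k := 3) (by decide)
  have z := hX.transition_zero01 hY
  have z' := hX.transition_zero23 hY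
  have z4 : ∀ k : Fin 5, k ≠ 4 → transition X Y k 4 a = 0 := fun k hk => by
    rw [transition, hX.frame4_eq hY, coords_smul, coords_frame hX.frameDet_ne]; simp [hk]
  have hd : ∀ i j, DifferentiableAt ℝ (transition X Y i j) a := fun i j =>
    (hX.transition_smooth hY i j).differentiableAt
  have d01 := hX.det01 hY
  have d23 := hX.det23 hY
  have D1 := fderiv_det (a := a) (hd 0 0) (hd 0 1) (hd 1 0) (hd 1 1) (l := transition X Y 4 4)
    (by filter_upwards [hX.eventually, hY.eventually] with y h h' using h.det01 h') (X 4 a)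
  have D2 := fderiv_det (a := a) (hd 2 2) (hd 2 3) (hd 3 2) (hd 3 3) (l := transition X Y 4 4)
    (by filter_upwards [hX.eventually, hY.eventually] with y h h' using h.det23 h') (X 4 a)
  simp only [Fin.sum_univ_five, z 2 (by simp) 0 (by simp), z 2 (by simp) 1 (by simp),
    z 3 (by simp) 0 (by simp), z 3 (by simp) 1 (by simp), z 4 (by simp) 0 (by simp),
    z 4 (by simp) 1 (by simp), z' 0 (by simp) 2 (by simp), z' 0 (by simp) 3 (by simp),
    z' 1 (by simp) 2 (by simp), z' 1 (by simp) 3 (by simp), z' 4 (by simp) 2 (by simp),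
    z' 4 (by simp) 3 (by simp), z4 0 (by decide), z4 1 (by decide), z4 2 (by decide),
    z4 3 (by decide)] at b00 b10 b01 b11 b22 b32 b23 b33
  have t1 : brk Y 0 0 4 a + brk Y 1 1 4 a = transition X Y 4 4 a *
      (brk X 0 0 4 a + brk X 1 1 4 a) - fderiv ℝ (transition X Y 4 4) a (X 4 a) := by
    refine mul_left_cancel₀ (hX.transition4_ne hY) ?_
    rw [D1]
    rw [← d01] at *
    linear_combination transition X Y 1 1 a * b00 - transition X Y 0 1 a * b10 +
      transition X Y 0 0 a * b11 - transition X Y 1 0 a * b01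
  have t2 : brk Y 2 2 4 a + brk Y 3 3 4 a = transition X Y 4 4 a *
      (brk X 2 2 4 a + brk X 3 3 4 a) - fderiv ℝ (transition X Y 4 4) a (X 4 a) := by
    refine mul_left_cancel₀ (hX.transition4_ne hY) ?_
    rw [D2]
    rw [← d23] at *
    linear_combination transition X Y 3 3 a * b22 - transition X Y 2 3 a * b32 +
      transition X Y 2 2 a * b33 - transition X Y 3 2 a * b23
  simp only [brkTrace]
  linear_combination t1 + t2

theorem smooth_brk (hX : Adapted E X a) (i j k : Fin 5) : SmoothAt (brk X i j k) a :=
  SmoothAt.brk hX.smooth hX.frameDet_ne i j k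

theorem smooth_Lam1 (hX : Adapted E X a) : SmoothAt (Lam1 X) a :=
  ((hX.smooth_brk _ _ _).mul (hX.smooth_brk _ _ _)).sub
    ((hX.smooth_brk _ _ _).mul (hX.smooth_brk _ _ _))

theorem smooth_Lam2 (hX : Adapted E X a) : SmoothAt (Lam2 X) a :=
  ((hX.smooth_brk _ _ _).mul (hX.smooth_brk _ _ _)).sub
    ((hX.smooth_brk _ _ _).mul (hX.smooth_brk _ _ _))

theorem smooth_Lam12 (hX : Adapted E X a) : SmoothAt (Lam12 X) a :=
  ((((hX.smooth_brk _ _ _).mul (hX.smooth_brk _ _ _)).add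
    ((hX.smooth_brk _ _ _).mul (hX.smooth_brk _ _ _))).add
    ((hX.smooth_brk _ _ _).mul (hX.smooth_brk _ _ _))).add
    ((hX.smooth_brk _ _ _).mul (hX.smooth_brk _ _ _))

theorem smooth_brkTrace (hX : Adapted E X a) : SmoothAt (brkTrace X) a :=
  (((hX.smooth_brk _ _ _).add (hX.smooth_brk _ _ _)).add (hX.smooth_brk _ _ _)).add
    (hX.smooth_brk _ _ _)

/-- For a function L scaling by l², the term 2 l² L X₅(l) from the derivative cancels against the
change of the trace. So X₅(L) + Lβ scales by l³, and both its square and |Λ₁|³ scale by l⁶. -/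
theorem sqInv_eq (hX : Adapted E X a) (hY : Adapted E Y a) {L L' : J1 → ℝ}
    (hL : DifferentiableAt ℝ L a)
    (h : ∀ᶠ y in 𝓝 a, L' y = transition X Y 4 4 y ^ 2 * L y) :
    sqInv Y L' a = sqInv X L a := by
  set l := transition X Y 4 4 with hl
  have hld := (hX.transition_smooth hY 4 4).differentiableAt
  have e : L' =ᶠ[𝓝 a] fun y => l y ^ 2 * L y := h
  have hder : fderiv ℝ L' a (Y 4 a) =
      l a * (l a ^ 2 * fderiv ℝ L a (X 4 a) + 2 * l a * L a * fderiv ℝ l a (X 4 a)) := by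
    rw [e.fderiv_eq, hX.frame4_eq hY]
    have h2 : fderiv ℝ (fun y => l y ^ 2 * L y) a = _ :=
      ((hld.hasFDerivAt.pow 2).mul hL.hasFDerivAt).fderiv
    rw [h2]
    simp [← hl]
    left
    ring
  have hne : l a ≠ 0 := hX.transition4_ne hY
  rw [sqInv, sqInv, hder, hX.brkTrace_transition hY, hX.Lam1_transition hY, h.self_of_nhds, ← hl,
    abs_mul, abs_of_nonneg (sq_nonneg (l a)), mul_pow,
    ← mul_div_mul_left _ (|Lam1 X a| ^ 3) (pow_ne_zero 3 (pow_ne_zero 2 hne))]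
  congr 1
  ring

/-- The five invariants do not depend on the choice of the adapted frame. -/
theorem frameInv_eq (hX : Adapted E X a) (hY : Adapted E Y a) : frameInv Y a = frameInv X a := by
  have hne : transition X Y 4 4 a ^ 2 ≠ 0 := pow_ne_zero 2 (hX.transition4_ne hY)
  have hev := hX.eventually.and hY.eventually
  simp only [frameInv]
  rw [hX.sqInv_eq hY hX.smooth_Lam1.differentiableAt
      (hev.mono fun y h => h.1.Lam1_transition h.2),
    hX.sqInv_eq hY hX.smooth_Lam2.differentiableAt
      (hev.mono fun y h => h.1.Lam2_transition h.2),
    hX.sqInv_eq hY hX.smooth_Lam12.differentiableAt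
      (hev.mono fun y h => h.1.Lam12_transition h.2),
    hX.Lam1_transition hY, hX.Lam2_transition hY, hX.Lam12_transition hY,
    mul_div_mul_left _ _ hne, mul_div_mul_left _ _ hne]

theorem basicInv_eq (hX : Adapted E X a) : E.basicInv a = frameInv X a := by
  have h : ∃ X, IsAdaptedFrame E X a := ⟨X, hX.isAdaptedFrame⟩
  rw [HypEq.basicInv, dif_pos h]
  exact hX.frameInv_eq (h.choose_spec.adapted hX.mem_dom)

theorem basicInv_eventuallyEq (hX : Adapted E X a) : E.basicInv =ᶠ[𝓝 a] frameInv X :=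
  hX.eventually.mono fun _ hy => hy.basicInv_eq

end Adapted

/-! ### Covectors and frames -/

section Covectors

variable {X : Fin 5 → J1 → J1} {a : J1}

theorem linearMap_ext_frame {F : Type*} [AddCommGroup F] [Module ℝ F] (h : frameDet X a ≠ 0)
    {φ ψ : J1 →ₗ[ℝ] F} (H : ∀ i, φ (X i a) = ψ (X i a)) : φ = ψ :=
  LinearMap.ext_on_range (span_frame_univ h) H

theorem linearIndependent_covectors_iff (h : frameDet X a ≠ 0) (φ : Fin 5 → J1 →ₗ[ℝ] ℝ) :
    LinearIndependent ℝ φ ↔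
      (Matrix.of fun i m => φ i (X m a) : Matrix (Fin 5) (Fin 5) ℝ).det ≠ 0 := by
  let ev : (J1 →ₗ[ℝ] ℝ) →ₗ[ℝ] (Fin 5 → ℝ) :=
    { toFun := fun φ m => φ (X m a)
      map_add' := fun _ _ => rfl
      map_smul' := fun _ _ => rfl }
  have hev : LinearMap.ker ev = ⊥ := LinearMap.ker_eq_bot'.2 fun φ hφ =>
    linearMap_ext_frame h fun i => congrFun hφ i
  rw [← LinearMap.linearIndependent_iff ev hev, ← isUnit_iff_ne_zero,
    ← Matrix.isUnit_iff_isUnit_det, ← Matrix.linearIndependent_rows_iff_isUnit]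
  rfl

theorem eq_zero_of_covectors {φ : Fin 5 → J1 →ₗ[ℝ] ℝ} (h : LinearIndependent ℝ φ) {v : J1}
    (hv : ∀ i, φ i v = 0) : v = 0 := by
  have hspan : Submodule.span ℝ (Set.range φ) = ⊤ :=
    h.span_eq_top_of_card_eq_finrank' (by simp [Subspace.dual_finrank_eq])
  have hall : ∀ ψ : J1 →ₗ[ℝ] ℝ, ψ v = 0 := by
    intro ψ
    have hψ : ψ ∈ Submodule.span ℝ (Set.range φ) := hspan ▸ Submodule.mem_top
    induction hψ using Submodule.span_induction with
    | mem x hx => obtain ⟨i, rfl⟩ := hx; exact hv i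
    | zero => rfl
    | add x y _ _ hx hy => rw [LinearMap.add_apply, hx, hy, add_zero]
    | smul c x _ hx => rw [LinearMap.smul_apply, hx, smul_zero]
  ext i
  exact hall (LinearMap.proj i)

theorem isCompl_span_frame (h : frameDet X a ≠ 0) (S : Set (Fin 5)) :
    IsCompl (Submodule.span ℝ ((fun i => X i a) '' S))
      (Submodule.span ℝ ((fun i => X i a) '' Sᶜ)) := by
  constructor
  · rw [Submodule.disjoint_def]
    intro v h1 h2
    rw [mem_span_frame_iff h] at h1 h2
    rw [← sum_coords h v]
    refine Finset.sum_eq_zero fun i _ => ?_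
    by_cases hi : i ∈ S
    · rw [h2 i (by simpa using hi), zero_smul]
    · rw [h1 i hi, zero_smul]
  · rw [codisjoint_iff, ← Submodule.span_union, ← Set.image_union, Set.union_compl_self,
      Set.image_univ, span_frame_univ h]

theorem projAlong_frame (h : frameDet X a ≠ 0) {P Q : Submodule ℝ J1} (S : Set (Fin 5))
    (hP : P = Submodule.span ℝ ((fun i => X i a) '' S))
    (hQ : Q = Submodule.span ℝ ((fun i => X i a) '' Sᶜ)) (i : Fin 5) [Decidable (i ∈ S)] :
    projAlong P Q (X i a) = if i ∈ S then X i a else 0 := by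
  have hc : IsCompl P Q := by rw [hP, hQ]; exact isCompl_span_frame h S
  rw [projAlong, dif_pos hc]
  split_ifs with hi
  · exact Submodule.projection_apply_of_mem_left hc (hP ▸ Submodule.subset_span ⟨i, hi, rfl⟩)
  · exact (Submodule.projection_apply_eq_zero_iff hc).2
      (hQ ▸ Submodule.subset_span ⟨i, hi, rfl⟩)

end Covectors

/-! ### Projections and the invariant coframe in an adapted frame. -/

namespace Adapted

variable {E : HypEq} {X : Fin 5 → J1 → J1} {a : J1}

theorem D3_eq' (h : Adapted E X a) :
    E.D3 a = Submodule.span ℝ ((fun i => X i a) '' {4}) := by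
  rw [h.D3_eq, Set.image_singleton]

theorem Pr1_frame (h : Adapted E X a) (i : Fin 5) :
    E.Pr1 a (X i a) = ![X 0 a, X 1 a, 0, 0, 0] i := by
  rw [HypEq.Pr1, projAlong_frame h.frameDet_ne {0, 1} (by rw [h.D1_eq, span01])]
  · fin_cases i <;> simp
  · rw [h.D2_eq, span23, h.D3_eq', ← Submodule.span_union, ← Set.image_union]
    congr 2
    ext i; fin_cases i <;> simp

theorem Pr2_frame (h : Adapted E X a) (i : Fin 5) :
    E.Pr2 a (X i a) = ![0, 0, X 2 a, X 3 a, 0] i := by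
  rw [HypEq.Pr2, projAlong_frame h.frameDet_ne {2, 3} (by rw [h.D2_eq, span23])]
  · fin_cases i <;> simp
  · rw [h.D1_eq, span01, h.D3_eq', ← Submodule.span_union, ← Set.image_union]
    congr 2
    ext i; fin_cases i <;> simp

theorem Pr3_frame (h : Adapted E X a) (i : Fin 5) :
    E.Pr3 a (X i a) = ![0, 0, 0, 0, X 4 a] i := by
  rw [HypEq.Pr3, projAlong_frame h.frameDet_ne {4} h.D3_eq']
  · fin_cases i <;> simp
  · rw [h.D1_eq, span01, h.D2_eq, span23, ← Submodule.span_union, ← Set.image_union]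
    congr 2
    ext i; fin_cases i <;> simp

/-- The matrix of the invariant coframe in an adapted frame. -/
theorem coframe_frame (h : Adapted E X a) (k : Fin 2) (i m : Fin 5) :
    E.coframe k a i (X m a) =
      (!![E.dInv 0 a (X 0 a), E.dInv 0 a (X 1 a), 0, 0, 0;
        E.dInv 1 a (X 0 a), E.dInv 1 a (X 1 a), 0, 0, 0;
        0, 0, E.dInv 0 a (X 2 a), E.dInv 0 a (X 3 a), 0;
        0, 0, E.dInv 1 a (X 2 a), E.dInv 1 a (X 3 a), 0;
        0, 0, 0, 0, E.dInv (Fin.castLE (by decide) k) a (X 4 a)] : Matrix _ _ ℝ) i m := by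
  fin_cases i <;> simp only [HypEq.coframe, Fin.zero_eta, Fin.mk_one, Fin.reduceFinMk,
    Matrix.cons_val, LinearMap.comp_apply, h.Pr1_frame, h.Pr2_frame, h.Pr3_frame] <;>
    fin_cases m <;> simp

theorem coframe_indep_iff (h : Adapted E X a) (k : Fin 2) :
    LinearIndependent ℝ (E.coframe k a) ↔
      E.dInv 0 a (X 0 a) * E.dInv 1 a (X 1 a) - E.dInv 0 a (X 1 a) * E.dInv 1 a (X 0 a) ≠ 0 ∧
      E.dInv 0 a (X 2 a) * E.dInv 1 a (X 3 a) - E.dInv 0 a (X 3 a) * E.dInv 1 a (X 2 a) ≠ 0 ∧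
      E.dInv (Fin.castLE (by decide) k) a (X 4 a) ≠ 0 := by
  rw [linearIndependent_covectors_iff h.frameDet_ne]
  simp only [h.coframe_frame]
  have : ∀ p q r s p' q' r' s' t : ℝ,
      (Matrix.of (fun i m => (!![p, q, 0, 0, 0; r, s, 0, 0, 0; 0, 0, p', q', 0; 0, 0, r', s', 0;
        0, 0, 0, 0, t] : Matrix (Fin 5) (Fin 5) ℝ) i m)).det =
      (p * s - q * r) * ((p' * s' - q' * r') * t) := by
    intros
    simp [Matrix.det_succ_row_zero, Fin.sum_univ_succ, Fin.succAbove]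
    ring
  rw [this, mul_ne_zero_iff, mul_ne_zero_iff]

theorem dInv_indep_iff (h : Adapted E X a) :
    LinearIndependent ℝ (fun j => E.dInv j a) ↔
      (Matrix.of fun j m => E.dInv j a (X m a) : Matrix (Fin 5) (Fin 5) ℝ).det ≠ 0 :=
  linearIndependent_covectors_iff h.frameDet_ne _

/-! ### The second derived distributions -/

end Adapted

/-- Modulo ⟨X_p, X_q, X₅⟩ the new directions are [X_p, X₅] and [X_q, X₅]. They fill the two missing
dimensions exactly when the 2 × 2 matrix of their components along X_r, X_s is invertible. -/
theorem finrank_derived_eq_five_iff {X : Fin 5 → J1 → J1} {a : J1} (hX : ∀ i, SmoothAt (X i) a)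
    (h : frameDet X a ≠ 0) {P : J1 → Submodule ℝ J1} {p q r s : Fin 5}
    (hr : r ∉ ({p, q, 4} : Set (Fin 5))) (hs : s ∉ ({p, q, 4} : Set (Fin 5)))
    (hall : ∀ i, i ∈ ({p, q, 4} : Set (Fin 5)) ∨ i = r ∨ i = s)
    (hP : ∀ᶠ y in 𝓝 a, P y = Submodule.span ℝ ((fun i => X i y) '' {p, q, 4}))
    (hpq : VectorField.lieBracket ℝ (X p) (X q) a ∈
      Submodule.span ℝ ((fun i => X i a) '' {p, q, 4})) :
    Module.finrank ℝ (derived P a) = 5 ↔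
      brk X r p 4 a * brk X s q 4 a - brk X s p 4 a * brk X r q 4 a ≠ 0 := by
  set B := Submodule.span ℝ ((fun i => X i a) '' {p, q, 4}) with hB
  have hder := derived_span hX h {p, q, 4} hP
  rw [← hB] at hder
  constructor
  · intro hfin h0
    have htop : derived P a = ⊤ := Submodule.eq_top_of_finrank_eq (by rw [hfin]; simp)
    -- A left null vector of the component matrix yields a non-zero covector that annihilates the
    -- whole derived distribution.
    obtain ⟨x, hx0, hx⟩ : ∃ x : Fin 2 → ℝ, x ≠ 0 ∧
        Matrix.vecMul x !![brk X r p 4 a, brk X r q 4 a; brk X s p 4 a, brk X s q 4 a] = 0 := by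
      refine Matrix.exists_vecMul_eq_zero_iff.2 ?_
      rw [Matrix.det_fin_two_of]; linarith
    have e0 := congrFun hx 0
    have e1 := congrFun hx 1
    simp [Matrix.vecMul, dotProduct] at e0 e1
    have hrs : r ≠ s := by
      rintro rfl
      have : ∀ p q r : Fin 5, ∃ i, ¬(i = p ∨ i = q ∨ i = 4 ∨ i = r) := by decide
      obtain ⟨i, hi⟩ := this p q r
      have := hall i
      simp at this
      tauto
    let φ : J1 →ₗ[ℝ] ℝ :=
      (x 0 • LinearMap.proj r + x 1 • LinearMap.proj s) ∘ₗ coordsₗ X a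
    have hφ : ∀ v, φ v = x 0 * coords X a v r + x 1 * coords X a v s := fun v => rfl
    have hB0 : ∀ v ∈ B, φ v = 0 := fun v hv => by
      rw [mem_span_frame_iff h] at hv
      rw [hφ, hv r hr, hv s hs]; ring
    have hswap : ∀ i j, φ (VectorField.lieBracket ℝ (X i) (X j) a) = 0 →
        φ (VectorField.lieBracket ℝ (X j) (X i) a) = 0 := fun i j hij => by
      rw [VectorField.lieBracket_swap, map_neg, hij, neg_zero]
    have hp4 : φ (VectorField.lieBracket ℝ (X p) (X 4) a) = 0 := by
      rw [hφ, ← brk_eq_coords, ← brk_eq_coords]; linarith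
    have hq4 : φ (VectorField.lieBracket ℝ (X q) (X 4) a) = 0 := by
      rw [hφ, ← brk_eq_coords, ← brk_eq_coords]; linarith
    have hself : ∀ i, φ (VectorField.lieBracket ℝ (X i) (X i) a) = 0 := fun i => by
      rw [VectorField.lieBracket_self]; exact map_zero φ
    have hle : derived P a ≤ LinearMap.ker φ := by
      rw [hder]
      refine sup_le hB0 (Submodule.span_le.2 ?_)
      rintro _ ⟨i, hi, j, hj, rfl⟩
      change φ _ = 0
      rcases hi with rfl | rfl | rfl <;> rcases hj with rfl | rfl | rfl
      exacts [hself _, hB0 _ hpq, hp4, hswap _ _ (hB0 _ hpq), hself _, hq4, hswap _ _ hp4,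
        hswap _ _ hq4, hself _]
    rw [htop] at hle
    have hr' : φ (X r a) = 0 := hle Submodule.mem_top
    have hs' : φ (X s a) = 0 := hle Submodule.mem_top
    rw [hφ, coords_frame h] at hr' hs'
    simp [hrs, hrs.symm] at hr' hs'
    exact hx0 (by ext i; fin_cases i <;> assumption)
  · intro hne
    have hB' : ∀ i ∈ ({p, q, 4} : Set (Fin 5)), X i a ∈ derived P a := fun i hi => by
      rw [hder]; exact Submodule.mem_sup_left (Submodule.subset_span ⟨i, hi, rfl⟩)
    have hBr : ∀ i ∈ ({p, q} : Set (Fin 5)),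
        brk X r i 4 a • X r a + brk X s i 4 a • X s a ∈ derived P a := by
      intro i hi
      have h1 : VectorField.lieBracket ℝ (X i) (X 4) a ∈ derived P a := by
        rw [hder]
        refine Submodule.mem_sup_right (Submodule.subset_span ⟨i, ?_, 4, by simp, rfl⟩)
        rcases hi with rfl | rfl <;> simp
      have h2 : VectorField.lieBracket ℝ (X i) (X 4) a - (brk X r i 4 a • X r a +
          brk X s i 4 a • X s a) ∈ B := by
        rw [mem_span_frame_iff h]
        intro j hj
        rw [coords_sub, coords_add, coords_smul, coords_smul, coords_frame h, coords_frame h]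
        have hrs : r ≠ s := by
          rintro rfl; exact hne (by ring)
        rcases hall j with hj' | rfl | rfl
        · exact absurd hj' hj
        · simp [hrs, brk_eq_coords]
        · simp [hrs.symm, brk_eq_coords]
      rw [← sub_sub_cancel (VectorField.lieBracket ℝ (X i) (X 4) a)
        (brk X r i 4 a • X r a + brk X s i 4 a • X s a)]
      exact Submodule.sub_mem _ h1 (hder ▸ Submodule.mem_sup_left h2)
    have h1 := hBr p (by simp)
    have h2 := hBr q (by simp)
    have er : X r a ∈ derived P a := by
      have := Submodule.smul_mem _ (brk X r p 4 a * brk X s q 4 a - brk X s p 4 a * brk X r q 4 a)⁻¹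
        (Submodule.sub_mem _ (Submodule.smul_mem _ (brk X s q 4 a) h1)
          (Submodule.smul_mem _ (brk X s p 4 a) h2))
      convert this using 1
      trans ((brk X r p 4 a * brk X s q 4 a - brk X s p 4 a * brk X r q 4 a)⁻¹ *
        (brk X r p 4 a * brk X s q 4 a - brk X s p 4 a * brk X r q 4 a)) • X r a
      · rw [inv_mul_cancel₀ hne, one_smul]
      · module
    have es : X s a ∈ derived P a := by
      have := Submodule.smul_mem _ (brk X r p 4 a * brk X s q 4 a - brk X s p 4 a * brk X r q 4 a)⁻¹
        (Submodule.sub_mem _ (Submodule.smul_mem _ (brk X r p 4 a) h2)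
          (Submodule.smul_mem _ (brk X r q 4 a) h1))
      convert this using 1
      trans ((brk X r p 4 a * brk X s q 4 a - brk X s p 4 a * brk X r q 4 a)⁻¹ *
        (brk X r p 4 a * brk X s q 4 a - brk X s p 4 a * brk X r q 4 a)) • X s a
      · rw [inv_mul_cancel₀ hne, one_smul]
      · module
    have : derived P a = ⊤ := by
      rw [eq_top_iff, ← span_frame_univ h, Submodule.span_le]
      rintro _ ⟨i, rfl⟩
      rcases hall i with hi | rfl | rfl
      exacts [hB' i hi, er, es]
    rw [this]
    simp

/-! ### Genericity as non-vanishing of finitely many functions. -/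

namespace Adapted

variable {E : HypEq} {X : Fin 5 → J1 → J1} {a : J1}

theorem finrank_D1_iff (h : Adapted E X a) :
    Module.finrank ℝ (derived (derived E.D1) a) = 5 ↔ Lam2 X a ≠ 0 := by
  -- The order of `r` and `s` makes the determinant equal to `Lam2` rather than to its negative.
  refine finrank_derived_eq_five_iff (p := 0) (q := 1) (r := 3) (s := 2) h.smooth h.frameDet_ne
    (by decide +revert) (by decide +revert) (by intro i; fin_cases i <;> simp)
    (h.eventually.mono fun y hy => hy.derived_D1) ?_
  rw [← h.derived_D1]
  refine Submodule.subset_span (Or.inr ⟨X 0, X 1, ?_, ?_, rfl⟩)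
  · exact isLocalSection_iff.2 ⟨h.smooth 0, h.eventually.mono fun y hy => hy.mem0⟩
  · exact isLocalSection_iff.2 ⟨h.smooth 1, h.eventually.mono fun y hy => hy.mem1⟩

theorem finrank_D2_iff (h : Adapted E X a) :
    Module.finrank ℝ (derived (derived E.D2) a) = 5 ↔ Lam1 X a ≠ 0 := by
  refine finrank_derived_eq_five_iff (p := 2) (q := 3) (r := 1) (s := 0) h.smooth h.frameDet_ne
    (by decide +revert) (by decide +revert) (by intro i; fin_cases i <;> simp)
    (h.eventually.mono fun y hy => hy.derived_D2) ?_
  rw [← h.derived_D2]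
  refine Submodule.subset_span (Or.inr ⟨X 2, X 3, ?_, ?_, rfl⟩)
  · exact isLocalSection_iff.2 ⟨h.smooth 2, h.eventually.mono fun y hy => hy.mem2⟩
  · exact isLocalSection_iff.2 ⟨h.smooth 3, h.eventually.mono fun y hy => hy.mem3⟩

/-- Genericity in terms of an adapted frame. -/
theorem genericAt_iff (h : Adapted E X a) : E.GenericAt a ↔
    Lam1 X a ≠ 0 ∧ Lam2 X a ≠ 0 ∧
      E.dInv 0 a (X 0 a) * E.dInv 1 a (X 1 a) - E.dInv 0 a (X 1 a) * E.dInv 1 a (X 0 a) ≠ 0 ∧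
      E.dInv 0 a (X 2 a) * E.dInv 1 a (X 3 a) - E.dInv 0 a (X 3 a) * E.dInv 1 a (X 2 a) ≠ 0 ∧
      E.dInv 0 a (X 4 a) ≠ 0 ∧ E.dInv 1 a (X 4 a) ≠ 0 ∧
      (Matrix.of fun j m => E.dInv j a (X m a) : Matrix (Fin 5) (Fin 5) ℝ).det ≠ 0 := by
  constructor
  · rintro ⟨-, h1, h2, h3, h4⟩
    have c0 := (h.coframe_indep_iff 0).1 (h3 0)
    have c1 := (h.coframe_indep_iff 1).1 (h3 1)
    exact ⟨h.finrank_D2_iff.1 h2, h.finrank_D1_iff.1 h1, c0.1, c0.2.1, c0.2.2, c1.2.2,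
      h.dInv_indep_iff.1 h4⟩
  · rintro ⟨h1, h2, h3, h4, h5, h6, h7⟩
    refine ⟨h.mem_dom, h.finrank_D1_iff.2 h2, h.finrank_D2_iff.2 h1, fun k => ?_,
      h.dInv_indep_iff.2 h7⟩
    rw [h.coframe_indep_iff]
    fin_cases k
    exacts [⟨h3, h4, h5⟩, ⟨h3, h4, h6⟩]

theorem smooth_sqInv (h : Adapted E X a) (h1 : Lam1 X a ≠ 0) {L : J1 → ℝ} (hL : SmoothAt L a) :
    SmoothAt (sqInv X L) a :=
  (((hL.fderiv_apply (h.smooth 4)).add (hL.mul h.smooth_brkTrace)).pow 2).div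
    ((h.smooth_Lam1.abs h1).pow 3) (pow_ne_zero 3 (abs_ne_zero.2 h1))

theorem smooth_frameInv (h : Adapted E X a) (h1 : Lam1 X a ≠ 0) (h2 : Lam2 X a ≠ 0) :
    SmoothAt (frameInv X) a := by
  refine SmoothAt.pi fun i => ?_
  fin_cases i
  · exact h.smooth_Lam12.div h.smooth_Lam1 h1
  · exact h.smooth_Lam12.div h.smooth_Lam2 h2
  · exact h.smooth_sqInv h1 h.smooth_Lam1
  · exact h.smooth_sqInv h1 h.smooth_Lam2
  · exact h.smooth_sqInv h1 h.smooth_Lam12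

theorem smooth_basicInv (h : Adapted E X a) (h1 : Lam1 X a ≠ 0) (h2 : Lam2 X a ≠ 0) :
    SmoothAt E.basicInv a :=
  (h.smooth_frameInv h1 h2).congr h.basicInv_eventuallyEq

theorem smooth_dInv (h : Adapted E X a) (hs : SmoothAt E.basicInv a) (j m : Fin 5) :
    SmoothAt (fun y => E.dInv j y (X m y)) a :=
  (hs.apply j).fderiv_apply (h.smooth m)

/-- By `genericAt_iff` genericity is the non-vanishing of seven functions, which are continuous once
`Lam1` and `Lam2` are non-zero. -/
theorem genericAt_eventually (h : Adapted E X a) (hg : E.GenericAt a) :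
    ∀ᶠ y in 𝓝 a, E.GenericAt y := by
  obtain ⟨h1, h2, h3, h4, h5, h6, h7⟩ := h.genericAt_iff.1 hg
  have s := h.smooth_dInv (h.smooth_basicInv h1 h2)
  filter_upwards [h.eventually, h.smooth_Lam1.continuousAt.eventually_ne h1,
    h.smooth_Lam2.continuousAt.eventually_ne h2,
    (((s 0 0).mul (s 1 1)).sub ((s 0 1).mul (s 1 0))).continuousAt.eventually_ne h3,
    (((s 0 2).mul (s 1 3)).sub ((s 0 3).mul (s 1 2))).continuousAt.eventually_ne h4,
    (s 0 4).continuousAt.eventually_ne h5, (s 1 4).continuousAt.eventually_ne h6,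
    (SmoothAt.det (M := fun y => Matrix.of fun j m => E.dInv j y (X m y))
      fun j m => s j m).continuousAt.eventually_ne h7] with y hy a1 a2 a3 a4 a5 a6 a7
  exact hy.genericAt_iff.2 ⟨a1, a2, a3, a4, a5, a6, a7⟩

end Adapted

/-! ### Local coordinates given by the invariants -/

/-- A smooth map with injective differential at `a` restricts to a local diffeomorphism. -/
theorem exists_local_diffeo {f : J1 → J1} {a : J1} (hf : SmoothAt f a)
    (hinj : Function.Injective (fderiv ℝ f a)) {U : Set J1} (hU : U ∈ 𝓝 a) :
    ∃ Φ : OpenPartialHomeomorph J1 J1, a ∈ Φ.source ∧ Φ.source ⊆ U ∧ (Φ : J1 → J1) = f ∧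
      ContDiffOn ℝ ∞ Φ Φ.source ∧ ContDiffOn ℝ ∞ Φ.symm Φ.target ∧
      ∀ x ∈ Φ.source, ContDiffAt ℝ ∞ f x ∧ Function.Injective (fderiv ℝ f x) := by
  have heq : ∀ x, Function.Injective (fderiv ℝ f x) →
      ∃ L : J1 ≃L[ℝ] J1, (L : J1 →L[ℝ] J1) = fderiv ℝ f x := fun x hx =>
    ⟨(LinearEquiv.ofInjectiveEndo (fderiv ℝ f x : J1 →ₗ[ℝ] J1) hx).toContinuousLinearEquiv, by
      ext v; rfl⟩
  have hdet : ∀ x, (fderiv ℝ f x).det ≠ 0 ↔ Function.Injective (fderiv ℝ f x) := fun x => by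
    rw [← isUnit_iff_ne_zero]
    change IsUnit (LinearMap.det _) ↔ _
    rw [← LinearMap.isUnit_iff_isUnit_det, LinearMap.isUnit_iff_ker_eq_bot]
    exact LinearMap.ker_eq_bot
  have hev : ∀ᶠ x in 𝓝 a, Function.Injective (fderiv ℝ f x) := by
    have hc : ContinuousAt (fun x => (fderiv ℝ f x).det) a :=
      ContinuousLinearMap.continuous_det.continuousAt.comp hf.fderiv.continuousAt
    filter_upwards [hc.eventually_ne ((hdet a).2 hinj)] with x hx using (hdet x).1 hx
  obtain ⟨s, hs, hso, has⟩ := mem_nhds_iff.1 (inter_mem hU (inter_mem hf hev))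
  obtain ⟨L, hL⟩ := heq a hinj
  have hfa : HasFDerivAt f (L : J1 →L[ℝ] J1) a := by
    rw [hL]; exact hf.differentiableAt.hasFDerivAt
  set Φ := (hf.contDiffAt.toOpenPartialHomeomorph f hfa (by simp)).restrOpen s hso with hΦ
  have hcoe : (Φ : J1 → J1) = f := rfl
  have hsrc : ∀ x ∈ Φ.source, x ∈ s := fun x hx => hx.2
  refine ⟨Φ, ⟨hf.contDiffAt.mem_toOpenPartialHomeomorph_source hfa (by simp), has⟩,
    fun x hx => (hs (hsrc x hx)).1, hcoe, ?_, ?_, fun x hx => (hs (hsrc x hx)).2⟩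
  · intro x hx
    rw [hcoe]
    exact (show ContDiffAt ℝ ∞ f x from (hs (hsrc x hx)).2.1).contDiffWithinAt
  · intro y hy
    have hx := hs (hsrc _ (Φ.map_target hy))
    have hx1 : ContDiffAt ℝ ∞ f (Φ.symm y) := hx.2.1
    obtain ⟨L', hL'⟩ := heq _ hx.2.2
    refine (Φ.contDiffAt_symm hy (f₀' := L') ?_ ?_).contDiffWithinAt
    · rw [hcoe, hL']; exact (hx1.differentiableAt (by simp)).hasFDerivAt
    · rw [hcoe]; exact hx1

namespace HypEq

variable {E : HypEq} {a : J1}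

theorem fderiv_basicInv_apply (h : DifferentiableAt ℝ E.basicInv a) (v : J1) (j : Fin 5) :
    fderiv ℝ E.basicInv a v j = E.dInv j a v := by
  have := (hasFDerivAt_pi'.1 h.hasFDerivAt j).fderiv
  rw [dInv, ContinuousLinearMap.coe_coe, this]
  rfl

theorem injective_fderiv_basicInv (h : DifferentiableAt ℝ E.basicInv a)
    (hi : LinearIndependent ℝ fun j => E.dInv j a) :
    Function.Injective (fderiv ℝ E.basicInv a) := by
  rw [injective_iff_map_eq_zero]
  intro v hv
  refine eq_zero_of_covectors hi fun j => ?_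
  rw [← fderiv_basicInv_apply h, hv]
  rfl

theorem GenericAt.smooth_basicInv (h : E.GenericAt a) : SmoothAt E.basicInv a := by
  obtain ⟨X, hX, -⟩ := exists_adapted h.mem_dom
  obtain ⟨h1, h2, -⟩ := hX.genericAt_iff.1 h
  exact hX.smooth_basicInv h1 h2

/-- The coefficients of the invariant coframe with respect to the differentials of the
invariants, at a point, computed in the frame `X`. -/
def coefMatrix (E : HypEq) (X : Fin 5 → J1 → J1) (k : Fin 2) (x : J1) : Matrix (Fin 5) (Fin 5) ℝ :=
  (Matrix.of fun i m => E.coframe k x i (X m x)) * (Matrix.of fun j m => E.dInv j x (X m x))⁻¹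

theorem coefMatrix_spec {X : Fin 5 → J1 → J1} (hX : Adapted E X a)
    (hi : LinearIndependent ℝ fun j => E.dInv j a) (k : Fin 2) (i : Fin 5) :
    E.coframe k a i = ∑ j, E.coefMatrix X k a i j • E.dInv j a := by
  refine linearMap_ext_frame hX.frameDet_ne fun m => ?_
  have hu := isUnit_iff_ne_zero.2 (hX.dInv_indep_iff.1 hi)
  have e : E.coefMatrix X k a * (Matrix.of fun j m => E.dInv j a (X m a)) =
      Matrix.of fun i m => E.coframe k a i (X m a) := by
    rw [coefMatrix, Matrix.mul_assoc, Matrix.nonsing_inv_mul _ hu, Matrix.mul_one]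
  have := congrFun (congrFun e i) m
  rw [Matrix.mul_apply] at this
  simp only [LinearMap.sum_apply, LinearMap.smul_apply, smul_eq_mul]
  exact this.symm

theorem smooth_coefMatrix {X : Fin 5 → J1 → J1} (hX : Adapted E X a)
    (hs : SmoothAt E.basicInv a) (hi : LinearIndependent ℝ fun j => E.dInv j a) (k : Fin 2)
    (i j : Fin 5) : SmoothAt (fun x => E.coefMatrix X k x i j) a := by
  simp only [coefMatrix, Matrix.mul_apply]
  refine SmoothAt.sum fun m _ => SmoothAt.mul ?_ (SmoothAt.matrix_inv
    (fun j m => hX.smooth_dInv hs j m) (hX.dInv_indep_iff.1 hi) m j)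
  have key := hX.smooth_dInv hs
  refine SmoothAt.congr ?_ (hX.eventually.mono fun y hy => hy.coframe_frame k i m)
  fin_cases i <;> fin_cases m <;> first | exact SmoothAt.const _ | exact key _ _

end HypEq

/-- The invariants have an invertible differential, so the inverse function theorem makes them
coordinates. The coefficient functions are the entries of `coefMatrix` written in these coordinates,
and independence of the differentials makes them unique. -/
theorem exists_coordinates (E : HypEq) (a : J1) (hg : E.GenericAt a) :
      ∃ Φ : OpenPartialHomeomorph J1 (Fin 5 → ℝ),
        a ∈ Φ.source ∧ Set.EqOn Φ E.basicInv Φ.source ∧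
        ContDiffOn ℝ ∞ Φ Φ.source ∧ ContDiffOn ℝ ∞ Φ.symm Φ.target ∧
        (∀ x ∈ Φ.source, E.GenericAt x) ∧
        ∀ k : Fin 2, ∃ w : Fin 5 → Fin 5 → (Fin 5 → ℝ) → ℝ,
          (∀ i j, ContDiffOn ℝ ∞ (w i j) Φ.target) ∧
          (∀ x ∈ Φ.source, ∀ i, E.coframe k x i = ∑ j, w i j (E.basicInv x) • E.dInv j x) ∧
          ∀ w' : Fin 5 → Fin 5 → (Fin 5 → ℝ) → ℝ,
            (∀ x ∈ Φ.source, ∀ i,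
              E.coframe k x i = ∑ j, w' i j (E.basicInv x) • E.dInv j x) →
            ∀ i j, Set.EqOn (w' i j) (w i j) Φ.target := by
  obtain ⟨X, hX, -⟩ := exists_adapted hg.mem_dom
  have hs := hg.smooth_basicInv
  obtain ⟨Φ, ha, hU, hΦ, c1, c2, -⟩ := exists_local_diffeo hs
    (HypEq.injective_fderiv_basicInv hs.differentiableAt hg.inv_indep)
    (inter_mem hX.eventually (hX.genericAt_eventually hg))
  have hgen : ∀ x ∈ Φ.source, E.GenericAt x := fun x hx => (hU hx).2
  have hinv : ∀ y ∈ Φ.target, E.basicInv (Φ.symm y) = y := fun y hy => by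
    rw [← hΦ]; exact Φ.right_inv hy
  have hinv' : ∀ x ∈ Φ.source, Φ.symm (E.basicInv x) = x := fun x hx => by
    rw [← hΦ]; exact Φ.left_inv hx
  refine ⟨Φ, ha, fun x _ => by rw [hΦ], c1, c2, hgen, fun k =>
    ⟨fun i j y => E.coefMatrix X k (Φ.symm y) i j, fun i j y hy => ?_, fun x hx i => ?_,
      fun w' hw' i j y hy => ?_⟩⟩
  · have hx := Φ.map_target hy
    have h1 := (HypEq.smooth_coefMatrix (hU hx).1 (hgen _ hx).smooth_basicInv
      (hgen _ hx).inv_indep k i j).contDiffAt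
    exact h1.comp_contDiffWithinAt y (c2 y hy)
  · simp only [hinv' x hx]
    exact HypEq.coefMatrix_spec (hU hx).1 (hgen x hx).inv_indep k i
  · have hx := Φ.map_target hy
    have h1 := hw' _ hx i
    rw [HypEq.coefMatrix_spec (hU hx).1 (hgen _ hx).inv_indep k i, hinv y hy] at h1
    have h2 := (Fintype.linearIndependent_iff.1 (hgen _ hx).inv_indep)
      (fun j => w' i j y - E.coefMatrix X k (Φ.symm y) i j) (by
        simp only [sub_smul, Finset.sum_sub_distrib]
        rw [← h1, sub_self]) j
    exact sub_eq_zero.1 h2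

/-! ### The equation in terms of its characteristic planes -/

/-- The plane of a 2-jet, as a set of vectors. -/
theorem mem_jetPlane {a v : J1} {r s t : ℝ} : v ∈ jetPlane a r s t ↔
    contactForm a v = 0 ∧ v 3 = r * v 0 + s * v 1 ∧ v 4 = s * v 0 + t * v 1 := by
  rw [jetPlane, Submodule.mem_span_pair]
  constructor
  · rintro ⟨c, e, rfl⟩
    refine ⟨?_, ?_, ?_⟩ <;> simp [contactForm_apply] <;> ring
  · rintro ⟨hv, h3, h4⟩
    refine ⟨v 0, v 1, cartan_ext ?_ hv ?_ ?_ ?_ ?_⟩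
    · simp [contactForm_apply]; ring
    · simp
    · simp
    · simp [h3]; ring
    · simp [h4]; ring

theorem Om_jetPlane {a v w : J1} {r s t : ℝ} (hv : v ∈ jetPlane a r s t)
    (hw : w ∈ jetPlane a r s t) : Om v w = 0 := by
  obtain ⟨-, v3, v4⟩ := mem_jetPlane.1 hv
  obtain ⟨-, w3, w4⟩ := mem_jetPlane.1 hw
  simp only [Om, v3, v4, w3, w4]
  ring

/-- The bridge between the equation and J: as K is Lagrangian, vanishing of dU(J·, ·) on K means
that K is J-invariant. -/
theorem HypEq.Om_jop_jetPlane (E : HypEq) {a v w : J1} {r s t : ℝ} (hv : v ∈ jetPlane a r s t)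
    (hw : w ∈ jetPlane a r s t) :
    Om (jop (E.coeff a) a v) w = 2 * (v 0 * w 1 - v 1 * w 0) *
      (E.N a * (r * t - s ^ 2) + E.A a * r + E.B a * s + E.C a * t + E.D a) := by
  obtain ⟨-, v3, v4⟩ := mem_jetPlane.1 hv
  obtain ⟨-, w3, w4⟩ := mem_jetPlane.1 hw
  simp [Om, jop, v3, v4, w3, w4, N, A, B, C, D]
  ring

/-- A 2-jet belongs to the equation if and only if its plane meets the first characteristic
plane. -/
theorem HypEq.holds_iff (E : HypEq) {a : J1} (ha : a ∈ E.dom) (r s t : ℝ) :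
    E.Holds a r s t ↔ ∃ v ∈ jetPlane a r s t, v ∈ E.D1 a ∧ v ≠ 0 := by
  have hd := E.sqrt_disc_pos ha
  constructor
  · intro h
    have h' : E.coeff a 0 * (r * t - s ^ 2) + E.coeff a 1 * r + E.coeff a 2 * s +
      E.coeff a 3 * t + E.coeff a 4 = 0 := h
    set e1 : J1 := ![1, 0, a 3, r, s] with he1
    set e2 : J1 := ![0, 1, a 4, s, t] with he2
    have m1 : contactForm a e1 = 0 := by simp [contactForm_apply, he1]
    have m2 : contactForm a e2 = 0 := by simp [contactForm_apply, he2]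
    -- K is J-invariant, so J + √Δ maps it into K ∩ D¹.
    have k1 : jop (E.coeff a) a e1 + (1 * √(E.disc a)) • e1 ∈ jetPlane a r s t := by
      refine mem_jetPlane.2 ⟨by rw [map_add, contactForm_jop, map_smul, m1, smul_zero, add_zero],
        ?_, ?_⟩ <;> simp [jop, he1]
      · ring
      · linear_combination -2 * h'
    have k2 : jop (E.coeff a) a e2 + (1 * √(E.disc a)) • e2 ∈ jetPlane a r s t := by
      refine mem_jetPlane.2 ⟨by rw [map_add, contactForm_jop, map_smul, m2, smul_zero, add_zero],
        ?_, ?_⟩ <;> simp [jop, he2]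
      · linear_combination 2 * h'
      · ring
    have d1 := E.jop_add_mem (ε := 1) (by norm_num) ha m1
    have d2 := E.jop_add_mem (ε := 1) (by norm_num) ha m2
    -- The two images cannot both vanish: the sum of the x-component of the first and the
    -- y-component of the second is 2√Δ.
    by_cases z1 : jop (E.coeff a) a e1 + (1 * √(E.disc a)) • e1 = 0
    · refine ⟨_, k2, d2, fun z2 => ?_⟩
      have c1 := congrFun z1 0
      have c2 := congrFun z2 1
      simp [jop, he1, he2] at c1 c2
      linarith
    · exact ⟨_, k1, d1, z1⟩
  · rintro ⟨v, hv, hD, h0⟩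
    obtain ⟨hc, v3, v4⟩ := mem_jetPlane.1 hv
    have hJ := (E.mem_charPlane.1 hD).2
    -- The vector of K whose horizontal part is that of `v` turned by a right angle, so that dx ∧ dy
    -- takes the value v₀² + v₁² on the pair.
    set w : J1 := ![-v 1, v 0, a 3 * (-v 1) + a 4 * v 0, r * (-v 1) + s * v 0,
      s * (-v 1) + t * v 0] with hw
    have hwm : w ∈ jetPlane a r s t := mem_jetPlane.2 ⟨by simp [contactForm_apply, hw],
      by simp [hw], by simp [hw]⟩
    have h1 := E.Om_jop_jetPlane hv hwm
    rw [hJ, Om_smul_left, Om_jetPlane hv hwm, mul_zero] at h1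
    have h2 : v 0 * w 1 - v 1 * w 0 ≠ 0 := by
      simp only [hw, Matrix.cons_val]
      intro h3
      have z0 : v 0 = 0 := by nlinarith [sq_nonneg (v 0), sq_nonneg (v 1)]
      have z1 : v 1 = 0 := by nlinarith [sq_nonneg (v 0), sq_nonneg (v 1)]
      apply h0
      refine cartan_ext hc (map_zero _) z0 z1 ?_ ?_
      · rw [v3, z0, z1]; simp
      · rw [v4, z0, z1]; simp
    exact (mul_eq_zero.1 h1.symm).resolve_left (mul_ne_zero two_ne_zero h2)

/-- Two independent contact vectors, orthogonal with respect to `dU`, span the plane of a 2-jet if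
their projections to the `(x, y)`-plane are independent. -/
theorem exists_jetPlane {a v w : J1} (hv : contactForm a v = 0) (hw : contactForm a w = 0)
    (hO : Om v w = 0) (hp : v 0 * w 1 - v 1 * w 0 ≠ 0) :
    ∃ r s t : ℝ, Submodule.span ℝ {v, w} = jetPlane a r s t := by
  set p := v 0 * w 1 - v 1 * w 0 with hpdef
  simp only [Om] at hO
  refine ⟨(v 3 * w 1 - v 1 * w 3) / p, (v 0 * w 3 - v 3 * w 0) / p,
    (v 0 * w 4 - v 4 * w 0) / p, ?_⟩
  have hvm : v ∈ jetPlane a ((v 3 * w 1 - v 1 * w 3) / p) ((v 0 * w 3 - v 3 * w 0) / p)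
      ((v 0 * w 4 - v 4 * w 0) / p) := by
    refine mem_jetPlane.2 ⟨hv, ?_, ?_⟩
    · field_simp
      rw [hpdef]; ring
    · field_simp
      rw [hpdef]; linear_combination (-v 0) * hO
  have hwm : w ∈ jetPlane a ((v 3 * w 1 - v 1 * w 3) / p) ((v 0 * w 3 - v 3 * w 0) / p)
      ((v 0 * w 4 - v 4 * w 0) / p) := by
    refine mem_jetPlane.2 ⟨hw, ?_, ?_⟩
    · field_simp
      rw [hpdef]; ring
    · field_simp
      rw [hpdef]; linear_combination (-w 0) * hO
  apply le_antisymm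
  · rw [Submodule.span_le]
    rintro x (rfl | rfl)
    exacts [hvm, hwm]
  · generalize (v 3 * w 1 - v 1 * w 3) / p = r at *
    generalize (v 0 * w 3 - v 3 * w 0) / p = s at *
    generalize (v 0 * w 4 - v 4 * w 0) / p = t at *
    intro u hu
    obtain ⟨hu0, u3, u4⟩ := mem_jetPlane.1 hu
    obtain ⟨-, v3, v4⟩ := mem_jetPlane.1 hvm
    obtain ⟨-, w3, w4⟩ := mem_jetPlane.1 hwm
    refine Submodule.mem_span_pair.2 ⟨(u 0 * w 1 - u 1 * w 0) / p, (v 0 * u 1 - v 1 * u 0) / p,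
      cartan_ext (by simp [hv, hw]) hu0 ?_ ?_ ?_ ?_⟩ <;>
      simp only [Pi.add_apply, Pi.smul_apply, smul_eq_mul, u3, v3, w3, u4, v4, w4] <;>
      field_simp <;> rw [hpdef] <;> ring

/-- Cramer's rule in a two-dimensional space with `Om` as area form. It replaces dimension arguments
below: a vector of the plane orthogonal to two vectors with `Om v w ≠ 0` is zero. -/
theorem HypEq.plane_identity {E : HypEq} {a : J1} (ha : a ∈ E.dom) {ε : ℝ} (hε : ε ^ 2 = 1)
    {u v w : J1} (hu : u ∈ E.charPlane ε a) (hv : v ∈ E.charPlane ε a)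
    (hw : w ∈ E.charPlane ε a) : Om v w • u = Om u w • v - Om u v • w := by
  obtain ⟨x, y, -, -, -, -, hs⟩ := E.exists_pluck_at ha hε
  rw [hs] at hu hv hw
  obtain ⟨p, q, rfl⟩ := Submodule.mem_span_pair.1 hu
  obtain ⟨p', q', rfl⟩ := Submodule.mem_span_pair.1 hv
  obtain ⟨p'', q'', rfl⟩ := Submodule.mem_span_pair.1 hw
  simp only [Om_add_left, Om_add_right, Om_smul_left, Om_smul_right, Om_self, Om_swap x y]
  module

theorem HypEq.charPlane_eq_of_Om_ne {E : HypEq} {a : J1} (ha : a ∈ E.dom) {ε : ℝ}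
    (hε : ε ^ 2 = 1) {v w : J1} (hv : v ∈ E.charPlane ε a) (hw : w ∈ E.charPlane ε a)
    (h : Om v w ≠ 0) : E.charPlane ε a = Submodule.span ℝ {v, w} := by
  apply le_antisymm
  · intro u hu
    have := E.plane_identity ha hε hu hv hw
    have e : u = (Om v w)⁻¹ • (Om u w • v - Om u v • w) := by
      rw [← this, smul_smul, inv_mul_cancel₀ h, one_smul]
    rw [e, Submodule.mem_span_pair]
    exact ⟨(Om v w)⁻¹ * Om u w, -((Om v w)⁻¹ * Om u v), by module⟩
  · rw [Submodule.span_le]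
    rintro x (rfl | rfl) <;> assumption

theorem HypEq.exists_Om_ne {E : HypEq} {a : J1} (ha : a ∈ E.dom) {ε : ℝ}
    (hε : ε ^ 2 = 1) : ∃ v ∈ E.charPlane ε a, ∃ w ∈ E.charPlane ε a, Om v w ≠ 0 := by
  obtain ⟨x, y, -, -, -, hO, hs⟩ := E.exists_pluck_at ha hε
  refine ⟨x, hs ▸ Submodule.subset_span (by simp), y, hs ▸ Submodule.subset_span (by simp), ?_⟩
  exact E.Om_ne_zero_of_span ha hε hs

/-! ### Linear contact maps taking one equation to another -/

/-- A real vector space is not a finite union of proper subspaces; applied to `v` and afterwards to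
`w`, this puts one pair in general position for all the forms at once. -/
theorem exists_forall_bilin_ne {A B : Type*} [AddCommGroup A] [Module ℝ A] [AddCommGroup B]
    [Module ℝ B] {ι : Type*} [Finite ι] (b : ι → A →ₗ[ℝ] B →ₗ[ℝ] ℝ)
    (h : ∀ i, ∃ v w, b i v w ≠ 0) : ∃ v w, ∀ i, b i v w ≠ 0 := by
  obtain ⟨v, hv⟩ := Submodule.exists_forall_notMem_of_forall_ne_top
    (fun i => LinearMap.ker (b i)) fun i htop => by
      obtain ⟨v, w, hvw⟩ := h i
      have : v ∈ LinearMap.ker (b i) := by rw [htop]; trivial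
      exact hvw (by rw [LinearMap.mem_ker.1 this]; rfl)
  obtain ⟨w, hw⟩ := Submodule.exists_forall_notMem_of_forall_ne_top
    (fun i => LinearMap.ker (b i v)) fun i htop => by
      apply hv i
      rw [LinearMap.mem_ker]
      ext w
      have : w ∈ LinearMap.ker (b i v) := by rw [htop]; trivial
      exact this
  exact ⟨v, w, hw⟩

/-- The form `dx ∧ dy`. -/
def horForm : J1 →ₗ[ℝ] J1 →ₗ[ℝ] ℝ :=
  LinearMap.mk₂ ℝ (fun v w => v 0 * w 1 - v 1 * w 0)
    (by intros; simp; ring) (by intros; simp; ring) (by intros; simp; ring)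
    (by intros; simp; ring)

theorem horForm_apply (v w : J1) : horForm v w = v 0 * w 1 - v 1 * w 0 := rfl

/-- The form `dU(J v, w)`. -/
def jopForm (c : Fin 5 → ℝ) (a : J1) : J1 →ₗ[ℝ] J1 →ₗ[ℝ] ℝ :=
  LinearMap.mk₂ ℝ (fun v w => Om (jop c a v) w)
    (fun _ _ _ => by rw [jop_add, Om_add_left])
    (fun _ _ _ => by rw [jop_smul, Om_smul_left]; rfl)
    (fun _ _ _ => by rw [Om_add_right])
    (fun _ _ _ => by rw [Om_smul_right]; rfl)

theorem jopForm_apply (c : Fin 5 → ℝ) (a v w : J1) : jopForm c a v w = Om (jop c a v) w := rfl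

/-- If `A` and `B` were orthogonal for dx ∧ dy, splitting the two horizontal basis vectors would
show that one of them projects onto the (x, y)-plane. The other one would then be vertical, on which
`Om` vanishes, a contradiction. -/
theorem exists_horForm_ne {a : J1} {A B : Submodule ℝ J1} (hAB : A ⊔ B = cartan a)
    (hA : ∃ v ∈ A, ∃ w ∈ A, Om v w ≠ 0) (hB : ∃ v ∈ B, ∃ w ∈ B, Om v w ≠ 0) :
    ∃ v ∈ A, ∃ w ∈ B, horForm v w ≠ 0 := by
  by_contra! H
  have h1 : (![1, 0, a 3, 0, 0] : J1) ∈ A ⊔ B := by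
    rw [hAB]; change contactForm a _ = 0; simp [contactForm_apply]
  have h2 : (![0, 1, a 4, 0, 0] : J1) ∈ A ⊔ B := by
    rw [hAB]; change contactForm a _ = 0; simp [contactForm_apply]
  obtain ⟨v1, hv1, w1, hw1, e1⟩ := Submodule.mem_sup.1 h1
  obtain ⟨v2, hv2, w2, hw2, e2⟩ := Submodule.mem_sup.1 h2
  have key : horForm v1 v2 + horForm w1 w2 = 1 := by
    have : horForm (v1 + w1) (v2 + w2) = 1 := by rw [e1, e2]; simp [horForm_apply]
    have h3 := H v1 hv1 w2 hw2
    have h4 := H v2 hv2 w1 hw1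
    have h5 : horForm w1 v2 = -horForm v2 w1 := by simp only [horForm_apply]; ring
    simp only [map_add, LinearMap.add_apply] at this
    rw [h3, h5, h4] at this
    linarith
  have vert : ∀ u u' w : J1, horForm u u' ≠ 0 → horForm u w = 0 → horForm u' w = 0 →
      w 0 = 0 ∧ w 1 = 0 := by
    intro u u' w hne z1 z2
    simp only [horForm_apply] at *
    constructor
    · refine (mul_eq_zero.1 (?_ : (u 0 * u' 1 - u 1 * u' 0) * w 0 = 0)).resolve_left hne
      linear_combination u' 0 * z1 - u 0 * z2
    · refine (mul_eq_zero.1 (?_ : (u 0 * u' 1 - u 1 * u' 0) * w 1 = 0)).resolve_left hne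
      linear_combination u' 1 * z1 - u 1 * z2
  have hOm : ∀ v w : J1, v 0 = 0 ∧ v 1 = 0 → w 0 = 0 ∧ w 1 = 0 → Om v w = 0 := by
    rintro v w ⟨h1, h2⟩ ⟨h3, h4⟩
    simp [Om, h1, h2, h3, h4]
  by_cases hz : horForm v1 v2 = 0
  · have hz' : horForm w1 w2 ≠ 0 := by rw [hz] at key; linarith
    obtain ⟨v, hv, w, hw, hne⟩ := hA
    have sw : ∀ v w : J1, horForm v w = 0 → horForm w v = 0 := by
      intro v w h; simp only [horForm_apply] at *; linarith
    exact hne (hOm v w (vert w1 w2 v hz' (sw _ _ (H v hv w1 hw1)) (sw _ _ (H v hv w2 hw2)))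
      (vert w1 w2 w hz' (sw _ _ (H w hw w1 hw1)) (sw _ _ (H w hw w2 hw2))))
  · obtain ⟨v, hv, w, hw, hne⟩ := hB
    exact hne (hOm v w (vert v1 v2 v hz (H v1 hv1 v hv) (H v2 hv2 v hv))
      (vert v1 v2 w hz (H v1 hv1 w hw) (H v2 hv2 w hw)))

/-- A linear isomorphism of the tangent spaces which preserves the Cartan planes and the conformal
symplectic structures on them and takes the 2-jets of `E` to those of `E'`. -/
structure LinearEquivalence (E : HypEq) (a : J1) (E' : HypEq) (a' : J1) (T : J1 →ₗ[ℝ] J1) :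
    Prop where
  mem : a ∈ E.dom
  mem' : a' ∈ E'.dom
  injective : Function.Injective T
  map_cartan : (cartan a).map T = cartan a'
  conformal : ∃ l : ℝ, l ≠ 0 ∧ ∀ v ∈ cartan a, ∀ w ∈ cartan a, Om (T v) (T w) = l * Om v w
  holds : ∀ r s t r' s' t' : ℝ, (jetPlane a r s t).map T = jetPlane a' r' s' t' →
    E.Holds a r s t → E'.Holds a' r' s' t'

namespace LinearEquivalence

variable {E E' : HypEq} {a a' : J1} {T : J1 →ₗ[ℝ] J1}

theorem map_mem (h : LinearEquivalence E a E' a' T) {v : J1} (hv : contactForm a v = 0) :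
    contactForm a' (T v) = 0 := by
  have : T v ∈ cartan a' := h.map_cartan ▸ Submodule.mem_map_of_mem hv
  exact this

/-- Planes ⟨v, w⟩ with v in D¹ and w in D² are Lagrangian and meet D¹. If they and their images are
transversal to the vertical, they are 2-jets of `E` whose images are 2-jets of `E'`, which forces
the value zero. A non-zero bilinear form would be non-zero at such a pair in general position. -/
theorem jopForm_eq_zero (h : LinearEquivalence E a E' a' T) {v w : J1} (hv : v ∈ E.D1 a)
    (hw : w ∈ E.D2 a) : jopForm (E'.coeff a') a' (T v) (T w) = 0 := by
  by_contra hne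
  obtain ⟨l, hl, hconf⟩ := h.conformal
  let b : Fin 3 → E.D1 a →ₗ[ℝ] E.D2 a →ₗ[ℝ] ℝ :=
    ![horForm.compl₁₂ (E.D1 a).subtype (E.D2 a).subtype,
      horForm.compl₁₂ (T ∘ₗ (E.D1 a).subtype) (T ∘ₗ (E.D2 a).subtype),
      (jopForm (E'.coeff a') a').compl₁₂ (T ∘ₗ (E.D1 a).subtype) (T ∘ₗ (E.D2 a).subtype)]
  have hb : ∀ i, ∃ v w, b i v w ≠ 0 := by
    intro i
    fin_cases i
    · obtain ⟨v, hv, w, hw, hvw⟩ := exists_horForm_ne (E.D1_sup_D2 h.mem)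
        (E.exists_Om_ne h.mem (by norm_num)) (E.exists_Om_ne h.mem (by norm_num))
      exact ⟨⟨v, hv⟩, ⟨w, hw⟩, hvw⟩
    · have key : ∀ ε : ℝ, ε ^ 2 = 1 → ∃ v ∈ (E.charPlane ε a).map T,
          ∃ w ∈ (E.charPlane ε a).map T, Om v w ≠ 0 := by
        intro ε hε
        obtain ⟨v, hv, w, hw, hvw⟩ := E.exists_Om_ne h.mem hε
        exact ⟨T v, Submodule.mem_map_of_mem hv, T w, Submodule.mem_map_of_mem hw, by
          rw [hconf v hv.1 w hw.1]; exact mul_ne_zero hl hvw⟩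
      obtain ⟨v, hv, w, hw, hvw⟩ := exists_horForm_ne (a := a')
        (A := (E.D1 a).map T) (B := (E.D2 a).map T)
        (by rw [← Submodule.map_sup, E.D1_sup_D2 h.mem, h.map_cartan])
        (key 1 (by norm_num)) (key (-1) (by norm_num))
      obtain ⟨v, hv, rfl⟩ := hv
      obtain ⟨w, hw, rfl⟩ := hw
      exact ⟨⟨v, hv⟩, ⟨w, hw⟩, hvw⟩
    · exact ⟨⟨v, hv⟩, ⟨w, hw⟩, hne⟩
  obtain ⟨⟨x, hx⟩, ⟨y, hy⟩, hxy⟩ := exists_forall_bilin_ne b hb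
  have h0 : horForm x y ≠ 0 := hxy 0
  have h1 : horForm (T x) (T y) ≠ 0 := hxy 1
  have h2 : Om (jop (E'.coeff a') a' (T x)) (T y) ≠ 0 := hxy 2
  have hO := E.Om_eq_zero_of_mem h.mem hx hy
  obtain ⟨r, s, t, e⟩ := exists_jetPlane hx.1 hy.1 hO h0
  obtain ⟨r', s', t', e'⟩ := exists_jetPlane (h.map_mem hx.1) (h.map_mem hy.1)
    (by rw [hconf x hx.1 y hy.1, hO, mul_zero]) h1
  have hx' : x ∈ jetPlane a r s t := e ▸ Submodule.subset_span (by simp)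
  have hlift : (jetPlane a r s t).map T = jetPlane a' r' s' t' := by
    rw [← e, ← e', Submodule.map_span, Set.image_pair]
  have hH : E'.Holds a' r' s' t' := h.holds r s t r' s' t' hlift
    ((E.holds_iff h.mem r s t).2 ⟨x, hx', hx, by rintro rfl; simp at h0⟩)
  have k := E'.Om_jop_jetPlane (v := T x) (w := T y) (a := a') (r := r') (s := s') (t := t')
    (e' ▸ Submodule.subset_span (by simp)) (e' ▸ Submodule.subset_span (by simp))
  rw [show E'.N a' * (r' * t' - s' ^ 2) + E'.A a' * r' + E'.B a' * s' + E'.C a' * t' + E'.D a' = 0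
    from hH, mul_zero] at k
  exact h2 k

/-- A characteristic plane is taken to a characteristic plane. -/
theorem map_D1_le (h : LinearEquivalence E a E' a' T) :
    ∃ ε : ℝ, (ε = 1 ∨ ε = -1) ∧ (E.D1 a).map T ≤ E'.charPlane ε a' := by
  obtain ⟨l, hl, hconf⟩ := h.conformal
  obtain ⟨x, hx, y, hy, hxy⟩ := E.exists_Om_ne h.mem (by norm_num : (1 : ℝ) ^ 2 = 1)
  -- J' preserves the image of D¹: the D²-component of the preimage of J'(Tv) is `Om`-orthogonal to
  -- D², hence zero.
  have hpres : ∀ v ∈ E.D1 a, ∃ u ∈ E.D1 a, jop (E'.coeff a') a' (T v) = T u := by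
    intro v hv
    have hm : jop (E'.coeff a') a' (T v) ∈ cartan a' := contactForm_jop _ _ _
    rw [← h.map_cartan] at hm
    obtain ⟨u, hu, hu'⟩ := hm
    have hu0 : contactForm a u = 0 := hu
    change contactForm a u = 0 at hu
    change u ∈ cartan a at hu
    rw [← E.D1_sup_D2 h.mem] at hu
    obtain ⟨u1, hu1, u2, hu2, rfl⟩ := Submodule.mem_sup.1 hu
    have hz : ∀ w ∈ E.D2 a, Om u2 w = 0 := by
      intro w hw
      have h1 := h.jopForm_eq_zero hv hw
      rw [jopForm_apply, ← hu', hconf _ hu0 _ hw.1, Om_add_left,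
        E.Om_eq_zero_of_mem h.mem hu1 hw, zero_add] at h1
      exact (mul_eq_zero.1 h1).resolve_left hl
    obtain ⟨x', hx', y', hy', hxy'⟩ := E.exists_Om_ne h.mem (by norm_num : (-1 : ℝ) ^ 2 = 1)
    have h2 := E.plane_identity h.mem (by norm_num) hu2 hx' hy'
    rw [hz x' hx', hz y' hy', zero_smul, zero_smul, sub_zero] at h2
    have h3 := (smul_eq_zero.1 h2).resolve_left hxy'
    exact ⟨u1, hu1, by rw [← hu', h3, add_zero]⟩
  -- By `Om_jop_self`, J'(Tv) is orthogonal to Tv, hence proportional to it in a symplectic plane.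
  -- As every vector is an eigenvector, J' is scalar on the image; comparing x, y and x + y below
  -- identifies the eigenvalues.
  have hscal : ∀ v ∈ E.D1 a, v ≠ 0 → ∃ κ : ℝ, jop (E'.coeff a') a' (T v) = κ • T v := by
    intro v hv hv0
    obtain ⟨u, hu, hJ⟩ := hpres v hv
    have h1 := Om_jop_self (E'.coeff a') a' (T v)
    rw [hJ, hconf u hu.1 v hv.1] at h1
    have huv : Om u v = 0 := (mul_eq_zero.1 h1).resolve_left hl
    obtain ⟨w, hw, hvw⟩ : ∃ w ∈ E.D1 a, Om v w ≠ 0 := by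
      by_contra! H
      have h2 := E.plane_identity h.mem (by norm_num) hv hx hy
      rw [H x hx, H y hy, zero_smul, zero_smul, sub_zero] at h2
      exact hv0 ((smul_eq_zero.1 h2).resolve_left hxy)
    have h2 := E.plane_identity h.mem (by norm_num) hu hv hw
    rw [huv, zero_smul, sub_zero] at h2
    refine ⟨(Om v w)⁻¹ * Om u w, ?_⟩
    rw [hJ, ← map_smul, mul_smul, ← h2, smul_smul, inv_mul_cancel₀ hvw, one_smul]
  have hx0 : x ≠ 0 := by rintro rfl; simp [Om] at hxy
  have hy0 : y ≠ 0 := by rintro rfl; simp [Om] at hxy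
  have hxy0 : x + y ≠ 0 := by
    intro hz
    apply hxy
    rw [eq_neg_of_add_eq_zero_right hz]
    simp [Om]; ring
  obtain ⟨κ, hκ⟩ := hscal x hx hx0
  obtain ⟨μ, hμ⟩ := hscal y hy hy0
  obtain ⟨ν, hν⟩ := hscal (x + y) (Submodule.add_mem _ hx hy) hxy0
  have hTxy : Om (T x) (T y) ≠ 0 := by
    rw [hconf x hx.1 y hy.1]; exact mul_ne_zero hl hxy
  rw [map_add, jop_add, hκ, hμ] at hν
  have e1 : κ = ν := by
    have := congrArg (fun z => Om z (T y)) hν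
    simp only [Om_add_left, Om_smul_left, Om_self, mul_zero, add_zero] at this
    exact mul_right_cancel₀ hTxy this
  have e2 : μ = ν := by
    have := congrArg (fun z => Om (T x) z) hν
    simp only [Om_add_right, Om_smul_right, Om_self, mul_zero, zero_add] at this
    exact mul_right_cancel₀ hTxy this
  have hsq : κ ^ 2 = E'.disc a' := by
    have h1 := jop_jop (E'.coeff a') (h.map_mem hx.1)
    rw [hκ, jop_smul, hκ, smul_smul, ← E'.disc_eq] at h1
    have h2 : T x ≠ 0 := fun hz => hx0 (h.injective (by rw [hz, map_zero]))
    have := smul_left_injective ℝ h2 h1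
    rw [sq]; exact this
  have hroot : κ = √(E'.disc a') ∨ κ = -√(E'.disc a') := by
    rw [← E'.sq_sqrt_disc h.mem'] at hsq
    exact sq_eq_sq_iff_eq_or_eq_neg.1 hsq
  obtain ⟨ε, hε, hκε⟩ : ∃ ε : ℝ, (ε = 1 ∨ ε = -1) ∧ κ = ε * √(E'.disc a') := by
    rcases hroot with h' | h'
    · exact ⟨1, Or.inl rfl, by rw [h', one_mul]⟩
    · exact ⟨-1, Or.inr rfl, by rw [h']; ring⟩
  refine ⟨ε, hε, ?_⟩
  rw [HypEq.D1, E.charPlane_eq_of_Om_ne h.mem (by norm_num) hx hy hxy, Submodule.map_span,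
    Set.image_pair, Submodule.span_le]
  rintro z (rfl | rfl)
  · exact E'.mem_charPlane.2 ⟨h.map_mem hx.1, by rw [hκ, hκε]⟩
  · exact E'.mem_charPlane.2 ⟨h.map_mem hy.1, by rw [hμ, e2, ← e1, hκε]⟩

/-- D² is the orthogonal complement of D¹ with respect to dU, so a conformal map controlling one
plane controls the other. -/
theorem map_charPlanes_of_le (h : LinearEquivalence E a E' a' T)
    (hle : (E.D1 a).map T ≤ E'.D1 a') :
    (E.D1 a).map T = E'.D1 a' ∧ (E.D2 a).map T = E'.D2 a' := by
  obtain ⟨l, hl, hconf⟩ := h.conformal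
  have hTmem : ∀ v ∈ E.D1 a, T v ∈ E'.D1 a' := fun v hv => hle (Submodule.mem_map_of_mem hv)
  have hOm : ∀ {v w : J1}, contactForm a v = 0 → contactForm a w = 0 → Om v w ≠ 0 →
      Om (T v) (T w) ≠ 0 := fun {v w} hv hw hne => by
    rw [hconf v hv w hw]; exact mul_ne_zero hl hne
  obtain ⟨x, hx, y, hy, hxy⟩ := E.exists_Om_ne h.mem (by norm_num : (1 : ℝ) ^ 2 = 1)
  obtain ⟨x', hx', y', hy', hxy'⟩ := E.exists_Om_ne h.mem (by norm_num : (-1 : ℝ) ^ 2 = 1)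
  have hTmem' : ∀ w ∈ E.D2 a, T w ∈ E'.D2 a' := by
    intro w hw
    have hm : T w ∈ E'.D1 a' ⊔ E'.D2 a' := by
      rw [E'.D1_sup_D2 h.mem']; exact h.map_mem hw.1
    obtain ⟨p, hp, q, hq, e⟩ := Submodule.mem_sup.1 hm
    have hz : ∀ v ∈ E.D1 a, Om p (T v) = 0 := by
      intro v hv
      have h1 : Om (T w) (T v) = 0 := by
        rw [hconf w hw.1 v hv.1, Om_swap, E.Om_eq_zero_of_mem h.mem hv hw]; simp
      rw [← e, Om_add_left, Om_swap (T v) q, E'.Om_eq_zero_of_mem h.mem' (hTmem v hv) hq] at h1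
      linarith
    have h2 := E'.plane_identity h.mem' (by norm_num) hp (hTmem x hx) (hTmem y hy)
    rw [hz x hx, hz y hy, zero_smul, zero_smul, sub_zero] at h2
    rw [← e, (smul_eq_zero.1 h2).resolve_left (hOm hx.1 hy.1 hxy), zero_add]
    exact hq
  constructor
  · rw [HypEq.D1, HypEq.D1, E.charPlane_eq_of_Om_ne h.mem (by norm_num) hx hy hxy,
      E'.charPlane_eq_of_Om_ne h.mem' (by norm_num) (hTmem x hx) (hTmem y hy)
        (hOm hx.1 hy.1 hxy), Submodule.map_span, Set.image_pair]
  · rw [HypEq.D2, HypEq.D2, E.charPlane_eq_of_Om_ne h.mem (by norm_num) hx' hy' hxy',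
      E'.charPlane_eq_of_Om_ne h.mem' (by norm_num) (hTmem' x' hx') (hTmem' y' hy')
        (hOm hx'.1 hy'.1 hxy'), Submodule.map_span, Set.image_pair]

end LinearEquivalence

/-! ### Local diffeomorphisms -/

/-- `φ` is a diffeomorphism between open sets. -/
structure IsDiffeo (φ : OpenPartialHomeomorph J1 J1) : Prop where
  contDiffOn : ContDiffOn ℝ ∞ φ φ.source
  contDiffOn_symm : ContDiffOn ℝ ∞ φ.symm φ.target

namespace IsDiffeo

variable {φ : OpenPartialHomeomorph J1 J1} {x : J1}

theorem symm (h : IsDiffeo φ) : IsDiffeo φ.symm := ⟨h.contDiffOn_symm, h.contDiffOn⟩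

theorem contDiffAt (h : IsDiffeo φ) (hx : x ∈ φ.source) : ContDiffAt ℝ ∞ φ x :=
  h.contDiffOn.contDiffAt (φ.open_source.mem_nhds hx)

theorem smoothAt (h : IsDiffeo φ) (hx : x ∈ φ.source) : SmoothAt φ x :=
  .of_contDiffOn (φ.open_source.mem_nhds hx) h.contDiffOn

theorem differentiableAt (h : IsDiffeo φ) (hx : x ∈ φ.source) : DifferentiableAt ℝ φ x :=
  (h.contDiffAt hx).differentiableAt (by simp)

theorem differentiableAt_symm (h : IsDiffeo φ) (hx : x ∈ φ.source) :
    DifferentiableAt ℝ φ.symm (φ x) :=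
  h.symm.differentiableAt (φ.map_source hx)

theorem fderiv_symm_fderiv (h : IsDiffeo φ) (hx : x ∈ φ.source) (v : J1) :
    fderiv ℝ φ.symm (φ x) (fderiv ℝ φ x v) = v := by
  have h1 := (h.differentiableAt_symm hx).hasFDerivAt.comp x (h.differentiableAt hx).hasFDerivAt
  have h2 : HasFDerivAt (φ.symm ∘ φ) (ContinuousLinearMap.id ℝ J1) x := by
    refine (hasFDerivAt_id x).congr_of_eventuallyEq ?_
    filter_upwards [φ.open_source.mem_nhds hx] with y hy using φ.left_inv hy
  exact congrArg (fun L : J1 →L[ℝ] J1 => L v) (h1.unique h2)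

theorem fderiv_fderiv_symm (h : IsDiffeo φ) (hx : x ∈ φ.source) (v : J1) :
    fderiv ℝ φ x (fderiv ℝ φ.symm (φ x) v) = v := by
  have := h.symm.fderiv_symm_fderiv (φ.map_source hx) v
  rwa [φ.left_inv hx] at this

theorem injective (h : IsDiffeo φ) (hx : x ∈ φ.source) : Function.Injective (fderiv ℝ φ x) :=
  Function.LeftInverse.injective (h.fderiv_symm_fderiv hx)

/-- The differential as a linear isomorphism. -/
theorem exists_equiv (h : IsDiffeo φ) (hx : x ∈ φ.source) :
    ∃ M : J1 ≃L[ℝ] J1, (M : J1 →L[ℝ] J1) = fderiv ℝ φ x ∧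
      ∀ v, M.symm v = fderiv ℝ φ.symm (φ x) v := by
  refine ⟨ContinuousLinearEquiv.equivOfInverse (fderiv ℝ φ x) (fderiv ℝ φ.symm (φ x))
    (h.fderiv_symm_fderiv hx) (h.fderiv_fderiv_symm hx), ?_, fun v => rfl⟩
  ext v; rfl

theorem pullback_eq (h : IsDiffeo φ) (hx : x ∈ φ.source) (V : J1 → J1) :
    VectorField.pullback ℝ φ V x = fderiv ℝ φ.symm (φ x) (V (φ x)) := by
  obtain ⟨M, hM, hM'⟩ := h.exists_equiv hx
  rw [VectorField.pullback_eq_of_fderiv_eq hM, hM']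

theorem fderiv_pullback (h : IsDiffeo φ) (hx : x ∈ φ.source) (V : J1 → J1) :
    fderiv ℝ φ x (VectorField.pullback ℝ φ V x) = V (φ x) := by
  rw [h.pullback_eq hx, h.fderiv_fderiv_symm hx]

theorem comp_smoothAt (h : IsDiffeo φ) (hx : x ∈ φ.source) {F : Type*} [NormedAddCommGroup F]
    [NormedSpace ℝ F] {f : J1 → F} (hf : SmoothAt f (φ x)) : SmoothAt (fun y => f (φ y)) x := by
  filter_upwards [φ.open_source.mem_nhds hx, (φ.continuousAt hx).eventually hf] with y hy hfy
  exact ContDiffAt.comp y hfy (h.contDiffAt hy)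

theorem pullback_smoothAt (h : IsDiffeo φ) (hx : x ∈ φ.source) {V : J1 → J1}
    (hV : SmoothAt V (φ x)) : SmoothAt (VectorField.pullback ℝ φ V) x := by
  have h1 : SmoothAt (fun y => fderiv ℝ φ.symm (φ y) (V (φ y))) x :=
    h.comp_smoothAt hx ((h.symm.smoothAt (φ.map_source hx)).fderiv_apply hV)
  refine h1.congr ?_
  filter_upwards [φ.open_source.mem_nhds hx] with y hy using h.pullback_eq hy V

theorem fderiv_lieBracket_pullback (h : IsDiffeo φ) (hx : x ∈ φ.source) {V W : J1 → J1}
    (hV : DifferentiableAt ℝ V (φ x)) (hW : DifferentiableAt ℝ W (φ x)) :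
    fderiv ℝ φ x (VectorField.lieBracket ℝ (VectorField.pullback ℝ φ V)
      (VectorField.pullback ℝ φ W) x) = VectorField.lieBracket ℝ V W (φ x) := by
  rw [← VectorField.pullback_lieBracket (n := 2) (by simp) ((h.contDiffAt hx).of_le (by exact WithTop.coe_le_coe.2 (le_top : (2 : ℕ∞) ≤ ⊤))) hV hW,
    h.fderiv_pullback hx]

end IsDiffeo

/-! ### Diffeomorphisms preserving the characteristic distributions -/

/-- `φ` takes the characteristic distributions of `E` to those of `E'` at `x`. -/
def MapsChar (φ : OpenPartialHomeomorph J1 J1) (E E' : HypEq) (x : J1) : Prop :=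
  x ∈ E.dom ∧ φ x ∈ E'.dom ∧ (E.D1 x).map (fderiv ℝ φ x).toLinearMap = E'.D1 (φ x) ∧
    (E.D2 x).map (fderiv ℝ φ x).toLinearMap = E'.D2 (φ x)

section MapsChar

variable {φ : OpenPartialHomeomorph J1 J1} {E E' : HypEq} {a x : J1}

theorem MapsChar.map_cartan (h : MapsChar φ E E' x) :
    (cartan x).map (fderiv ℝ φ x).toLinearMap = cartan (φ x) := by
  rw [← E.D1_sup_D2 h.1, ← E'.D1_sup_D2 h.2.1, Submodule.map_sup, h.2.2.1, h.2.2.2]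

/-- By `HypEq.holds_iff`, membership of a 2-jet depends only on whether its plane meets D¹, and an
injective differential preserves this. -/
theorem MapsChar.holds_iff (h : MapsChar φ E E' x) (hφ : IsDiffeo φ) (hx : x ∈ φ.source)
    {r s t r' s' t' : ℝ} (hl : LiftsTo φ x r s t r' s' t') :
    E.Holds x r s t ↔ E'.Holds (φ x) r' s' t' := by
  rw [E.holds_iff h.1, E'.holds_iff h.2.1]
  have hinj := hφ.injective hx
  constructor
  · rintro ⟨v, hv, hD, h0⟩
    refine ⟨fderiv ℝ φ x v, ?_, ?_, fun hz => h0 (hinj (by rw [hz, map_zero]))⟩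
    · rw [← hl]; exact Submodule.mem_map_of_mem (f := (fderiv ℝ φ x).toLinearMap) hv
    · rw [← h.2.2.1]; exact Submodule.mem_map_of_mem (f := (fderiv ℝ φ x).toLinearMap) hD
  · rintro ⟨v', hv', hD', h0⟩
    rw [← hl] at hv'
    rw [← h.2.2.1] at hD'
    obtain ⟨v, hv, rfl⟩ := hv'
    obtain ⟨u, hu, hvu⟩ := hD'
    have : u = v := hinj hvu
    subst this
    exact ⟨u, hv, hu, by rintro rfl; exact h0 (map_zero _)⟩

theorem contactEquiv_of_mapsChar (hφ : IsDiffeo φ) (ha : a ∈ φ.source)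
    (h : ∀ x ∈ φ.source, MapsChar φ E E' x) : ContactEquiv E a E' (φ a) := by
  refine ⟨φ, ha, rfl, fun x hx => (h x hx).1, fun y hy => ?_,
    ⟨hφ.contDiffOn, hφ.contDiffOn_symm, fun x hx => (h x hx).map_cartan⟩,
    fun x hx r s t r' s' t' hl => (h x hx).holds_iff hφ hx hl⟩
  have := (h _ (φ.map_target hy)).2.1
  rwa [φ.right_inv hy] at this

theorem mem_of_map_eq {T : J1 →ₗ[ℝ] J1} (hT : Function.Injective T) {P Q : Submodule ℝ J1}
    (h : P.map T = Q) {v : J1} : v ∈ P ↔ T v ∈ Q := by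
  rw [← h]
  exact ⟨Submodule.mem_map_of_mem, fun ⟨u, hu, e⟩ => hT e ▸ hu⟩

theorem eq_span_pair_of_map {T : J1 →ₗ[ℝ] J1} (hT : Function.Injective T) {P : Submodule ℝ J1}
    {v w : J1} (h : P.map T = Submodule.span ℝ {T v, T w}) : P = Submodule.span ℝ {v, w} := by
  apply Submodule.map_injective_of_injective hT
  rw [h, Submodule.map_span, Set.image_pair]

/-- Adapted frames can be pulled back. -/
theorem adapted_pullback (hφ : IsDiffeo φ) (ha : a ∈ φ.source)
    (h : ∀ᶠ x in 𝓝 a, MapsChar φ E E' x) {X : Fin 5 → J1 → J1} (hX : Adapted E' X (φ a)) :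
    Adapted E (fun i => VectorField.pullback ℝ φ (X i)) a := by
  refine ⟨h.self_of_nhds.1, fun i => hφ.pullback_smoothAt ha (hX.smooth i), ?_⟩
  filter_upwards [h, φ.open_source.mem_nhds ha, (φ.continuousAt ha).eventually hX.eventually]
    with y hy hys hXy
  have hinj : Function.Injective (fderiv ℝ φ y).toLinearMap := hφ.injective hys
  have hd := fun i => (hXy.smooth i).differentiableAt
  obtain ⟨-, -, h3, h4⟩ := hXy.eventually'.self_of_nhds
  refine ⟨?_, ?_, ?_, ?_⟩
  · apply eq_span_pair_of_map hinj
    rw [hy.2.2.1, hXy.D1_eq]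
    simp only [ContinuousLinearMap.coe_coe, hφ.fderiv_pullback hys]
  · apply eq_span_pair_of_map hinj
    rw [hy.2.2.2, hXy.D2_eq]
    simp only [ContinuousLinearMap.coe_coe, hφ.fderiv_pullback hys]
  · rw [mem_of_map_eq hinj hy.2.2.1]
    simpa only [ContinuousLinearMap.coe_coe, map_sub, hφ.fderiv_pullback hys,
      hφ.fderiv_lieBracket_pullback hys (hd 0) (hd 1)] using h3
  · rw [mem_of_map_eq hinj hy.2.2.2]
    simpa only [ContinuousLinearMap.coe_coe, map_add, hφ.fderiv_pullback hys,
      hφ.fderiv_lieBracket_pullback hys (hd 2) (hd 3)] using h4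

theorem brk_pullback (hφ : IsDiffeo φ) (hx : x ∈ φ.source) {X : Fin 5 → J1 → J1}
    (hd : ∀ i, DifferentiableAt ℝ (X i) (φ x)) (h : frameDet X (φ x) ≠ 0)
    (h' : frameDet (fun i => VectorField.pullback ℝ φ (X i)) x ≠ 0) (i j k : Fin 5) :
    brk (fun i => VectorField.pullback ℝ φ (X i)) i j k x = brk X i j k (φ x) := by
  rw [brk_eq_coords, brk_eq_coords]
  have e := sum_coords h' (VectorField.lieBracket ℝ (VectorField.pullback ℝ φ (X j))
    (VectorField.pullback ℝ φ (X k)) x)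
  have e2 := congrArg (fderiv ℝ φ x) e
  rw [map_sum, hφ.fderiv_lieBracket_pullback hx (hd j) (hd k)] at e2
  simp only [map_smul, hφ.fderiv_pullback hx] at e2
  rw [← e2, coords_sum h]

theorem frameInv_pullback (hφ : IsDiffeo φ) (ha : a ∈ φ.source)
    (h : ∀ᶠ x in 𝓝 a, MapsChar φ E E' x) {X : Fin 5 → J1 → J1} (hX : Adapted E' X (φ a)) :
    frameInv (fun i => VectorField.pullback ℝ φ (X i)) a = frameInv X (φ a) := by
  set Y : Fin 5 → J1 → J1 := fun i => VectorField.pullback ℝ φ (X i) with hYdef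
  have hb : ∀ᶠ x in 𝓝 a, ∀ i j k, brk Y i j k x = brk X i j k (φ x) := by
    filter_upwards [φ.open_source.mem_nhds ha, (φ.continuousAt ha).eventually hX.eventually,
      (adapted_pullback hφ ha h hX).eventually] with y hy hXy hYy i j k
    exact brk_pullback hφ hy (fun i => (hXy.smooth i).differentiableAt) hXy.frameDet_ne
      hYy.frameDet_ne i j k
  have hb0 := hb.self_of_nhds
  have l1 : Lam1 Y =ᶠ[𝓝 a] Lam1 X ∘ φ := hb.mono fun y hy => by
    simp only [Lam1, Function.comp_apply, hy]
  have l2 : Lam2 Y =ᶠ[𝓝 a] Lam2 X ∘ φ := hb.mono fun y hy => by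
    simp only [Lam2, Function.comp_apply, hy]
  have l12 : Lam12 Y =ᶠ[𝓝 a] Lam12 X ∘ φ := hb.mono fun y hy => by
    simp only [Lam12, Function.comp_apply, hy]
  have ht : brkTrace Y a = brkTrace X (φ a) := by simp only [brkTrace, hb0]
  have hs : ∀ L L' : J1 → ℝ, L' =ᶠ[𝓝 a] L ∘ φ → DifferentiableAt ℝ L (φ a) →
      sqInv Y L' a = sqInv X L (φ a) := by
    intro L L' hL hd
    have e : fderiv ℝ L' a (Y 4 a) = fderiv ℝ L (φ a) (X 4 (φ a)) := by
      rw [hL.fderiv_eq, fderiv_comp a hd (hφ.differentiableAt ha), ContinuousLinearMap.comp_apply,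
        hYdef, hφ.fderiv_pullback ha]
    rw [sqInv, sqInv, e, hL.self_of_nhds, ht, l1.self_of_nhds]
    rfl
  simp only [frameInv]
  rw [hs _ _ l1 hX.smooth_Lam1.differentiableAt, hs _ _ l2 hX.smooth_Lam2.differentiableAt,
    hs _ _ l12 hX.smooth_Lam12.differentiableAt, l1.self_of_nhds, l2.self_of_nhds,
    l12.self_of_nhds]
  rfl

theorem basicInv_comp (hφ : IsDiffeo φ) (ha : a ∈ φ.source)
    (h : ∀ᶠ x in 𝓝 a, MapsChar φ E E' x) : E.basicInv a = E'.basicInv (φ a) := by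
  obtain ⟨X, hX, -⟩ := exists_adapted h.self_of_nhds.2.1
  rw [hX.basicInv_eq, (adapted_pullback hφ ha h hX).basicInv_eq, frameInv_pullback hφ ha h hX]

theorem dInv_comp (hφ : IsDiffeo φ) (ha : a ∈ φ.source)
    (h : ∀ᶠ x in 𝓝 a, MapsChar φ E E' x) (hd : DifferentiableAt ℝ E.basicInv a) (j : Fin 5)
    (v : J1) : E.dInv j a v = E'.dInv j (φ a) (fderiv ℝ φ a v) := by
  -- Differentiability is known for the invariants of `E` only, so the chain rule is applied to the
  -- inverse map.
  have hev : ∀ᶠ y in 𝓝 (φ a), E'.basicInv y j = E.basicInv (φ.symm y) j := by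
    rw [← φ.map_nhds_eq ha]
    change ∀ᶠ y in 𝓝 a, _
    filter_upwards [h.eventually_nhds, φ.open_source.mem_nhds ha] with y hy hys
    rw [φ.left_inv hys, basicInv_comp hφ hys hy]
  have e : (fun y => E'.basicInv y j) =ᶠ[𝓝 (φ a)] (fun x => E.basicInv x j) ∘ φ.symm := hev
  have hd' : DifferentiableAt ℝ (fun x => E.basicInv x j) (φ.symm (φ a)) := by
    rw [φ.left_inv ha]; exact differentiableAt_pi.1 hd j
  simp only [HypEq.dInv, ContinuousLinearMap.coe_coe]
  rw [e.fderiv_eq, fderiv_comp _ hd' (hφ.differentiableAt_symm ha),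
    ContinuousLinearMap.comp_apply, hφ.fderiv_symm_fderiv ha, φ.left_inv ha]

theorem coframe_comp (hφ : IsDiffeo φ) (ha : a ∈ φ.source)
    (h : ∀ᶠ x in 𝓝 a, MapsChar φ E E' x) (hd : DifferentiableAt ℝ E.basicInv a) (k : Fin 2)
    (i : Fin 5) (v : J1) : E.coframe k a i v = E'.coframe k (φ a) i (fderiv ℝ φ a v) := by
  obtain ⟨X, hX, -⟩ := exists_adapted h.self_of_nhds.2.1
  have hY := adapted_pullback hφ ha h hX
  have : E.coframe k a i = E'.coframe k (φ a) i ∘ₗ (fderiv ℝ φ a).toLinearMap := by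
    refine linearMap_ext_frame hY.frameDet_ne fun m => ?_
    rw [LinearMap.comp_apply, ContinuousLinearMap.coe_coe, hφ.fderiv_pullback ha,
      hY.coframe_frame, hX.coframe_frame]
    simp only [dInv_comp hφ ha h hd, hφ.fderiv_pullback ha]
  rw [this]
  rfl

/-- Diffeomorphisms preserving the characteristic distributions preserve the coefficient
functions. -/
theorem sameCoeffFunctions_of_mapsChar (hφ : IsDiffeo φ) (ha : a ∈ φ.source)
    (h : ∀ᶠ x in 𝓝 a, MapsChar φ E E' x) (hs : SmoothAt E.basicInv a) {k : Fin 2}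
    {w : Fin 5 → Fin 5 → (Fin 5 → ℝ) → ℝ} (hw : E.HasCoeffFunctions k a w) :
    SameCoeffFunctions k E a E' (φ a) := by
  refine ⟨basicInv_comp hφ ha h, w, w, hw, ?_, Eventually.of_forall fun _ _ _ => rfl⟩
  rw [HypEq.HasCoeffFunctions, ← φ.map_nhds_eq ha]
  change ∀ᶠ x in 𝓝 a, _
  filter_upwards [hw, h.eventually_nhds, φ.open_source.mem_nhds ha, hs] with x h1 h2 h3 h4 i
  have hd := h4.differentiableAt (by simp)
  refine LinearMap.ext fun v' => ?_
  obtain ⟨v, rfl⟩ : ∃ v, fderiv ℝ φ x v = v' := ⟨_, hφ.fderiv_fderiv_symm h3 v'⟩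
  rw [← coframe_comp hφ h3 h2 hd, h1 i]
  simp only [LinearMap.sum_apply, LinearMap.smul_apply, dInv_comp hφ h3 h2 hd,
    basicInv_comp hφ h3 h2]

end MapsChar

/-! ### Interchanging the characteristic distributions -/

namespace HypEq

variable (E : HypEq) (a : J1)

theorem neg_charPlane (ε : ℝ) : E.neg.charPlane ε a = E.charPlane (-ε) a := by
  ext v
  rw [mem_charPlane, mem_charPlane]
  have hd : E.neg.disc a = E.disc a := by
    rw [disc_eq, disc_eq]; simp [neg, discForm]
  have hc : jop (E.neg.coeff a) a v = -jop (E.coeff a) a v := jop_neg _ _ _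
  rw [hd, hc, neg_eq_iff_eq_neg]
  have : -((ε * √(E.disc a)) • v) = (-ε * √(E.disc a)) • v := by module
  rw [this]

theorem neg_D1 : E.neg.D1 a = E.D2 a := E.neg_charPlane a 1

theorem neg_D2 : E.neg.D2 a = E.D1 a := by
  rw [D2, neg_charPlane, neg_neg]; rfl

end HypEq

namespace Adapted

variable {E : HypEq} {X : Fin 5 → J1 → J1} {a : J1}

/-- The adapted frame of the equation with interchanged characteristic distributions. -/
def swapFrame (X : Fin 5 → J1 → J1) : Fin 5 → J1 → J1 :=
  ![X 2, X 3, X 0, X 1, fun y => (-1 : ℝ) • X 4 y]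

theorem swap (h : Adapted E X a) : Adapted E.neg (swapFrame X) a := by
  refine ⟨h.mem_dom, fun i => ?_, ?_⟩
  · fin_cases i
    exacts [h.smooth 2, h.smooth 3, h.smooth 0, h.smooth 1,
      (SmoothAt.const (-1)).smul (h.smooth 4)]
  · filter_upwards [h.eventually'] with y ⟨h1, h2, h3, h4⟩
    rw [E.neg_D1, E.neg_D2]
    refine ⟨h2, h1, ?_, ?_⟩
    · simpa [swapFrame] using h4
    · simpa [swapFrame, ← sub_eq_add_neg] using h3

/-- The sign comes from replacing X₅ by -X₅, which the normalisation requires. It disappears from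
the quadratic expressions `Lam1`, `Lam2` and `Lam12`. -/
theorem brk_swap (h : Adapted E X a) (i j : Fin 5) (hi : i ≠ 4) (hj : j ≠ 4) :
    brk (swapFrame X) i j 4 a = -brk X (![2, 3, 0, 1, 4] i) (![2, 3, 0, 1, 4] j) 4 a := by
  have hc : ∀ v, coords (swapFrame X) a v =
      ![coords X a v 2, coords X a v 3, coords X a v 0, coords X a v 1, -coords X a v 4] := by
    intro v
    rw [← coords_sum h.swap.frameDet_ne ![coords X a v 2, coords X a v 3, coords X a v 0,
      coords X a v 1, -coords X a v 4]]
    congr 1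
    nth_rewrite 1 [← sum_coords h.frameDet_ne v]
    simp only [Fin.sum_univ_five, swapFrame, Matrix.cons_val]
    module
  have hb : VectorField.lieBracket ℝ (swapFrame X j) (swapFrame X 4) a =
      -VectorField.lieBracket ℝ (X (![2, 3, 0, 1, 4] j)) (X 4) a := by
    have h4 : swapFrame X 4 = (-1 : ℝ) • X 4 := rfl
    rw [h4, VectorField.lieBracket_const_smul_right (h.smooth 4).differentiableAt, neg_one_smul]
    congr 2
    fin_cases j <;> first | rfl | exact absurd rfl hj
  rw [brk_eq_coords, hb, coords_neg, Pi.neg_apply, hc, brk_eq_coords]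
  fin_cases i <;> first | rfl | exact absurd rfl hi

theorem Lam_swap (h : Adapted E X a) : Lam1 (swapFrame X) a = Lam2 X a ∧
    Lam2 (swapFrame X) a = Lam1 X a ∧ Lam12 (swapFrame X) a = Lam12 X a := by
  refine ⟨?_, ?_, ?_⟩
  · simp only [Lam1, Lam2, h.brk_swap _ _ (by decide : (0 : Fin 5) ≠ 4) (by decide : (2 : Fin 5) ≠ 4),
      h.brk_swap _ _ (by decide : (1 : Fin 5) ≠ 4) (by decide : (2 : Fin 5) ≠ 4),
      h.brk_swap _ _ (by decide : (0 : Fin 5) ≠ 4) (by decide : (3 : Fin 5) ≠ 4),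
      h.brk_swap _ _ (by decide : (1 : Fin 5) ≠ 4) (by decide : (3 : Fin 5) ≠ 4), Matrix.cons_val]
    ring
  · simp only [Lam1, Lam2, h.brk_swap _ _ (by decide : (2 : Fin 5) ≠ 4) (by decide : (0 : Fin 5) ≠ 4),
      h.brk_swap _ _ (by decide : (3 : Fin 5) ≠ 4) (by decide : (0 : Fin 5) ≠ 4),
      h.brk_swap _ _ (by decide : (2 : Fin 5) ≠ 4) (by decide : (1 : Fin 5) ≠ 4),
      h.brk_swap _ _ (by decide : (3 : Fin 5) ≠ 4) (by decide : (1 : Fin 5) ≠ 4), Matrix.cons_val]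
    ring
  · simp only [Lam12, h.brk_swap _ _ (by decide : (0 : Fin 5) ≠ 4) (by decide : (2 : Fin 5) ≠ 4),
      h.brk_swap _ _ (by decide : (1 : Fin 5) ≠ 4) (by decide : (2 : Fin 5) ≠ 4),
      h.brk_swap _ _ (by decide : (0 : Fin 5) ≠ 4) (by decide : (3 : Fin 5) ≠ 4),
      h.brk_swap _ _ (by decide : (1 : Fin 5) ≠ 4) (by decide : (3 : Fin 5) ≠ 4),
      h.brk_swap _ _ (by decide : (2 : Fin 5) ≠ 4) (by decide : (0 : Fin 5) ≠ 4),
      h.brk_swap _ _ (by decide : (3 : Fin 5) ≠ 4) (by decide : (0 : Fin 5) ≠ 4),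
      h.brk_swap _ _ (by decide : (2 : Fin 5) ≠ 4) (by decide : (1 : Fin 5) ≠ 4),
      h.brk_swap _ _ (by decide : (3 : Fin 5) ≠ 4) (by decide : (1 : Fin 5) ≠ 4), Matrix.cons_val]
    ring

/-- Only the first two invariants enter the coframe. The other three are normalised by |Λ₁|, which
becomes |Λ₂| after the interchange, so they are not merely permuted. -/
theorem basicInv_swap (h : Adapted E X a) :
    E.neg.basicInv a 0 = E.basicInv a 1 ∧ E.neg.basicInv a 1 = E.basicInv a 0 := by
  obtain ⟨h1, h2, h3⟩ := h.Lam_swap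
  rw [h.swap.basicInv_eq, h.basicInv_eq]
  simp only [frameInv, Matrix.cons_val, h1, h2, h3]
  exact ⟨trivial, trivial⟩

theorem dInv_swap (h : Adapted E X a) :
    E.neg.dInv 0 a = E.dInv 1 a ∧ E.neg.dInv 1 a = E.dInv 0 a := by
  have e0 : (fun x => E.neg.basicInv x 0) =ᶠ[𝓝 a] fun x => E.basicInv x 1 :=
    h.eventually.mono fun y hy => hy.basicInv_swap.1
  have e1 : (fun x => E.neg.basicInv x 1) =ᶠ[𝓝 a] fun x => E.basicInv x 0 :=
    h.eventually.mono fun y hy => hy.basicInv_swap.2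
  simp only [HypEq.dInv, e0.fderiv_eq, e1.fderiv_eq]
  exact ⟨trivial, trivial⟩

end Adapted

/-! ### Equations with the same coefficient functions -/

/-- The part of genericity which is needed to reconstruct the equation from its coefficient
functions. -/
structure RegularAt (E : HypEq) (k : Fin 2) (a : J1) : Prop where
  mem_dom : a ∈ E.dom
  smooth : SmoothAt E.basicInv a
  coframe_indep : LinearIndependent ℝ (E.coframe k a)
  inv_indep : LinearIndependent ℝ fun j => E.dInv j a

theorem HypEq.GenericAt.regularAt {E : HypEq} {a : J1} (h : E.GenericAt a) (k : Fin 2) :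
    RegularAt E k a := ⟨h.mem_dom, h.smooth_basicInv, h.coframe_indep k, h.inv_indep⟩

/-- Independence of all five differentials does not pass to `E.neg` by mere relabelling. It follows
from `hw`: the five members of the coframe of `E.neg` are independent and lie in the span of the
five differentials. -/
theorem regularAt_neg {E : HypEq} {a : J1} (h : E.GenericAt a) {k : Fin 2}
    {w : Fin 5 → Fin 5 → (Fin 5 → ℝ) → ℝ} (hw : E.neg.HasCoeffFunctions k a w) :
    RegularAt E.neg k a := by
  obtain ⟨X, hX, -⟩ := exists_adapted h.mem_dom
  have hL := hX.Lam_swap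
  obtain ⟨h1, h2, h3, h4, h5, h6, -⟩ := hX.genericAt_iff.1 h
  obtain ⟨d0, d1⟩ := hX.dInv_swap
  have hco : LinearIndependent ℝ (E.neg.coframe k a) := by
    rw [hX.swap.coframe_indep_iff]
    have e4 : Adapted.swapFrame X 4 a = (-1 : ℝ) • X 4 a := rfl
    have c0 : (Fin.castLE (by decide) (0 : Fin 2) : Fin 5) = 0 := rfl
    have c1 : (Fin.castLE (by decide) (1 : Fin 2) : Fin 5) = 1 := rfl
    have hk : E.neg.dInv (Fin.castLE (by decide) k) a (X 4 a) ≠ 0 := by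
      revert k
      rw [Fin.forall_fin_two, c0, c1, d0, d1]
      exact ⟨fun _ => h6, fun _ => h5⟩
    rw [e4, map_smul, d0, d1]
    exact ⟨fun e => h4 (by simp only [Adapted.swapFrame, Matrix.cons_val] at e; linarith),
      fun e => h3 (by simp only [Adapted.swapFrame, Matrix.cons_val] at e; linarith),
      smul_ne_zero (by norm_num) hk⟩
  refine ⟨h.mem_dom, hX.swap.smooth_basicInv (by rw [hL.1]; exact h2) (by rw [hL.2.1]; exact h1), hco, ?_⟩
  apply linearIndependent_of_top_le_span_of_card_eq_finrank
  · have hspan : Submodule.span ℝ (Set.range (E.neg.coframe k a)) = ⊤ :=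
      hco.span_eq_top_of_card_eq_finrank' (by simp [Subspace.dual_finrank_eq])
    rw [← hspan, Submodule.span_le]
    rintro _ ⟨i, rfl⟩
    rw [hw.self_of_nhds i]
    exact Submodule.sum_mem _ fun j _ => Submodule.smul_mem _ _ (Submodule.subset_span ⟨j, rfl⟩)
  · simp [Subspace.dual_finrank_eq]

namespace RegularAt

variable {E E' : HypEq} {k : Fin 2} {a a' : J1}

theorem eventually (h : RegularAt E k a) : ∀ᶠ x in 𝓝 a,
    x ∈ E.dom ∧ DifferentiableAt ℝ E.basicInv x ∧ LinearIndependent ℝ (E.coframe k x) := by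
  obtain ⟨X, hX, -⟩ := exists_adapted h.mem_dom
  obtain ⟨h1, h2, h3⟩ := (hX.coframe_indep_iff k).1 h.coframe_indep
  have s := hX.smooth_dInv h.smooth
  filter_upwards [hX.eventually, h.smooth,
    (((s 0 0).mul (s 1 1)).sub ((s 0 1).mul (s 1 0))).continuousAt.eventually_ne h1,
    (((s 0 2).mul (s 1 3)).sub ((s 0 3).mul (s 1 2))).continuousAt.eventually_ne h2,
    (s (Fin.castLE (by decide) k) 4).continuousAt.eventually_ne h3] with y hy hs a1 a2 a3
  exact ⟨hy.mem_dom, hs.differentiableAt (by simp), (hy.coframe_indep_iff k).2 ⟨a1, a2, a3⟩⟩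

end RegularAt

theorem eq_zero_of_det_two {p q r s c d : ℝ} (h : p * s - q * r ≠ 0) (h1 : c * p + d * q = 0)
    (h2 : c * r + d * s = 0) : c = 0 ∧ d = 0 := by
  constructor
  · refine (mul_eq_zero.1 (?_ : (p * s - q * r) * c = 0)).resolve_left h
    linear_combination s * h1 - q * h2
  · refine (mul_eq_zero.1 (?_ : (p * s - q * r) * d = 0)).resolve_left h
    linear_combination p * h2 - r * h1

theorem coframe_apply {E : HypEq} {X : Fin 5 → J1 → J1} {a : J1} (hX : Adapted E X a) (k : Fin 2)
    (i : Fin 5) (v : J1) :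
    E.coframe k a i v = ∑ m, coords X a v m *
      (!![E.dInv 0 a (X 0 a), E.dInv 0 a (X 1 a), 0, 0, 0;
        E.dInv 1 a (X 0 a), E.dInv 1 a (X 1 a), 0, 0, 0;
        0, 0, E.dInv 0 a (X 2 a), E.dInv 0 a (X 3 a), 0;
        0, 0, E.dInv 1 a (X 2 a), E.dInv 1 a (X 3 a), 0;
        0, 0, 0, 0, E.dInv (Fin.castLE (by decide) k) a (X 4 a)] : Matrix _ _ ℝ) i m := by
  nth_rewrite 1 [← sum_coords hX.frameDet_ne v]
  simp only [map_sum, map_smul, smul_eq_mul, hX.coframe_frame]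

/-- D¹ is the common kernel of Ω₃, Ω₄, Ω₅, the members factoring through the projections onto D² and
D³. So a map preserving the coframe preserves D¹, and similarly D². -/
theorem mem_D1_iff_coframe {E : HypEq} {k : Fin 2} {a : J1} (ha : a ∈ E.dom)
    (h : LinearIndependent ℝ (E.coframe k a)) (v : J1) :
    v ∈ E.D1 a ↔ E.coframe k a 2 v = 0 ∧ E.coframe k a 3 v = 0 ∧ E.coframe k a 4 v = 0 := by
  obtain ⟨X, hX, -⟩ := exists_adapted ha
  obtain ⟨h1, h2, h3⟩ := (hX.coframe_indep_iff k).1 h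
  rw [hX.mem_D1_iff]
  simp only [coframe_apply hX, Fin.sum_univ_five, Matrix.of_apply, Matrix.cons_val,
    mul_zero, zero_add, add_zero, mul_eq_zero]
  constructor
  · rintro ⟨e2, e3, e4⟩
    simp [e2, e3, e4]
  · rintro ⟨e2, e3, e4⟩
    exact ⟨(eq_zero_of_det_two h2 e2 e3).1, (eq_zero_of_det_two h2 e2 e3).2,
      e4.resolve_right h3⟩

theorem mem_D2_iff_coframe {E : HypEq} {k : Fin 2} {a : J1} (ha : a ∈ E.dom)
    (h : LinearIndependent ℝ (E.coframe k a)) (v : J1) :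
    v ∈ E.D2 a ↔ E.coframe k a 0 v = 0 ∧ E.coframe k a 1 v = 0 ∧ E.coframe k a 4 v = 0 := by
  obtain ⟨X, hX, -⟩ := exists_adapted ha
  obtain ⟨h1, h2, h3⟩ := (hX.coframe_indep_iff k).1 h
  rw [hX.mem_D2_iff]
  simp only [coframe_apply hX, Fin.sum_univ_five, Matrix.of_apply, Matrix.cons_val,
    mul_zero, zero_add, add_zero, mul_eq_zero]
  constructor
  · rintro ⟨e2, e3, e4⟩
    simp [e2, e3, e4]
  · rintro ⟨e2, e3, e4⟩
    exact ⟨(eq_zero_of_det_two h1 e2 e3).1, (eq_zero_of_det_two h1 e2 e3).2,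
      e4.resolve_right h3⟩

theorem map_eq_of_forall_mem {T : J1 →ₗ[ℝ] J1} (hT : Function.Surjective T)
    {P Q : Submodule ℝ J1} (h : ∀ v, v ∈ P ↔ T v ∈ Q) : P.map T = Q := by
  ext w
  constructor
  · rintro ⟨v, hv, rfl⟩; exact (h v).1 hv
  · intro hw
    obtain ⟨v, rfl⟩ := hT w
    exact ⟨v, (h v).2 hw, rfl⟩

/-- Equations with the same coefficient functions are contact equivalent. -/
theorem contactEquiv_of_sameCoeffFunctions {E E' : HypEq} {k : Fin 2} {a a' : J1}
    (h : RegularAt E k a) (h' : RegularAt E' k a') (hS : SameCoeffFunctions k E a E' a') :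
    ContactEquiv E a E' a' := by
  obtain ⟨hI, w, w', hw, hw', hww⟩ := hS
  obtain ⟨Φ, haΦ, -, hΦ, c1, c2, -⟩ := exists_local_diffeo h.smooth
    (HypEq.injective_fderiv_basicInv h.smooth.differentiableAt h.inv_indep) univ_mem
  obtain ⟨Ψ, haΨ, hΨU, hΨ, c1', c2', -⟩ := exists_local_diffeo h'.smooth
    (HypEq.injective_fderiv_basicInv h'.smooth.differentiableAt h'.inv_indep)
    (inter_mem h'.eventually hw')
  have hww' : ∀ᶠ x in 𝓝 a, ∀ i j, w i j (E.basicInv x) = w' i j (E.basicInv x) :=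
    h.smooth.continuousAt.eventually hww
  obtain ⟨G, hG, hGo, haG⟩ := mem_nhds_iff.1 (inter_mem (inter_mem h.eventually hw) hww')
  have htr : IsDiffeo (Φ.trans Ψ.symm) := by
    constructor
    · refine c2'.comp (c1.mono ?_) ?_
      · intro x hx; exact hx.1
      · intro x hx; exact hx.2
    · refine c2.comp (c1'.mono ?_) ?_
      · intro x hx; exact hx.1
      · intro x hx; exact hx.2
  -- Points with equal values of the invariants are identified; the restriction to `G` makes the
  -- expansions of the coframe and the agreement of coefficients available at every point.
  set φ := (Φ.trans Ψ.symm).restrOpen G hGo with hφ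
  have hφd : IsDiffeo φ :=
    ⟨htr.contDiffOn.mono fun x hx => hx.1, htr.contDiffOn_symm.mono fun x hx => hx.1⟩
  have hcoe : ∀ x, φ x = Ψ.symm (E.basicInv x) := fun x => by rw [← hΦ]; rfl
  have hIa : Ψ.symm (E.basicInv a) = a' := by rw [hI, ← hΨ]; exact Ψ.left_inv haΨ
  have haT : E.basicInv a ∈ Ψ.target := by rw [hI, ← hΨ]; exact Ψ.map_source haΨ
  have haφ : a ∈ φ.source := ⟨⟨haΦ, by change Φ a ∈ Ψ.target; rwa [hΦ]⟩, haG⟩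
  have hsrc : ∀ x ∈ φ.source, E.basicInv x ∈ Ψ.target := fun x hx => by
    have : Φ x ∈ Ψ.target := hx.1.2
    rwa [hΦ] at this
  have hinv : ∀ x ∈ φ.source, E'.basicInv (φ x) = E.basicInv x := fun x hx => by
    rw [hcoe, ← hΨ]; exact Ψ.right_inv (hsrc x hx)
  have hmaps : ∀ x ∈ φ.source, MapsChar φ E E' x := by
    intro x hx
    obtain ⟨⟨⟨hxd, hxs, hxc⟩, hxw⟩, hxww⟩ := hG hx.2
    have hx' : φ x ∈ Ψ.source := by rw [hcoe]; exact Ψ.map_target (hsrc x hx)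
    obtain ⟨⟨hyd, hys, hyc⟩, hyw⟩ := hΨU hx'
    have hdI : ∀ j v, E'.dInv j (φ x) (fderiv ℝ φ x v) = E.dInv j x v := by
      intro j v
      have e : (fun y => E.basicInv y j) =ᶠ[𝓝 x] (fun y => E'.basicInv y j) ∘ φ := by
        filter_upwards [φ.open_source.mem_nhds hx] with y hy
        rw [Function.comp_apply, hinv y hy]
      simp only [HypEq.dInv, ContinuousLinearMap.coe_coe]
      rw [e.fderiv_eq, fderiv_comp x (differentiableAt_pi.1 hys j) (hφd.differentiableAt hx)]
      rfl
    -- Both coframes have the same coefficients with respect to differentials that `φ` matches.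
    have hco : ∀ i v, E'.coframe k (φ x) i (fderiv ℝ φ x v) = E.coframe k x i v := by
      intro i v
      rw [hxw i, hyw i]
      have hxww' : ∀ i j, w i j (E.basicInv x) = w' i j (E.basicInv x) := hxww
      simp only [LinearMap.sum_apply, LinearMap.smul_apply, hdI, hinv x hx, hxww']
    have hsurj : Function.Surjective (fderiv ℝ φ x).toLinearMap := fun v =>
      ⟨_, hφd.fderiv_fderiv_symm hx v⟩
    refine ⟨hxd, hyd, map_eq_of_forall_mem hsurj fun v => ?_,
      map_eq_of_forall_mem hsurj fun v => ?_⟩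
    · rw [mem_D1_iff_coframe hxd hxc, mem_D1_iff_coframe hyd hyc]
      simp only [ContinuousLinearMap.coe_coe, hco]
    · rw [mem_D2_iff_coframe hxd hxc, mem_D2_iff_coframe hyd hyc]
      simp only [ContinuousLinearMap.coe_coe, hco]
  have := contactEquiv_of_mapsChar hφd haφ hmaps
  rwa [hcoe, hIa] at this

theorem ContactEquiv.of_neg {E E' : HypEq} {a a' : J1} (h : ContactEquiv E a E'.neg a') :
    ContactEquiv E a E' a' := by
  obtain ⟨φ, h1, h2, h3, h4, h5, h6⟩ := h
  refine ⟨φ, h1, h2, h3, h4, h5, fun x hx r s t r' s' t' hl => ?_⟩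
  rw [h6 x hx r s t r' s' t' hl, E'.neg_holds]

/-! ### Contact equivalent equations -/

/-- A contact transformation is conformally symplectic on the Cartan planes. -/
theorem IsContact.conformal {φ : OpenPartialHomeomorph J1 J1} (hφ : IsContact φ) {x : J1}
    (hx : x ∈ φ.source) : ∃ l : ℝ, l ≠ 0 ∧ ∀ v ∈ cartan x, ∀ w ∈ cartan x,
      Om (fderiv ℝ φ x v) (fderiv ℝ φ x w) = l * Om v w := by
  have hd : IsDiffeo φ := ⟨hφ.1, hφ.2.1⟩
  set T := fderiv ℝ φ x with hT
  set e : J1 := ![0, 0, 1, 0, 0] with he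
  have hUe : contactForm x e = 1 := by simp [contactForm_apply, he]
  have hTc : ∀ y ∈ φ.source, ∀ v, contactForm y v = 0 →
      contactForm (φ y) (fderiv ℝ φ y v) = 0 := fun y hy v hv => by
    have : fderiv ℝ φ y v ∈ cartan (φ y) := hφ.2.2 y hy ▸
      Submodule.mem_map_of_mem (f := (fderiv ℝ φ y).toLinearMap) hv
    exact this
  -- Preservation of the Cartan planes makes the pulled back contact form a multiple of the contact
  -- form; the factor is its value on ∂z.
  have hU : ∀ u, contactForm (φ x) (T u) = contactForm (φ x) (T e) * contactForm x u := by
    intro u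
    have h1 : contactForm x (u - contactForm x u • e) = 0 := by
      rw [map_sub, map_smul, hUe, smul_eq_mul, mul_one, sub_self]
    have h2 := hTc x hx _ h1
    rw [← hT, map_sub, map_smul, map_sub, map_smul, smul_eq_mul] at h2
    linarith
  refine ⟨contactForm (φ x) (T e), fun h0 => ?_, fun v hv w hw => ?_⟩
  · have h1 := hU (fderiv ℝ φ.symm (φ x) ![0, 0, 1, 0, 0])
    rw [h0, zero_mul, hT, hd.fderiv_fderiv_symm hx] at h1
    simp [contactForm_apply] at h1
  · have hc : ∀ v : J1, SmoothAt (fun z => fderiv ℝ φ (φ.symm z)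
        (HypEq.contactLift v (φ.symm z))) (φ x) := by
      intro v
      have hx' := φ.map_source hx
      refine SmoothAt.fderiv_apply (f := φ) (a := x) (V := HypEq.contactLift v) (hd.smoothAt hx)
        (HypEq.contactLift_smoothAt v) |> fun h => ?_
      have := hd.symm.comp_smoothAt (x := φ x) hx' (f := fun y => fderiv ℝ φ y
        (HypEq.contactLift v y)) (by rw [φ.left_inv hx]; exact h)
      exact this
    have hp : ∀ v : J1, VectorField.pullback ℝ φ (fun z => fderiv ℝ φ (φ.symm z)
        (HypEq.contactLift v (φ.symm z))) =ᶠ[𝓝 x] HypEq.contactLift v := by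
      intro v
      filter_upwards [φ.open_source.mem_nhds hx] with y hy
      rw [hd.pullback_eq hy, φ.left_inv hy, hd.fderiv_symm_fderiv hy]
    have hm : ∀ v : J1, ∀ᶠ z in 𝓝 (φ x), contactForm z (fderiv ℝ φ (φ.symm z)
        (HypEq.contactLift v (φ.symm z))) = 0 := by
      intro v
      filter_upwards [φ.open_target.mem_nhds (φ.map_source hx)] with z hz
      have := hTc _ (φ.map_target hz) _ (HypEq.contactLift_mem v (φ.symm z))
      rwa [φ.right_inv hz] at this
    -- Evaluating the contact forms on a bracket and on its image turns proportionality of U into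
    -- proportionality of dU with the same factor.
    have h1 := hd.fderiv_lieBracket_pullback hx (hc v).differentiableAt (hc w).differentiableAt
    rw [lieBracket_congr (hp v) (hp w)] at h1
    have h2 := congrArg (contactForm (φ x)) h1
    rw [contactForm_lieBracket (hc v).differentiableAt (hc w).differentiableAt (hm v) (hm w),
      ← hT, hU, contactForm_lieBracket (HypEq.contactLift_smoothAt v).differentiableAt
        (HypEq.contactLift_smoothAt w).differentiableAt
        (Eventually.of_forall (HypEq.contactLift_mem v))
        (Eventually.of_forall (HypEq.contactLift_mem w)), φ.left_inv hx,
      HypEq.contactLift_self hv, HypEq.contactLift_self hw] at h2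
    linarith

theorem eventually_mapsChar {φ : OpenPartialHomeomorph J1 J1} {E E' : HypEq} {a : J1}
    (hd : IsDiffeo φ) (ha : a ∈ φ.source)
    (hL : ∀ x ∈ φ.source, LinearEquivalence E x E' (φ x) (fderiv ℝ φ x).toLinearMap)
    (h0 : (E.D1 a).map (fderiv ℝ φ a).toLinearMap ≤ E'.D1 (φ a)) :
    ∀ᶠ x in 𝓝 a, MapsChar φ E E' x := by
  obtain ⟨X, hX, -⟩ := exists_adapted (hL a ha).mem
  have hT : SmoothAt (fun x => fderiv ℝ φ x (X 0 x)) a :=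
    (hd.smoothAt ha).fderiv_apply (hX.smooth 0)
  have hc : SmoothAt (fun x => E'.coeff (φ x)) a :=
    hd.comp_smoothAt ha (HypEq.coeff_smoothAt (hL a ha).mem')
  have hs : SmoothAt (fun x => √(E'.disc (φ x))) a :=
    hd.comp_smoothAt ha (HypEq.sqrt_disc_smoothAt (hL a ha).mem')
  -- (J' + √Δ') applied to the image of X₁ vanishes if this image lies in D² of `E'`. It is non-zero
  -- at `a`, hence nearby, which excludes the eigenvalue -√Δ' there.
  set f : J1 → J1 := fun x => jop (E'.coeff (φ x)) (φ x) (fderiv ℝ φ x (X 0 x)) +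
    (1 * √(E'.disc (φ x))) • fderiv ℝ φ x (X 0 x) with hf
  have hjs : SmoothAt (fun x => jop (E'.coeff (φ x)) (φ x) (fderiv ℝ φ x (X 0 x))) a := by
    have h1 : SmoothAt (fun z => E'.coeff z) (φ a) := HypEq.coeff_smoothAt (hL a ha).mem'
    have h2 : SmoothAt (fun z => fderiv ℝ φ (φ.symm z) (X 0 (φ.symm z))) (φ a) :=
      hd.symm.comp_smoothAt (x := φ a) (φ.map_source ha)
        (f := fun y => fderiv ℝ φ y (X 0 y)) (by rw [φ.left_inv ha]; exact hT)
    have h3 := hd.comp_smoothAt ha (HypEq.SmoothAt_jop h1 h2)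
    refine h3.congr ?_
    filter_upwards [φ.open_source.mem_nhds ha] with y hy
    rw [φ.left_inv hy]
  have hfc : ContinuousAt f a :=
    (hjs.add (((SmoothAt.const 1).mul hs).smul hT)).continuousAt
  have hne : ∀ x ∈ φ.source, X 0 x ≠ 0 → fderiv ℝ φ x (X 0 x) ≠ 0 := fun x hx h hz =>
    h (hd.injective hx (by rw [hz, map_zero]))
  have hfa : f a ≠ 0 := by
    have h1 := h0 (Submodule.mem_map_of_mem (f := (fderiv ℝ φ a).toLinearMap) hX.mem0)
    have h2 := (E'.mem_charPlane.1 h1).2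
    simp only [hf]
    rw [show jop (E'.coeff (φ a)) (φ a) (fderiv ℝ φ a (X 0 a)) = _ from h2,
      ContinuousLinearMap.coe_coe, ← add_smul]
    refine smul_ne_zero ?_ (hne a ha (hX.linearIndependent.ne_zero 0))
    have := E'.sqrt_disc_pos (hL a ha).mem'
    linarith
  filter_upwards [φ.open_source.mem_nhds ha, hX.eventually, hfc.eventually_ne hfa] with x hx hXx hfx
  have hLx := hL x hx
  obtain ⟨ε, hε, hle⟩ := hLx.map_D1_le
  have hle1 : (E.D1 x).map (fderiv ℝ φ x).toLinearMap ≤ E'.D1 (φ x) := by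
    rcases hε with rfl | rfl
    · exact hle
    · exfalso
      apply hfx
      have h1 := hle (Submodule.mem_map_of_mem (f := (fderiv ℝ φ x).toLinearMap) hXx.mem0)
      have h2 := (E'.mem_charPlane.1 h1).2
      simp only [hf]
      rw [show jop (E'.coeff (φ x)) (φ x) (fderiv ℝ φ x (X 0 x)) = _ from h2,
        ContinuousLinearMap.coe_coe]
      module
  obtain ⟨h1, h2⟩ := hLx.map_charPlanes_of_le hle1
  exact ⟨hLx.mem, hLx.mem', h1, h2⟩

theorem contactEquiv_iff (k : Fin 2) (E E' : HypEq) (a a' : J1) (h : E.GenericAt a)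
    (h' : E'.GenericAt a') : ContactEquiv E a E' a' ↔
      SameCoeffFunctions k E a E' a' ∨ SameCoeffFunctions k E a E'.neg a' := by
  constructor
  · rintro ⟨φ, ha, rfl, hs, ht, hc, hH⟩
    have hd : IsDiffeo φ := ⟨hc.1, hc.2.1⟩
    obtain ⟨Φ, haΦ, hΦ, -, -, -, hw⟩ := exists_coordinates E a h
    obtain ⟨w, -, hw, -⟩ := hw k
    have hw' : E.HasCoeffFunctions k a w := by
      filter_upwards [Φ.open_source.mem_nhds haΦ] with x hx using hw x hx
    have hL : ∀ x ∈ φ.source, LinearEquivalence E x E' (φ x) (fderiv ℝ φ x).toLinearMap :=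
      fun x hx => ⟨hs hx, ht (φ.map_source hx), hd.injective hx, hc.2.2 x hx, hc.conformal hx,
        fun r s t r' s' t' hl => (hH x hx r s t r' s' t' hl).1⟩
    have hL' : ∀ x ∈ φ.source,
        LinearEquivalence E x E'.neg (φ x) (fderiv ℝ φ x).toLinearMap :=
      fun x hx => ⟨hs hx, ht (φ.map_source hx), hd.injective hx, hc.2.2 x hx, hc.conformal hx,
        fun r s t r' s' t' hl hh => (E'.neg_holds _ _ _ _).2 ((hL x hx).holds _ _ _ _ _ _ hl hh)⟩
    -- The sign at `a` decides whether `E'` or `E'.neg` has the same coefficient functions as `E`.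
    obtain ⟨ε, hε, hle⟩ := (hL a ha).map_D1_le
    rcases hε with rfl | rfl
    · exact Or.inl (sameCoeffFunctions_of_mapsChar hd ha (eventually_mapsChar hd ha hL hle)
        h.smooth_basicInv hw')
    · refine Or.inr (sameCoeffFunctions_of_mapsChar hd ha (eventually_mapsChar hd ha hL' ?_)
        h.smooth_basicInv hw')
      rw [E'.neg_D1]
      exact hle
  · rintro (hS | hS)
    · exact contactEquiv_of_sameCoeffFunctions (h.regularAt k) (h'.regularAt k) hS
    · obtain ⟨-, -, w', -, hw', -⟩ := id hS
      exact (contactEquiv_of_sameCoeffFunctions (h.regularAt k) (regularAt_neg h' hw') hS).of_neg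

/-! ### Functions vanishing to a given order -/

section Vanishing

variable {F : Type*} [NormedAddCommGroup F] [NormedSpace ℝ F]

/-- The germ of `f` at `a` is smooth and its derivatives of order `< r` vanish at `a`. -/
def VanishesAt (a : J1) : ℕ → (J1 → F) → Prop
  | 0, f => SmoothAt f a
  | r + 1, f => SmoothAt f a ∧ f a = 0 ∧ ∀ v, VanishesAt a r fun x => fderiv ℝ f x v

namespace VanishesAt

variable {a : J1} {r s : ℕ} {f g : J1 → F} {c : J1 → ℝ}

theorem smooth (h : VanishesAt a r f) : SmoothAt f a := by
  cases r with
  | zero => exact h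
  | succ r => exact h.1

theorem self (h : VanishesAt a (r + 1) f) : f a = 0 := h.2.1

theorem deriv (h : VanishesAt a (r + 1) f) (v : J1) : VanishesAt a r fun x => fderiv ℝ f x v :=
  h.2.2 v

theorem of_smooth (h : SmoothAt f a) : VanishesAt a 0 f := h

theorem of_smooth_of_eq_zero (h : SmoothAt f a) (h0 : f a = 0) : VanishesAt a 1 f :=
  ⟨h, h0, fun _ => h.fderiv_apply (.const _)⟩

theorem fderiv_eq_zero (h : VanishesAt a (r + 2) f) : fderiv ℝ f a = 0 := by
  ext v
  exact (h.deriv v).self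

theorem congr (h : VanishesAt a r f) (hg : g =ᶠ[𝓝 a] f) : VanishesAt a r g := by
  induction r generalizing f g with
  | zero => exact SmoothAt.congr h hg
  | succ r ih =>
    refine ⟨h.smooth.congr hg, hg.self_of_nhds.trans h.self, fun v => ih (h.deriv v) ?_⟩
    exact (hg.fderiv (𝕜 := ℝ)).mono fun x hx => congrArg (fun M : J1 →L[ℝ] F => M v) hx

theorem pred (h : VanishesAt a (r + 1) f) : VanishesAt a r f := by
  induction r generalizing f with
  | zero => exact h.1
  | succ r ih => exact ⟨h.1, h.2.1, fun v => ih (h.deriv v)⟩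

theorem mono (h : VanishesAt a r f) (hs : s ≤ r) : VanishesAt a s f := by
  induction r, hs using Nat.le_induction with
  | base => exact h
  | succ r _ ih => exact ih h.pred

theorem deriv' (h : VanishesAt a r f) (v : J1) : VanishesAt a (r - 1) fun x => fderiv ℝ f x v := by
  cases r with
  | zero => exact h.smooth.fderiv_apply (.const _)
  | succ r => exact h.deriv v

theorem zero : VanishesAt a r fun _ => (0 : F) := by
  induction r with
  | zero => exact SmoothAt.const _
  | succ r ih => exact ⟨SmoothAt.const _, rfl, fun v => by simpa using ih⟩

theorem add (hf : VanishesAt a r f) (hg : VanishesAt a r g) :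
    VanishesAt a r fun x => f x + g x := by
  induction r generalizing f g with
  | zero => exact SmoothAt.add hf hg
  | succ r ih =>
    refine ⟨hf.1.add hg.1, by simp only [hf.self, hg.self, add_zero], fun v => ?_⟩
    refine (ih (hf.deriv v) (hg.deriv v)).congr ?_
    filter_upwards [hf.1, hg.1] with x h1 h2
    rw [fderiv_fun_add (h1.differentiableAt (by simp)) (h2.differentiableAt (by simp))]
    rfl

/-- Orders of vanishing add, by induction on the total order through the Leibniz rule; an order 0
carries no condition at the point, so that factor may be differentiated freely. -/
theorem smul (hc : VanishesAt a r c) (hf : VanishesAt a s f) :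
    VanishesAt a (r + s) fun x => c x • f x := by
  generalize hN : r + s = N
  induction N generalizing r s c f with
  | zero => exact hc.smooth.smul hf.smooth
  | succ N ih =>
    refine ⟨hc.smooth.smul hf.smooth, ?_, fun v => ?_⟩
    · cases r with
      | zero =>
        obtain rfl : s = N + 1 := by omega
        simp only [hf.self, smul_zero]
      | succ r => simp only [hc.self, zero_smul]
    have h1 : VanishesAt a N fun x => c x • fderiv ℝ f x v := by
      cases s with
      | zero => exact ih (hc.mono (by omega : N ≤ r)) (hf.deriv' v) (by omega)
      | succ s => exact ih hc (hf.deriv v) (by omega)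
    have h2 : VanishesAt a N fun x => fderiv ℝ c x v • f x := by
      cases r with
      | zero => exact ih (hc.deriv' v) (hf.mono (by omega : N ≤ s)) (by omega)
      | succ r => exact ih (hc.deriv v) hf (by omega)
    refine (h1.add h2).congr ?_
    filter_upwards [hc.smooth, hf.smooth] with x e1 e2
    rw [fderiv_fun_smul (e1.differentiableAt (by simp)) (e2.differentiableAt (by simp))]
    rfl

theorem smooth_smul (hc : SmoothAt c a) (hf : VanishesAt a r f) :
    VanishesAt a r fun x => c x • f x := by
  have := (of_smooth hc).smul hf
  rwa [zero_add] at this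

theorem smul_smooth (hc : VanishesAt a r c) (hf : SmoothAt f a) :
    VanishesAt a r fun x => c x • f x :=
  hc.smul (of_smooth hf)

theorem mul_smooth {d : J1 → ℝ} (hc : VanishesAt a r c) (hd : SmoothAt d a) :
    VanishesAt a r fun x => c x * d x := hc.smul_smooth hd

theorem smooth_mul {d : J1 → ℝ} (hc : SmoothAt c a) (hd : VanishesAt a r d) :
    VanishesAt a r fun x => c x * d x := smooth_smul hc hd

theorem mul {d : J1 → ℝ} (hc : VanishesAt a r c) (hd : VanishesAt a s d) :
    VanishesAt a (r + s) fun x => c x * d x := hc.smul hd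

theorem const_mul (t : ℝ) (hc : VanishesAt a r c) : VanishesAt a r fun x => t * c x :=
  smooth_mul (.const t) hc

theorem neg (hf : VanishesAt a r f) : VanishesAt a r fun x => -f x := by
  simpa using smooth_smul (.const (-1)) hf

theorem sub (hf : VanishesAt a r f) (hg : VanishesAt a r g) :
    VanishesAt a r fun x => f x - g x := by
  simpa only [sub_eq_add_neg] using hf.add hg.neg

theorem sum {ι : Type*} {t : Finset ι} {f : ι → J1 → F} (h : ∀ i ∈ t, VanishesAt a r (f i)) :
    VanishesAt a r fun x => ∑ i ∈ t, f i x := by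
  classical
  induction t using Finset.induction_on with
  | empty => simpa using zero
  | insert i t hi ih =>
    simp only [Finset.sum_insert hi]
    exact (h i (Finset.mem_insert_self _ _)).add
      (ih fun j hj => h j (Finset.mem_insert_of_mem hj))

theorem sum_smul {ι : Type*} [Fintype ι] {c : ι → J1 → ℝ} {V : ι → J1 → F}
    (hc : ∀ i, VanishesAt a r (c i)) (hV : ∀ i, SmoothAt (V i) a) :
    VanishesAt a r fun x => ∑ i, c i x • V i x :=
  sum fun i _ => (hc i).smul_smooth (hV i)

theorem comp_clm {G : Type*} [NormedAddCommGroup G] [NormedSpace ℝ G] (L : F →L[ℝ] G)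
    (h : VanishesAt a r f) : VanishesAt a r fun x => L (f x) := by
  have hs : ∀ {f : J1 → F}, SmoothAt f a → SmoothAt (fun x => L (f x)) a := fun hf => by
    filter_upwards [hf] with x hx using L.contDiff.contDiffAt.comp x hx
  induction r generalizing f with
  | zero => exact hs h
  | succ r ih =>
    refine ⟨hs h.1, by simp only [h.self, map_zero], fun v => (ih (h.deriv v)).congr ?_⟩
    filter_upwards [h.1] with x hx
    exact congrArg (fun M : J1 →L[ℝ] G => M v)
      (L.hasFDerivAt.comp x (hx.differentiableAt (by simp)).hasFDerivAt).fderiv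

theorem apply {V : J1 → J1} (h : VanishesAt a r V) (i : Fin 5) : VanishesAt a r fun x => V x i :=
  h.comp_clm (ContinuousLinearMap.proj (R := ℝ) (φ := fun _ : Fin 5 => ℝ) i)

theorem sum_basis (v : J1) : ∑ i, v i • (Pi.single i 1 : J1) = v := by
  simp [← Pi.single_smul, Finset.univ_sum_single]

/-- Differentiation along a smooth field lowers the order by one. -/
theorem fderiv_apply {V : J1 → J1} (h : VanishesAt a (r + 1) f) (hV : SmoothAt V a) :
    VanishesAt a r fun x => fderiv ℝ f x (V x) := by
  refine (sum (t := Finset.univ) (f := fun i x => V x i • fderiv ℝ f x (Pi.single i 1))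
    fun i _ => smooth_smul (hV.apply i) (h.deriv _)).congr (Eventually.of_forall fun x => ?_)
  have := congrArg (fderiv ℝ f x) (sum_basis (V x)).symm
  simpa only [map_sum, map_smul] using this

/-- Differentiation along a field vanishing to order `r`. -/
theorem fderiv_along {V : J1 → J1} (h : SmoothAt f a) (hV : VanishesAt a r V) :
    VanishesAt a r fun x => fderiv ℝ f x (V x) := by
  refine (sum (t := Finset.univ) (f := fun i x => V x i • fderiv ℝ f x (Pi.single i 1))
    fun i _ => (hV.apply i).smul_smooth (h.fderiv_apply (.const _))).congr
      (Eventually.of_forall fun x => ?_)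
  have := congrArg (fderiv ℝ f x) (sum_basis (V x)).symm
  simpa only [map_sum, map_smul] using this

theorem coords {X : Fin 5 → J1 → J1} (hX : ∀ i, SmoothAt (X i) a) (h : frameDet X a ≠ 0)
    {V : J1 → J1} (hV : VanishesAt a r V) (i : Fin 5) :
    VanishesAt a r fun x => MongeAmpere.coords X x (V x) i := by
  refine (sum (t := Finset.univ)
    (f := fun j x => V x j * MongeAmpere.coords X x (Pi.single j 1) i)
    fun j _ => (hV.apply j).mul_smooth (SmoothAt.coords hX h (.const _) i)).congr
      (Eventually.of_forall fun x => ?_)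
  have := map_sum (coordsₗ X x) (fun j => V x j • (Pi.single j 1 : J1)) Finset.univ
  rw [sum_basis] at this
  have := congrFun this i
  simpa [coordsₗ, coords_smul] using this

theorem fderiv_smul_sub {V W : J1 → J1} (hc : VanishesAt a r c) (hV : SmoothAt V a)
    (hW : SmoothAt W a) :
    VanishesAt a r fun x => fderiv ℝ (fun y => c y • V y) x (W x) - fderiv ℝ c x (W x) • V x := by
  refine (hc.smul_smooth (hV.fderiv_apply hW)).congr ?_
  filter_upwards [hc.smooth, hV] with x e1 e2
  rw [fderiv_fun_smul (e1.differentiableAt (by simp)) (e2.differentiableAt (by simp))]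
  simp

/-- First order expansion of a bracket of perturbed fields. -/
theorem lieBracket_sub {V W ξ ζ : J1 → J1} (hV : SmoothAt V a) (hW : SmoothAt W a)
    (hξ : VanishesAt a r ξ) (hζ : VanishesAt a r ζ) :
    VanishesAt a r fun x =>
      VectorField.lieBracket ℝ (fun y => V y + ξ y) (fun y => W y + ζ y) x -
        VectorField.lieBracket ℝ V W x - (fderiv ℝ ζ x (V x) - fderiv ℝ ξ x (W x)) := by
  refine ((((fderiv_along hW hξ).add (fderiv_along hζ.smooth hξ)).sub (fderiv_along hV hζ)).sub
    (fderiv_along hξ.smooth hζ)).congr ?_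
  filter_upwards [hV, hW, hξ.smooth, hζ.smooth] with x e1 e2 e3 e4
  simp only [VectorField.lieBracket]
  rw [fderiv_fun_add (e1.differentiableAt (by simp)) (e3.differentiableAt (by simp)),
    fderiv_fun_add (e2.differentiableAt (by simp)) (e4.differentiableAt (by simp))]
  simp only [add_apply, map_add]
  abel

end VanishesAt

end Vanishing

/-! ### Polynomials in linear coordinates -/

open MvPolynomial in
/-- The function obtained by inserting in `φ` the linear coordinates centred at `a` which are dual
to the frame `X` at `a`. -/
def polyFun (X : Fin 5 → J1 → J1) (a : J1) (φ : MvPolynomial (Fin 5) ℝ) (x : J1) : ℝ :=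
  eval (coords X a (x - a)) φ

section PolyFun

variable {X : Fin 5 → J1 → J1} {a : J1}

theorem polyFun_self (φ : MvPolynomial (Fin 5) ℝ) : polyFun X a φ a = MvPolynomial.eval 0 φ := by
  rw [polyFun, sub_self]
  congr 2
  exact map_zero (coordsₗ X a)

theorem polyFun_add (φ ψ : MvPolynomial (Fin 5) ℝ) (x : J1) :
    polyFun X a (φ + ψ) x = polyFun X a φ x + polyFun X a ψ x := map_add _ _ _

theorem polyFun_mul (φ ψ : MvPolynomial (Fin 5) ℝ) (x : J1) :
    polyFun X a (φ * ψ) x = polyFun X a φ x * polyFun X a ψ x := map_mul _ _ _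

theorem polyFun_C (c : ℝ) (x : J1) : polyFun X a (MvPolynomial.C c) x = c :=
  MvPolynomial.eval_C _

theorem polyFun_neg (φ : MvPolynomial (Fin 5) ℝ) (x : J1) :
    polyFun X a (-φ) x = -polyFun X a φ x := map_neg _ _

theorem polyFun_sub (φ ψ : MvPolynomial (Fin 5) ℝ) (x : J1) :
    polyFun X a (φ - ψ) x = polyFun X a φ x - polyFun X a ψ x := map_sub _ _ _

theorem polyFun_zero (x : J1) : polyFun X a 0 x = 0 := map_zero _

theorem polyFun_hasFDerivAt (φ : MvPolynomial (Fin 5) ℝ) (x : J1) :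
    HasFDerivAt (polyFun X a φ) (∑ i, polyFun X a (MvPolynomial.pderiv i φ) x •
      ((LinearMap.proj i ∘ₗ coordsₗ X a).toContinuousLinearMap)) x := by
  have hlin : ∀ i, HasFDerivAt (fun y => coords X a (y - a) i)
      ((LinearMap.proj i ∘ₗ coordsₗ X a).toContinuousLinearMap) x := fun i => by
    have h1 := ((LinearMap.proj (R := ℝ) (φ := fun _ : Fin 5 => ℝ) i ∘ₗ
      coordsₗ X a).toContinuousLinearMap).hasFDerivAt (x := x - a)
    exact h1.comp x ((hasFDerivAt_id x).sub_const a)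
  induction φ using MvPolynomial.induction_on with
  | C c =>
    have : polyFun X a (MvPolynomial.C c) = fun _ => c := funext fun y => polyFun_C c y
    rw [this]
    simpa [polyFun_zero] using hasFDerivAt_const c x
  | add p q hp hq =>
    have : polyFun X a (p + q) = fun y => polyFun X a p y + polyFun X a q y :=
      funext fun y => polyFun_add p q y
    rw [this]
    simp only [map_add, polyFun_add, add_smul, Finset.sum_add_distrib]
    exact hp.add hq
  | mul_X p j hp =>
    have : polyFun X a (p * MvPolynomial.X j) =
        fun y => polyFun X a p y * coords X a (y - a) j := funext fun y => by
      rw [polyFun_mul, polyFun, polyFun, MvPolynomial.eval_X]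
    rw [this]
    refine (hp.mul (hlin j)).congr_fderiv ?_
    ext v
    simp only [MvPolynomial.pderiv_mul, polyFun_add, polyFun_mul, add_smul,
      Finset.sum_add_distrib, add_apply, sum_apply,
      smul_apply, smul_eq_mul, MvPolynomial.pderiv_X, Pi.single_apply]
    have hX : polyFun X a (MvPolynomial.X j) x = coords X a (x - a) j := MvPolynomial.eval_X _
    rw [Finset.sum_eq_single j (fun i _ hi => by simp [hi.symm, polyFun_zero]) (by simp)
      (f := fun i => polyFun X a p x * polyFun X a (if j = i then 1 else 0) x *
        (LinearMap.toContinuousLinearMap (LinearMap.proj i ∘ₗ coordsₗ X a)) v)]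
    have h1 : polyFun X a 1 x = 1 := map_one _
    rw [hX, if_pos rfl, h1, Finset.mul_sum, mul_one, add_comm]
    congr 1
    exact Finset.sum_congr rfl fun i _ => by ring

theorem fderiv_polyFun (φ : MvPolynomial (Fin 5) ℝ) (x v : J1) :
    fderiv ℝ (polyFun X a φ) x v =
      ∑ i, polyFun X a (MvPolynomial.pderiv i φ) x * coords X a v i := by
  rw [(polyFun_hasFDerivAt φ x).fderiv]
  simp [coordsₗ]

theorem polyFun_contDiff (φ : MvPolynomial (Fin 5) ℝ) : ContDiff ℝ ∞ (polyFun X a φ) := by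
  have hlin : ∀ i, ContDiff ℝ ∞ (fun y => coords X a (y - a) i) := fun i => by
    have h1 := ((LinearMap.proj (R := ℝ) (φ := fun _ : Fin 5 => ℝ) i ∘ₗ
      coordsₗ X a).toContinuousLinearMap).contDiff (n := ∞)
    exact h1.comp (contDiff_id.sub contDiff_const)
  induction φ using MvPolynomial.induction_on with
  | C c =>
    have : polyFun X a (MvPolynomial.C c) = fun _ => c := funext fun y => polyFun_C c y
    rw [this]; exact contDiff_const
  | add p q hp hq =>
    have : polyFun X a (p + q) = fun y => polyFun X a p y + polyFun X a q y :=
      funext fun y => polyFun_add p q y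
    rw [this]; exact hp.add hq
  | mul_X p j hp =>
    have : polyFun X a (p * MvPolynomial.X j) =
        fun y => polyFun X a p y * coords X a (y - a) j := funext fun y => by
      rw [polyFun_mul, polyFun, polyFun, MvPolynomial.eval_X]
    rw [this]; exact hp.mul (hlin j)

theorem polyFun_smooth (φ : MvPolynomial (Fin 5) ℝ) {b : J1} : SmoothAt (polyFun X a φ) b :=
  .of_contDiff (polyFun_contDiff φ)

theorem polyFun_vanishesAt {φ : MvPolynomial (Fin 5) ℝ} {n : ℕ} (h : φ.IsHomogeneous n) :
    VanishesAt a n (polyFun X a φ) := by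
  induction n generalizing φ with
  | zero => exact polyFun_smooth φ
  | succ n ih =>
    refine ⟨polyFun_smooth φ, ?_, fun v => ?_⟩
    · rw [polyFun_self]
      rw [MvPolynomial.eval_zero, MvPolynomial.constantCoeff_eq]
      exact h.coeff_eq_zero (by simp)
    · simp only [fderiv_polyFun]
      exact VanishesAt.sum fun i _ => (ih h.pderiv).mul_smooth (.const _)

/-- Along the frame, polynomials in the dual coordinates are differentiated like polynomials, up
to terms of higher order. -/
theorem fderiv_polyFun_frame (hX : ∀ i, SmoothAt (X i) a) (h0 : frameDet X a ≠ 0)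
    {φ : MvPolynomial (Fin 5) ℝ} {n : ℕ} (h : φ.IsHomogeneous (n + 1)) (j : Fin 5) :
    VanishesAt a (n + 1) fun x => fderiv ℝ (polyFun X a φ) x (X j x) -
      polyFun X a (MvPolynomial.pderiv j φ) x := by
  -- The coordinates are dual to the frame at `a` alone. Along X_j their derivatives differ from the
  -- Kronecker symbol by terms vanishing at `a`, which costs one order.
  have hc : ∀ i, VanishesAt a 1 fun x => coords X a (X j x) i - (Pi.single j 1 : J1) i := fun i => by
    refine VanishesAt.of_smooth_of_eq_zero (SmoothAt.sub ?_ (SmoothAt.const ((Pi.single j 1 : J1) i))) ?_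
    · simp only [coords, Matrix.mulVec, dotProduct]
      exact SmoothAt.sum fun k _ => (SmoothAt.const _).mul ((hX j).apply k)
    · rw [coords_frame h0, sub_self]
  refine (VanishesAt.sum (t := Finset.univ) (f := fun i x =>
    polyFun X a (MvPolynomial.pderiv i φ) x * (coords X a (X j x) i - (Pi.single j 1 : J1) i))
    fun i _ => (polyFun_vanishesAt h.pderiv).mul (hc i)).congr (Eventually.of_forall fun x => ?_)
  simp only [fderiv_polyFun, mul_sub, Finset.sum_sub_distrib]
  simp [Pi.single_apply]

end PolyFun

/-! ### Perturbed equations -/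

/-- An adapted frame whose first two and next two fields have the coefficients of the equation as
coefficient vector. -/
structure Normalized (E : HypEq) (X : Fin 5 → J1 → J1) (a : J1) : Prop
    extends Adapted E X a where
  coeff_eq : ∀ᶠ y in 𝓝 a, E.coeff y = pluck (X 0 y) (X 1 y) ∧
    E.coeff y = pluck (X 2 y) (X 3 y) ∧ Om (X 0 y) (X 1 y) = √(E.disc y) ∧
    Om (X 2 y) (X 3 y) = -√(E.disc y)

theorem exists_normalized {E : HypEq} {a : J1} (ha : a ∈ E.dom) : ∃ X, Normalized E X a :=
  (exists_adapted ha).imp fun _ h => ⟨h.1, h.2⟩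

theorem SmoothAt.pluck {V W : J1 → J1} {a : J1} (hV : SmoothAt V a) (hW : SmoothAt W a) :
    SmoothAt (fun y => pluck (V y) (W y)) a := by
  have m := fun i j : Fin 5 => (hV.apply i).mul (hW.apply j)
  refine SmoothAt.pi fun i => ?_
  fin_cases i
  · exact (m 0 1).sub (m 1 0)
  · exact ((m 0 4).sub (m 4 0)).neg
  · exact ((m 0 3).sub (m 3 0)).sub ((m 1 4).sub (m 4 1))
  · exact (m 1 3).sub (m 3 1)
  · exact (m 3 4).sub (m 4 3)

theorem SmoothAt.discForm {c : J1 → Fin 5 → ℝ} {a : J1} (hc : SmoothAt c a) :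
    SmoothAt (fun y => discForm (c y)) a :=
  (((hc.apply 2).pow 2).sub ((((SmoothAt.const 4).mul (hc.apply 1))).mul (hc.apply 3))).add
    (((SmoothAt.const 4).mul (hc.apply 0)).mul (hc.apply 4))

/-- A smooth coefficient vector with positive discriminant defines a hyperbolic equation. -/
theorem exists_hypEq {c : J1 → Fin 5 → ℝ} {a : J1} (hc : SmoothAt c a)
    (h0 : 0 < discForm (c a)) : ∃ E : HypEq, E.coeff = c ∧ a ∈ E.dom := by
  have h : ∀ᶠ y in 𝓝 a, ContDiffAt ℝ ∞ c y ∧ 0 < discForm (c y) :=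
    hc.and (hc.discForm.continuousAt.eventually_const_lt h0)
  obtain ⟨U, hU, hUo, haU⟩ := mem_nhds_iff.1 h
  exact ⟨⟨U, hUo, c, fun y hy => (hU hy).1.contDiffWithinAt, fun y hy => (hU hy).2⟩, rfl, haU⟩

/-- To be compared with `pluck_expand'`: the linear terms coincide, and the remaining terms coincide
if `pluck v0 v1 = pluck v2 v3`. The coefficients (k, -g) and (-h, f) of the second pair are chosen
so that both pairs define the same equation. -/
theorem pluck_expand (v0 v1 v2 v3 : J1) (f g h k : ℝ) :
    pluck (v0 + (f • v2 + g • v3)) (v1 + (h • v2 + k • v3)) =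
      pluck v0 v1 + (h • pluck v0 v2 + k • pluck v0 v3 - f • pluck v1 v2 - g • pluck v1 v3) +
        (f * k - g * h) • pluck v2 v3 := by
  ext i
  fin_cases i <;> simp [pluck] <;> ring

theorem pluck_expand' (v0 v1 v2 v3 : J1) (f g h k : ℝ) :
    pluck (v2 + (k • v0 + (-g) • v1)) (v3 + ((-h) • v0 + f • v1)) =
      pluck v2 v3 + (h • pluck v0 v2 + k • pluck v0 v3 - f • pluck v1 v2 - g • pluck v1 v3) +
        (f * k - g * h) • pluck v0 v1 := by
  ext i
  fin_cases i <;> simp [pluck] <;> ring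

theorem Om_expand {v0 v1 v2 v3 : J1} (h02 : Om v0 v2 = 0) (h03 : Om v0 v3 = 0) (h12 : Om v1 v2 = 0)
    (h13 : Om v1 v3 = 0) (h23 : Om v2 v3 = -Om v0 v1) (f g h k : ℝ) :
    Om (v0 + (f • v2 + g • v3)) (v1 + (h • v2 + k • v3)) = Om v0 v1 * (1 - (f * k - g * h)) ∧
    Om (v2 + (k • v0 + (-g) • v1)) (v3 + ((-h) • v0 + f • v1)) = -(Om v0 v1 * (1 - (f * k - g * h))) := by
  have h32 : Om v3 v2 = Om v0 v1 := by rw [Om_swap, h23, neg_neg]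
  simp only [Om_add_left, Om_add_right, Om_smul_left, Om_smul_right,
    Om_self, h02, h03, h12, h13, h23, h32, Om_swap v1 v2, Om_swap v1 v3, Om_swap v0 v2,
    Om_swap v0 v1]
  constructor <;> ring

/-- The perturbed frame of the characteristic distributions. -/
def perturbedFrame (X : Fin 5 → J1 → J1) (f g h k : J1 → ℝ) : Fin 4 → J1 → J1 :=
  ![fun y => X 0 y + (f y • X 2 y + g y • X 3 y), fun y => X 1 y + (h y • X 2 y + k y • X 3 y),
    fun y => X 2 y + (k y • X 0 y + (-g y) • X 1 y), fun y => X 3 y + ((-h y) • X 0 y + f y • X 1 y)]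

theorem exists_perturbed {E : HypEq} {X : Fin 5 → J1 → J1} {a : J1} (hX : Normalized E X a)
    {f g h k : J1 → ℝ} (hf : SmoothAt f a) (hg : SmoothAt g a) (hh : SmoothAt h a)
    (hk : SmoothAt k a) (f0 : f a = 0) (g0 : g a = 0) :
    ∃ (E' : HypEq) (W : J1 → J1),
      Normalized E' ![perturbedFrame X f g h k 0, perturbedFrame X f g h k 1,
        perturbedFrame X f g h k 2, perturbedFrame X f g h k 3, W] a ∧
      E'.coeff = fun y => pluck (perturbedFrame X f g h k 0 y) (perturbedFrame X f g h k 1 y) := by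
  set Z := perturbedFrame X f g h k with hZdef
  have hZ : ∀ i, SmoothAt (Z i) a := by
    have s := hX.smooth
    intro i
    fin_cases i
    · exact (s 0).add ((hf.smul (s 2)).add (hg.smul (s 3)))
    · exact (s 1).add ((hh.smul (s 2)).add (hk.smul (s 3)))
    · exact (s 2).add ((hk.smul (s 0)).add (hg.neg.smul (s 1)))
    · exact (s 3).add ((hh.neg.smul (s 0)).add (hf.smul (s 1)))
  have hO : ∀ᶠ y in 𝓝 a, Om (Z 0 y) (Z 1 y) = √(E.disc y) * (1 - (f y * k y - g y * h y)) ∧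
      Om (Z 2 y) (Z 3 y) = -(√(E.disc y) * (1 - (f y * k y - g y * h y))) := by
    filter_upwards [hX.eventually, hX.coeff_eq] with y hy ⟨_, _, h3, _⟩
    have hz : ∀ v w, v ∈ E.D1 y → w ∈ E.D2 y → Om v w = 0 :=
      fun v w hv hw => HypEq.Om_eq_zero_of_mem hy.mem_dom hv hw
    have := Om_expand (hz _ _ hy.mem0 hy.mem2) (hz _ _ hy.mem0 hy.mem3)
      (hz _ _ hy.mem1 hy.mem2) (hz _ _ hy.mem1 hy.mem3) hy.Om23_eq (f y) (g y) (h y) (k y)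
    rwa [h3] at this
  -- As f and g vanish at `a`, so does the quadratic term f k - g h, and the unperturbed value √Δ
  -- remains.
  have hpos0 : 0 < Om (Z 0 a) (Z 1 a) := by
    rw [hO.self_of_nhds.1, f0, g0]
    simpa using E.sqrt_disc_pos hX.mem_dom
  obtain ⟨E', hc, ha'⟩ := exists_hypEq ((hZ 0).pluck (hZ 1))
    (by rw [discForm_pluck]; positivity)
  have hpos : ∀ᶠ y in 𝓝 a, 0 < Om (Z 0 y) (Z 1 y) :=
    (HypEq.SmoothAt_Om (hZ 0) (hZ 1)).continuousAt.eventually_const_lt hpos0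
  have key : ∀ᶠ y in 𝓝 a, E'.coeff y = pluck (Z 0 y) (Z 1 y) ∧
      E'.coeff y = pluck (Z 2 y) (Z 3 y) ∧ Om (Z 0 y) (Z 1 y) = √(E'.disc y) ∧
      Om (Z 2 y) (Z 3 y) = -√(E'.disc y) := by
    filter_upwards [hO, hpos, hX.coeff_eq] with y hy hp ⟨c1, c2, _, _⟩
    have hd : √(E'.disc y) = Om (Z 0 y) (Z 1 y) := by
      rw [HypEq.disc_eq, hc, discForm_pluck, Real.sqrt_sq hp.le]
    refine ⟨by rw [hc], ?_, hd.symm, by rw [hd, hy.1, hy.2]⟩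
    rw [hc]
    change pluck (X 0 y + (f y • X 2 y + g y • X 3 y)) (X 1 y + (h y • X 2 y + k y • X 3 y)) =
      pluck (X 2 y + (k y • X 0 y + (-g y) • X 1 y)) (X 3 y + ((-h y) • X 0 y + f y • X 1 y))
    rw [pluck_expand, pluck_expand', ← c1, ← c2]
  have hcont : ∀ᶠ y in 𝓝 a, ∀ i, contactForm y (Z i y) = 0 := by
    filter_upwards [hX.eventually] with y hy i
    have e0 := hy.mem0.1; have e1 := hy.mem1.1; have e2 := hy.mem2.1; have e3 := hy.mem3.1
    fin_cases i <;> simp [hZdef, perturbedFrame, e0, e1, e2, e3]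
  have hA := exists_adapted_extension ha' hZ (by
    filter_upwards [key, hcont, hpos, hO] with y ⟨k1, k2, k3, k4⟩ hy hp h1
    refine ⟨E'.charPlane_eq_span (hy 0) (hy 1) k1 (by rw [one_mul, k3]) hp.ne',
      E'.charPlane_eq_span (hy 2) (hy 3) k2 (by rw [k4]; ring) ?_, by rw [k4, k3]⟩
    rw [h1.2, ← h1.1]
    exact (neg_lt_zero.2 hp).ne)
  exact ⟨E', _, ⟨hA, key⟩, hc⟩

/-! ### The structure functions of perturbed equations -/

/-- The leading part of the perturbation of the last field of the frame. -/
def leadingPart (X : Fin 5 → J1 → J1) (f g h k : J1 → ℝ) : Fin 5 → J1 → ℝ :=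
  ![fun x => fderiv ℝ h x (X 2 x) + fderiv ℝ k x (X 3 x),
    fun x => -(fderiv ℝ f x (X 2 x) + fderiv ℝ g x (X 3 x)),
    fun x => fderiv ℝ h x (X 0 x) - fderiv ℝ f x (X 1 x),
    fun x => fderiv ℝ k x (X 0 x) - fderiv ℝ g x (X 1 x), fun _ => 0]

section Perturbation

variable {E E' : HypEq} {X Y : Fin 5 → J1 → J1} {a : J1} {n : ℕ}

theorem vanishesAt_of_coords {X : Fin 5 → J1 → J1} (hs : ∀ i, SmoothAt (X i) a)
    (h0 : frameDet X a ≠ 0) {V : J1 → J1}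
    (h : ∀ i, VanishesAt a n fun x => coords X x (V x) i) : VanishesAt a n V := by
  refine (VanishesAt.sum_smul h hs).congr ?_
  filter_upwards [eventually_frameDet hs h0] with x hx using (sum_coords hx _).symm

/-- The bracket of two fields perturbed by combinations of a pair of fields. -/
theorem bracket_perturbed {V W S T : J1 → J1} (hV : SmoothAt V a) (hW : SmoothAt W a)
    (hS : SmoothAt S a) (hT : SmoothAt T a) {p q r s : J1 → ℝ} (hp : VanishesAt a n p)
    (hq : VanishesAt a n q) (hr : VanishesAt a n r) (hs : VanishesAt a n s) :
    VanishesAt a n fun x =>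
      VectorField.lieBracket ℝ (fun y => V y + (p y • S y + q y • T y))
        (fun y => W y + (r y • S y + s y • T y)) x - VectorField.lieBracket ℝ V W x -
      ((fderiv ℝ r x (V x) - fderiv ℝ p x (W x)) • S x +
        (fderiv ℝ s x (V x) - fderiv ℝ q x (W x)) • T x) := by
  have hd : ∀ {p q : J1 → ℝ} {V : J1 → J1}, VanishesAt a n p → VanishesAt a n q → SmoothAt V a →
      VanishesAt a n fun x => fderiv ℝ (fun y => p y • S y + q y • T y) x (V x) -
        (fderiv ℝ p x (V x) • S x + fderiv ℝ q x (V x) • T x) := by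
    intro p q V hp hq hV
    refine ((hp.fderiv_smul_sub hS hV).add (hq.fderiv_smul_sub hT hV)).congr ?_
    filter_upwards [hp.smooth, hq.smooth, hS, hT] with x e1 e2 e3 e4
    rw [fderiv_fun_add (f := fun y => p y • S y) (g := fun y => q y • T y)
      ((e1.smul e3).differentiableAt (by simp)) ((e2.smul e4).differentiableAt (by simp))]
    simp only [add_apply]
    abel
  refine (((VanishesAt.lieBracket_sub hV hW ((hp.smul_smooth hS).add (hq.smul_smooth hT))
    ((hr.smul_smooth hS).add (hs.smul_smooth hT))).add (hd hr hs hV)).sub (hd hp hq hW)).congr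
      (Eventually.of_forall fun x => ?_)
  simp only
  module

theorem leadingPart_vanishesAt {X : Fin 5 → J1 → J1} (hX : ∀ i, SmoothAt (X i) a)
    {f g h k : J1 → ℝ} (hf : VanishesAt a (n + 1) f) (hg : VanishesAt a (n + 1) g)
    (hh : VanishesAt a (n + 1) h) (hk : VanishesAt a (n + 1) k) (i : Fin 5) :
    VanishesAt a n (leadingPart X f g h k i) := by
  fin_cases i
  · exact (hh.fderiv_apply (hX 2)).add (hk.fderiv_apply (hX 3))
  · exact ((hf.fderiv_apply (hX 2)).add (hg.fderiv_apply (hX 3))).neg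
  · exact (hh.fderiv_apply (hX 0)).sub (hf.fderiv_apply (hX 1))
  · exact (hk.fderiv_apply (hX 0)).sub (hg.fderiv_apply (hX 1))
  · exact VanishesAt.zero

/-- The fifth field is determined by two congruences. [Y₁, Y₂] fixes it modulo the new D¹, giving
the components along X₃, X₄, X₅; -[Y₃, Y₄] fixes it modulo the new D², giving those along X₁, X₂.
The first derivatives of f, g, h, k in these brackets are the leading part. -/
theorem perturbed_frame4 (hX : Adapted E X a) (hY : Adapted E' Y a) {f g h k : J1 → ℝ}
    (hf : VanishesAt a (n + 1) f) (hg : VanishesAt a (n + 1) g) (hh : VanishesAt a (n + 1) h)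
    (hk : VanishesAt a (n + 1) k) (h0 : Y 0 = perturbedFrame X f g h k 0)
    (h1 : Y 1 = perturbedFrame X f g h k 1) (h2 : Y 2 = perturbedFrame X f g h k 2)
    (h3 : Y 3 = perturbedFrame X f g h k 3) :
    VanishesAt a (n + 1) fun x => Y 4 x - X 4 x - ∑ i, leadingPart X f g h k i x • X i x := by
  have sX := hX.smooth
  have sY := hY.smooth
  set R := leadingPart X f g h k with hR
  have d0 : VanishesAt a (n + 1) fun x => Y 0 x - X 0 x := by
    rw [h0]
    exact ((hf.smul_smooth (sX 2)).add (hg.smul_smooth (sX 3))).congr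
      (Eventually.of_forall fun x => by simp [perturbedFrame])
  have d1 : VanishesAt a (n + 1) fun x => Y 1 x - X 1 x := by
    rw [h1]
    exact ((hh.smul_smooth (sX 2)).add (hk.smul_smooth (sX 3))).congr
      (Eventually.of_forall fun x => by simp [perturbedFrame])
  have d2 : VanishesAt a (n + 1) fun x => Y 2 x - X 2 x := by
    rw [h2]
    exact ((hk.smul_smooth (sX 0)).add (hg.neg.smul_smooth (sX 1))).congr
      (Eventually.of_forall fun x => by simp [perturbedFrame])
  have d3 : VanishesAt a (n + 1) fun x => Y 3 x - X 3 x := by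
    rw [h3]
    exact ((hh.neg.smul_smooth (sX 0)).add (hf.smul_smooth (sX 1))).congr
      (Eventually.of_forall fun x => by simp [perturbedFrame])
  have b01 := bracket_perturbed (sX 0) (sX 1) (sX 2) (sX 3) hf hg hh hk
  have b23 := bracket_perturbed (sX 2) (sX 3) (sX 0) (sX 1) hk hg.neg hh.neg hf
  have u : ∀ i, SmoothAt (fun x => coords Y x (VectorField.lieBracket ℝ (Y 0) (Y 1) x - Y 4 x) i)
      a := fun i => SmoothAt.coords sY hY.frameDet_ne (((sY 0).lieBracket (sY 1)).sub (sY 4)) i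
  have w : ∀ i, SmoothAt (fun x => coords Y x (VectorField.lieBracket ℝ (Y 2) (Y 3) x + Y 4 x) i)
      a := fun i => SmoothAt.coords sY hY.frameDet_ne (((sY 2).lieBracket (sY 3)).add (sY 4)) i
  have e1 := VanishesAt.coords sX hX.frameDet_ne
    ((b01.sub (VanishesAt.smooth_smul (u 0) d0)).sub (VanishesAt.smooth_smul (u 1) d1))
  have e2 := VanishesAt.coords sX hX.frameDet_ne
    (((VanishesAt.smooth_smul (w 2) d2).add (VanishesAt.smooth_smul (w 3) d3)).sub b23)
  have key1 : ∀ i : Fin 5, i = 2 ∨ i = 3 ∨ i = 4 → VanishesAt a (n + 1) fun x =>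
      coords X x (Y 4 x - X 4 x - ∑ i, R i x • X i x) i := by
    intro i hi
    refine (e1 i).congr ?_
    filter_upwards [hX.eventually, hY.eventually] with x hXx hYx
    obtain ⟨m2, m3, m4⟩ := hYx.mem_D1_iff.1 hYx.eventually'.self_of_nhds.2.2.1
    have eY := sum_coords hYx.frameDet_ne (VectorField.lieBracket ℝ (Y 0) (Y 1) x - Y 4 x)
    rw [Fin.sum_univ_five, m2, m3, m4] at eY
    obtain ⟨l2, l3, l4⟩ := hXx.mem_D1_iff.1 hXx.eventually'.self_of_nhds.2.2.1
    set u0 := coords Y x (VectorField.lieBracket ℝ (Y 0) (Y 1) x - Y 4 x) 0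
    set u1 := coords Y x (VectorField.lieBracket ℝ (Y 0) (Y 1) x - Y 4 x) 1
    have hli : coords X x (VectorField.lieBracket ℝ (X 0) (X 1) x - X 4 x) i = 0 := by
      rcases hi with rfl | rfl | rfl
      exacts [l2, l3, l4]
    have hx : ∀ c d : ℝ, coords X x (c • X 0 x + d • X 1 x) i = 0 := by
      intro c d
      rw [coords_add, coords_smul, coords_smul, coords_frame hXx.frameDet_ne,
        coords_frame hXx.frameDet_ne]
      rcases hi with rfl | rfl | rfl <;> simp
    have hdec : Y 4 x - X 4 x - ∑ i, R i x • X i x =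
        (VectorField.lieBracket ℝ (Y 0) (Y 1) x - VectorField.lieBracket ℝ (X 0) (X 1) x -
          (R 2 x • X 2 x + R 3 x • X 3 x) - u0 • (Y 0 x - X 0 x) - u1 • (Y 1 x - X 1 x)) +
        ((VectorField.lieBracket ℝ (X 0) (X 1) x - X 4 x) +
          ((-u0 - R 0 x) • X 0 x + (-u1 - R 1 x) • X 1 x)) := by
      have hR4 : R 4 x = 0 := rfl
      have e4 : Y 4 x = VectorField.lieBracket ℝ (Y 0) (Y 1) x - (u0 • Y 0 x + u1 • Y 1 x) := by
        rw [eq_sub_iff_add_eq, ← eq_sub_iff_add_eq', ← eY]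
        module
      rw [Fin.sum_univ_five, hR4, e4]
      module
    rw [hdec, coords_add, coords_add _ _, Pi.add_apply, Pi.add_apply, hli, hx, add_zero, add_zero,
      h0, h1]
    rfl
  have key2 : ∀ i : Fin 5, i = 0 ∨ i = 1 → VanishesAt a (n + 1) fun x =>
      coords X x (Y 4 x - X 4 x - ∑ i, R i x • X i x) i := by
    intro i hi
    refine (e2 i).congr ?_
    filter_upwards [hX.eventually, hY.eventually, hh.smooth, hg.smooth] with x hXx hYx hhx hgx
    obtain ⟨m0, m1, m4⟩ := hYx.mem_D2_iff.1 hYx.eventually'.self_of_nhds.2.2.2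
    have eY := sum_coords hYx.frameDet_ne (VectorField.lieBracket ℝ (Y 2) (Y 3) x + Y 4 x)
    rw [Fin.sum_univ_five, m0, m1, m4] at eY
    obtain ⟨l0, l1, l4⟩ := hXx.mem_D2_iff.1 hXx.eventually'.self_of_nhds.2.2.2
    set w2 := coords Y x (VectorField.lieBracket ℝ (Y 2) (Y 3) x + Y 4 x) 2
    set w3 := coords Y x (VectorField.lieBracket ℝ (Y 2) (Y 3) x + Y 4 x) 3
    have hli : coords X x (-(VectorField.lieBracket ℝ (X 2) (X 3) x + X 4 x)) i = 0 := by
      rw [coords_neg, Pi.neg_apply, neg_eq_zero]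
      rcases hi with rfl | rfl
      exacts [l0, l1]
    have hx : ∀ c d : ℝ, coords X x (c • X 2 x + d • X 3 x) i = 0 := by
      intro c d
      rw [coords_add, coords_smul, coords_smul, coords_frame hXx.frameDet_ne,
        coords_frame hXx.frameDet_ne]
      rcases hi with rfl | rfl <;> simp
    have hdec : Y 4 x - X 4 x - ∑ i, R i x • X i x =
        (w2 • (Y 2 x - X 2 x) + w3 • (Y 3 x - X 3 x) -
          (VectorField.lieBracket ℝ (Y 2) (Y 3) x - VectorField.lieBracket ℝ (X 2) (X 3) x -
            ((-R 0 x) • X 0 x + (-R 1 x) • X 1 x))) +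
        (-(VectorField.lieBracket ℝ (X 2) (X 3) x + X 4 x) +
          ((w2 - R 2 x) • X 2 x + (w3 - R 3 x) • X 3 x)) := by
      have hR4 : R 4 x = 0 := rfl
      have e4 : Y 4 x = (w2 • Y 2 x + w3 • Y 3 x) - VectorField.lieBracket ℝ (Y 2) (Y 3) x := by
        rw [eq_sub_iff_add_eq', ← eY]
        module
      rw [Fin.sum_univ_five, hR4, e4]
      module
    have r0 : -R 0 x = fderiv ℝ (fun y => -h y) x (X 2 x) - fderiv ℝ k x (X 3 x) := by
      rw [fderiv_fun_neg, neg_apply]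
      simp only [hR, leadingPart, Matrix.cons_val]
      ring
    have r1 : -R 1 x = fderiv ℝ f x (X 2 x) - fderiv ℝ (fun y => -g y) x (X 3 x) := by
      rw [fderiv_fun_neg, neg_apply]
      simp only [hR, leadingPart, Matrix.cons_val]
      ring
    rw [hdec, coords_add, coords_add _ _, Pi.add_apply, Pi.add_apply, hli, hx, add_zero, add_zero,
      r0, r1, h2, h3]
    rfl
  refine vanishesAt_of_coords sX hX.frameDet_ne fun i => ?_
  fin_cases i
  · exact key2 0 (by simp)
  · exact key2 1 (by simp)
  · exact key1 2 (by simp)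
  · exact key1 3 (by simp)
  · exact key1 4 (by simp)

/-- The leading part of the perturbation of the structure functions. -/
theorem perturbed_brk (hX : Adapted E X a) (hY : Adapted E' Y a) {R : Fin 5 → J1 → ℝ}
    (hR : ∀ i, VanishesAt a n (R i)) {j : Fin 5}
    (hj : VanishesAt a (n + 1) fun x => Y j x - X j x)
    (hYX : ∀ i, VanishesAt a n fun x => Y i x - X i x)
    (h4 : VanishesAt a (n + 1) fun x => Y 4 x - X 4 x - ∑ i, R i x • X i x) (i : Fin 5) :
    VanishesAt a n fun x => brk Y i j 4 x - (brk X i j 4 x + fderiv ℝ (R i) x (X j x)) := by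
  have sX := hX.smooth
  have sY := hY.smooth
  have hb := VanishesAt.lieBracket_sub (sX j) (sX 4) hj.pred (hYX 4)
  have h5 : VanishesAt a n fun x => fderiv ℝ (fun y => Y 4 y - X 4 y) x (X j x) -
      ∑ i, fderiv ℝ (R i) x (X j x) • X i x := by
    refine ((h4.fderiv_apply (sX j)).add (VanishesAt.sum (t := Finset.univ) (f := fun i x =>
      R i x • fderiv ℝ (X i) x (X j x))
      fun i _ => (hR i).smul_smooth ((sX i).fderiv_apply (sX j)))).congr ?_
    filter_upwards [eventually_all.2 sX, sY 4, eventually_all.2 fun i => (hR i).smooth]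
      with x e1 e2 e3
    have hd := fderiv_sum_smul (fun i => (e3 i).differentiableAt (by simp))
      (fun i => (e1 i).differentiableAt (by simp)) (X j x)
    rw [fderiv_fun_sub (f := fun y => Y 4 y - X 4 y) (g := fun y => ∑ i, R i y • X i y)
      ((e2.sub (e1 4)).differentiableAt (by simp))
      (ContDiffAt.differentiableAt (n := ∞) (ContDiffAt.sum fun i _ => (e3 i).smul (e1 i))
        (by simp)), sub_apply, hd, Finset.sum_add_distrib]
    abel
  have hc : ∀ i, SmoothAt (fun x => brk X i j 4 x + fderiv ℝ (R i) x (X j x)) a := fun i =>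
    (hX.smooth_brk i j 4).add ((hR i).smooth.fderiv_apply (sX j))
  have h6 := ((hb.add h5).sub (hj.fderiv_apply (sX 4))).sub
    (VanishesAt.sum (t := Finset.univ) fun i _ => VanishesAt.smooth_smul (hc i) (hYX i))
  -- The differences to be estimated are the coordinates in the frame Y of [Y_j, Y₅] - ∑ (b^i_{j5} +
  -- X_j(R_i)) Y_i, which vanishes to order `n` by `h6`.
  refine (VanishesAt.coords sY hY.frameDet_ne h6 i).congr ?_
  filter_upwards [hX.eventually, hY.eventually] with x hXx hYx
  have e1 : (fun y => X j y + (Y j y - X j y)) = Y j := funext fun y => by abel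
  have e2 : (fun y => X 4 y + (Y 4 y - X 4 y)) = Y 4 := funext fun y => by abel
  have e3 := sum_coords hXx.frameDet_ne (VectorField.lieBracket ℝ (X j) (X 4) x)
  simp only [← brk_eq_coords] at e3
  have e4 : VectorField.lieBracket ℝ (fun y => X j y + (Y j y - X j y))
        (fun y => X 4 y + (Y 4 y - X 4 y)) x - VectorField.lieBracket ℝ (X j) (X 4) x -
        (fderiv ℝ (fun y => Y 4 y - X 4 y) x (X j x) -
          fderiv ℝ (fun y => Y j y - X j y) x (X 4 x)) +
      (fderiv ℝ (fun y => Y 4 y - X 4 y) x (X j x) - ∑ i, fderiv ℝ (R i) x (X j x) • X i x) -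
      fderiv ℝ (fun y => Y j y - X j y) x (X 4 x) -
      ∑ i, (brk X i j 4 x + fderiv ℝ (R i) x (X j x)) • (Y i x - X i x) =
      VectorField.lieBracket ℝ (Y j) (Y 4) x -
        ∑ i, (brk X i j 4 x + fderiv ℝ (R i) x (X j x)) • Y i x := by
    rw [e1, e2, ← e3]
    simp only [smul_sub, Finset.sum_sub_distrib, add_smul, Finset.sum_add_distrib]
    abel
  rw [e4, coords_sub, coords_sum hYx.frameDet_ne]
  rfl

end Perturbation

/-! ### Polynomial perturbations -/

/-- The derivatives of `c` and `c'` at `a` of order at most `m` differ by less than `δ`. -/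
def CloseAt (a : J1) (m : ℕ) (δ : ℝ) (c c' : J1 → Fin 5 → ℝ) : Prop :=
  ∀ n ≤ m, ‖iteratedFDeriv ℝ n c' a - iteratedFDeriv ℝ n c a‖ < δ

theorem CloseAt.trans {a : J1} {m : ℕ} {δ ε : ℝ} {c c' c'' : J1 → Fin 5 → ℝ}
    (h : CloseAt a m δ c c') (h' : CloseAt a m ε c' c'') : CloseAt a m (δ + ε) c c'' := by
  intro n hn
  rw [← sub_add_sub_cancel _ (iteratedFDeriv ℝ n c' a)]
  exact (norm_add_le _ _).trans_lt (by linarith [h n hn, h' n hn])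

theorem eventually_closeAt {a : J1} {c A B : J1 → Fin 5 → ℝ} (hc : SmoothAt c a)
    (hA : SmoothAt A a) (hB : SmoothAt B a) (m : ℕ) {δ : ℝ} (hδ : 0 < δ) :
    ∀ᶠ t : ℝ in 𝓝 0, CloseAt a m δ c fun y => c y + (t • A y + t ^ 2 • B y) := by
  have h : ∀ n : ℕ, ∀ᶠ t : ℝ in 𝓝 0, ‖iteratedFDeriv ℝ n
      (fun y => c y + (t • A y + t ^ 2 • B y)) a - iteratedFDeriv ℝ n c a‖ < δ := by
    intro n
    have e : ∀ t : ℝ, iteratedFDeriv ℝ n (fun y => c y + (t • A y + t ^ 2 • B y)) a -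
        iteratedFDeriv ℝ n c a = t • iteratedFDeriv ℝ n A a + t ^ 2 • iteratedFDeriv ℝ n B a := by
      intro t
      have hn : (n : WithTop ℕ∞) ≤ ∞ := WithTop.coe_le_coe.2 le_top
      have c1 := hc.contDiffAt.of_le hn
      have c2 := hA.contDiffAt.of_le hn
      have c3 := hB.contDiffAt.of_le hn
      have e1 := iteratedFDeriv_add_apply (x := a) c1 ((c2.const_smul t).add (c3.const_smul (t ^ 2)))
      have e2 := iteratedFDeriv_add_apply (x := a) (c2.const_smul t) (c3.const_smul (t ^ 2))
      rw [iteratedFDeriv_const_smul_apply' c2, iteratedFDeriv_const_smul_apply' c3] at e2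
      exact (congrArg (· - iteratedFDeriv ℝ n c a)
        (e1.trans (congrArg (iteratedFDeriv ℝ n c a + ·) e2))).trans (add_sub_cancel_left _ _)
    have hcont : Continuous fun t : ℝ =>
        ‖t • iteratedFDeriv ℝ n A a + t ^ 2 • iteratedFDeriv ℝ n B a‖ := by fun_prop
    simp only [e]
    exact (hcont.tendsto 0).eventually_lt_const (by simpa using hδ)
  have := (Finset.range (m + 1)).eventually_all.2 fun n _ => h n
  filter_upwards [this] with t ht n hn using ht n (Finset.mem_range.2 (by omega))

/-- `φ` is homogeneous of degree `d`, does not depend on the coordinates `k`, `l`, and is of degree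
at most one in the coordinates `i`, `j`. -/
structure IsTame (i j k l : Fin 5) (d : ℕ) (φ : MvPolynomial (Fin 5) ℝ) : Prop where
  homogeneous : φ.IsHomogeneous d
  k_eq : MvPolynomial.pderiv k φ = 0
  l_eq : MvPolynomial.pderiv l φ = 0
  ii_eq : MvPolynomial.pderiv i (MvPolynomial.pderiv i φ) = 0
  ij_eq : MvPolynomial.pderiv i (MvPolynomial.pderiv j φ) = 0
  ji_eq : MvPolynomial.pderiv j (MvPolynomial.pderiv i φ) = 0
  jj_eq : MvPolynomial.pderiv j (MvPolynomial.pderiv j φ) = 0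

namespace IsTame

variable {i j k l : Fin 5} {d : ℕ} {φ ψ : MvPolynomial (Fin 5) ℝ}

theorem zero : IsTame i j k l d 0 := by
  refine ⟨MvPolynomial.isHomogeneous_zero _ _ _, ?_, ?_, ?_, ?_, ?_, ?_⟩ <;> simp

theorem const (c : ℝ) : IsTame i j k l 0 (MvPolynomial.C c) := by
  refine ⟨MvPolynomial.isHomogeneous_C _ _, ?_, ?_, ?_, ?_, ?_, ?_⟩ <;> simp

theorem add (hφ : IsTame i j k l d φ) (hψ : IsTame i j k l d ψ) : IsTame i j k l d (φ + ψ) := by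
  refine ⟨hφ.1.add hψ.1, ?_, ?_, ?_, ?_, ?_, ?_⟩ <;>
    simp [hφ.2, hφ.3, hφ.4, hφ.5, hφ.6, hφ.7, hψ.2, hψ.3, hψ.4, hψ.5, hψ.6, hψ.7]

theorem C_mul (c : ℝ) (hφ : IsTame i j k l d φ) : IsTame i j k l d (MvPolynomial.C c * φ) := by
  refine ⟨by simpa using (MvPolynomial.isHomogeneous_C _ c).mul hφ.1, ?_, ?_, ?_, ?_, ?_, ?_⟩ <;>
    simp [hφ.2, hφ.3, hφ.4, hφ.5, hφ.6, hφ.7]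

end IsTame

open MvPolynomial in
/-- The four polynomials which determine a perturbation with prescribed leading parts `p`, `q` of
the mixed structure functions. -/
def perturbPoly (p q : Fin 2 → Fin 2 → MvPolynomial (Fin 5) ℝ) :
    Fin 4 → MvPolynomial (Fin 5) ℝ :=
  ![C (-1 / 2) * (X 2 * X 2 * p 1 0 + X 1 * X 1 * q 0 1), C (-1 / 2) * (X 3 * X 3 * p 1 1 + X 1 * X 1 * q 1 1),
    C (1 / 2) * (X 2 * X 2 * p 0 0 + X 0 * X 0 * q 0 0), C (1 / 2) * (X 3 * X 3 * p 0 1 + X 0 * X 0 * q 1 0)]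

open MvPolynomial in
theorem perturbPoly_homogeneous {d : ℕ} {p q : Fin 2 → Fin 2 → MvPolynomial (Fin 5) ℝ}
    (hp : ∀ i j, (p i j).IsHomogeneous d) (hq : ∀ i j, (q i j).IsHomogeneous d) (i : Fin 4) :
    (perturbPoly p q i).IsHomogeneous (d + 2) := by
  have key : ∀ (c : ℝ) (k l : Fin 5) (φ ψ : MvPolynomial (Fin 5) ℝ), φ.IsHomogeneous d →
      ψ.IsHomogeneous d → (C c * (X k * X k * φ + X l * X l * ψ)).IsHomogeneous (d + 2) := by
    intro c k l φ ψ hφ hψ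
    have hX : ∀ k : Fin 5, (X k * X k : MvPolynomial (Fin 5) ℝ).IsHomogeneous 2 := fun k => by
      exact (isHomogeneous_X ℝ k).mul (isHomogeneous_X ℝ k)
    have := (isHomogeneous_C (Fin 5) c).mul (((hX k).mul hφ).add ((hX l).mul hψ))
    rwa [zero_add, add_comm 2 d] at this
  fin_cases i
  · exact key _ _ _ _ _ (hp _ _) (hq _ _)
  · exact key _ _ _ _ _ (hp _ _) (hq _ _)
  · exact key _ _ _ _ _ (hp _ _) (hq _ _)
  · exact key _ _ _ _ _ (hp _ _) (hq _ _)

open MvPolynomial in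
/-- The symbol of `leadingPart`. -/
def leadingPoly (F : Fin 4 → MvPolynomial (Fin 5) ℝ) : Fin 5 → MvPolynomial (Fin 5) ℝ :=
  ![pderiv 2 (F 2) + pderiv 3 (F 3), -(pderiv 2 (F 0) + pderiv 3 (F 1)),
    pderiv 0 (F 2) - pderiv 1 (F 0), pderiv 0 (F 3) - pderiv 1 (F 1), 0]

-- The squares in `perturbPoly` invert second derivatives: ∂₂∂₂ of x₂² φ / 2 is φ if φ does not
-- depend on x₂. Tameness removes everything else: the `p` terms are independent of x₂, x₃ and the
-- `q` terms have degree at most one in them, and symmetrically with x₀, x₁.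
open MvPolynomial in
theorem pderiv_leadingPoly {d : ℕ} {p q : Fin 2 → Fin 2 → MvPolynomial (Fin 5) ℝ}
    (hp : ∀ i j, IsTame 0 1 2 3 d (p i j)) (hq : ∀ i j, IsTame 2 3 0 1 d (q i j)) :
    (∀ i j, pderiv (![2, 3] j) (leadingPoly (perturbPoly p q) (![0, 1] i)) = p i j) ∧
    (∀ i j, pderiv (![0, 1] j) (leadingPoly (perturbPoly p q) (![2, 3] i)) = q i j) := by
  have hX : ∀ i j : Fin 5, i ≠ j → pderiv i (X j : MvPolynomial (Fin 5) ℝ) = 0 :=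
    fun i j h => pderiv_X_of_ne h.symm
  have half : (C (1 / 2 : ℝ) : MvPolynomial (Fin 5) ℝ) * 2 = 1 := by
    rw [show (2 : MvPolynomial (Fin 5) ℝ) = C 2 from rfl, ← C_mul]; norm_num
  have nhalf : (C (-1 / 2 : ℝ) : MvPolynomial (Fin 5) ℝ) * 2 = -1 := by
    rw [show (2 : MvPolynomial (Fin 5) ℝ) = C 2 from rfl, ← C_mul]; norm_num
  have h0 : ∀ i : Fin 5, pderiv i (0 : MvPolynomial (Fin 5) ℝ) = 0 := fun i => map_zero _
  have p2 := fun i j => (hp i j).k_eq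
  have p3 := fun i j => (hp i j).l_eq
  have p00 := fun i j => (hp i j).ii_eq
  have p01 := fun i j => (hp i j).ij_eq
  have p10 := fun i j => (hp i j).ji_eq
  have p11 := fun i j => (hp i j).jj_eq
  have q0 := fun i j => (hq i j).k_eq
  have q1 := fun i j => (hq i j).l_eq
  have q22 := fun i j => (hq i j).ii_eq
  have q23 := fun i j => (hq i j).ij_eq
  have q32 := fun i j => (hq i j).ji_eq
  have q33 := fun i j => (hq i j).jj_eq
  constructor
  · simp only [Fin.forall_fin_two]
    refine ⟨⟨?_, ?_⟩, ?_, ?_⟩ <;>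
      simp only [leadingPoly, perturbPoly, Matrix.cons_val, pderiv_C, map_add, map_neg,
        pderiv_mul, pderiv_X_self, hX, p2, p3, q22, q23, q32, q33, ne_eq,
        Fin.reduceEq, not_false_eq_true, pderiv_one, h0]
    · linear_combination (p 0 0) * half
    · linear_combination (p 0 1) * half
    · linear_combination -(p 1 0) * nhalf
    · linear_combination -(p 1 1) * nhalf
  · simp only [Fin.forall_fin_two]
    refine ⟨⟨?_, ?_⟩, ?_, ?_⟩ <;>
      simp only [leadingPoly, perturbPoly, Matrix.cons_val, pderiv_C, map_add, map_sub,
        pderiv_mul, pderiv_X_self, hX, q0, q1, p00, p01, p10, p11, ne_eq,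
        Fin.reduceEq, not_false_eq_true, pderiv_one, h0]
    · linear_combination (q 0 0) * half
    · linear_combination -(q 0 1) * nhalf
    · linear_combination (q 1 0) * half
    · linear_combination -(q 1 1) * nhalf

section

variable {E E' : HypEq} {X Y : Fin 5 → J1 → J1} {a : J1} {d : ℕ}

/-- To leading order the frame fields act as partial derivatives in the dual coordinates. -/
theorem leadingPart_sub_leadingPoly (hX : ∀ i, SmoothAt (X i) a) (h0 : frameDet X a ≠ 0)
    {F : Fin 4 → MvPolynomial (Fin 5) ℝ} (hF : ∀ i, (F i).IsHomogeneous (d + 2)) (i : Fin 5) :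
    VanishesAt a (d + 2) fun x => leadingPart X (polyFun X a (F 0)) (polyFun X a (F 1))
      (polyFun X a (F 2)) (polyFun X a (F 3)) i x - polyFun X a (leadingPoly F i) x := by
  have h := fun (k : Fin 4) (j : Fin 5) => fderiv_polyFun_frame hX h0 (n := d + 1) (hF k) j
  fin_cases i
  · refine ((h 2 2).add (h 3 3)).congr (Eventually.of_forall fun x => ?_)
    simp [leadingPart, leadingPoly, polyFun_add]
    ring
  · refine ((h 0 2).add (h 1 3)).neg.congr (Eventually.of_forall fun x => ?_)
    simp [leadingPart, leadingPoly, polyFun_add, polyFun_neg]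
    ring
  · refine ((h 2 0).sub (h 0 1)).congr (Eventually.of_forall fun x => ?_)
    simp [leadingPart, leadingPoly, polyFun_sub]
    ring
  · refine ((h 3 0).sub (h 1 1)).congr (Eventually.of_forall fun x => ?_)
    simp [leadingPart, leadingPoly, polyFun_sub]
    ring
  · refine VanishesAt.zero.congr (Eventually.of_forall fun x => ?_)
    simp [leadingPart, leadingPoly, polyFun_zero]

theorem leadingPoly_homogeneous {F : Fin 4 → MvPolynomial (Fin 5) ℝ}
    (hF : ∀ i, (F i).IsHomogeneous (d + 2)) (i : Fin 5) :
    (leadingPoly F i).IsHomogeneous (d + 1) := by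
  have h := fun (k : Fin 4) (j : Fin 5) => (hF k).pderiv (i := j)
  fin_cases i
  · exact (h 2 2).add (h 3 3)
  · exact ((h 0 2).add (h 1 3)).neg
  · exact (h 2 0).sub (h 0 1)
  · exact (h 3 0).sub (h 1 1)
  · exact MvPolynomial.isHomogeneous_zero _ _ _

/-- Perturbation of an equation by homogeneous polynomials. -/
theorem exists_perturbed_poly (hX : Normalized E X a) {F : Fin 4 → MvPolynomial (Fin 5) ℝ}
    (hF : ∀ i, (F i).IsHomogeneous (d + 2)) :
    ∃ (E' : HypEq) (Y : Fin 5 → J1 → J1), Normalized E' Y a ∧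
      (E'.coeff = fun y => pluck
        (X 0 y + (polyFun X a (F 0) y • X 2 y + polyFun X a (F 1) y • X 3 y))
        (X 1 y + (polyFun X a (F 2) y • X 2 y + polyFun X a (F 3) y • X 3 y))) ∧
      (∀ i, VanishesAt a (d + 1) fun x => Y i x - X i x) ∧
      ∀ i j, j ≠ 4 → VanishesAt a (d + 1) fun x => brk Y i j 4 x -
        (brk X i j 4 x + polyFun X a (MvPolynomial.pderiv j (leadingPoly F i)) x) := by
  have sX := hX.smooth
  have vF : ∀ i, VanishesAt a (d + 2) (polyFun X a (F i)) := fun i => polyFun_vanishesAt (hF i)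
  obtain ⟨E', W, hY, hc⟩ := exists_perturbed hX (vF 0).smooth (vF 1).smooth (vF 2).smooth
    (vF 3).smooth (vF 0).self (vF 1).self
  set f := polyFun X a (F 0)
  set g := polyFun X a (F 1)
  set h := polyFun X a (F 2)
  set k := polyFun X a (F 3)
  set Y : Fin 5 → J1 → J1 := ![perturbedFrame X f g h k 0, perturbedFrame X f g h k 1,
        perturbedFrame X f g h k 2, perturbedFrame X f g h k 3, W] with hYdef
  have hR := leadingPart_vanishesAt sX (vF 0) (vF 1) (vF 2) (vF 3)
  have h4 := perturbed_frame4 hX.toAdapted hY.toAdapted (vF 0) (vF 1) (vF 2) (vF 3) rfl rfl rfl rfl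
  have hj : ∀ j : Fin 5, j ≠ 4 → VanishesAt a (d + 2) fun x => Y j x - X j x := by
    intro j hj4
    fin_cases j
    · exact (((vF 0).smul_smooth (sX 2)).add ((vF 1).smul_smooth (sX 3))).congr
        (Eventually.of_forall fun x => by simp [hYdef, perturbedFrame]; rfl)
    · exact (((vF 2).smul_smooth (sX 2)).add ((vF 3).smul_smooth (sX 3))).congr
        (Eventually.of_forall fun x => by simp [hYdef, perturbedFrame]; rfl)
    · exact (((vF 3).smul_smooth (sX 0)).add ((vF 1).neg.smul_smooth (sX 1))).congr
        (Eventually.of_forall fun x => by simp [hYdef, perturbedFrame]; rfl)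
    · exact (((vF 2).neg.smul_smooth (sX 0)).add ((vF 0).smul_smooth (sX 1))).congr
        (Eventually.of_forall fun x => by simp [hYdef, perturbedFrame]; rfl)
    · exact absurd rfl hj4
  have hYX : ∀ i, VanishesAt a (d + 1) fun x => Y i x - X i x := by
    intro i
    by_cases hi : i = 4
    · subst hi
      refine (h4.pred.add (VanishesAt.sum_smul hR sX)).congr (Eventually.of_forall fun x => ?_)
      exact (sub_add_cancel _ _).symm
    · exact (hj i hi).pred
  refine ⟨E', Y, hY, hc, hYX, fun i j hj4 => ?_⟩
  have h1 := perturbed_brk hX.toAdapted hY.toAdapted hR (hj j hj4) hYX h4 i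
  have hL := leadingPart_sub_leadingPoly sX hX.frameDet_ne hF i
  have h2 := hL.fderiv_apply (sX j)
  have h3 := fderiv_polyFun_frame sX hX.frameDet_ne (leadingPoly_homogeneous hF i) j
  refine ((h1.add h2).add h3).congr ?_
  filter_upwards [(hR i).smooth] with x hx
  rw [fderiv_fun_sub (hx.differentiableAt (by simp)) (polyFun_hasFDerivAt _ x).differentiableAt,
    sub_apply]
  ring

theorem perturbPoly_smul (t : ℝ) (p q : Fin 2 → Fin 2 → MvPolynomial (Fin 5) ℝ) (i : Fin 4) :
    perturbPoly (fun i j => MvPolynomial.C t * p i j) (fun i j => MvPolynomial.C t * q i j) i =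
      MvPolynomial.C t * perturbPoly p q i := by
  fin_cases i <;> simp only [perturbPoly, Matrix.cons_val, Fin.zero_eta, Fin.mk_one,
    Fin.reduceFinMk] <;> ring

/-- Small perturbations with prescribed leading parts of the mixed structure functions. -/
theorem eventually_exists_perturbed (hX : Normalized E X a)
    {p q : Fin 2 → Fin 2 → MvPolynomial (Fin 5) ℝ} (hp : ∀ i j, IsTame 0 1 2 3 d (p i j))
    (hq : ∀ i j, IsTame 2 3 0 1 d (q i j)) (m : ℕ) {δ : ℝ} (hδ : 0 < δ) :
    ∀ᶠ t : ℝ in 𝓝 0, ∃ (E' : HypEq) (Y : Fin 5 → J1 → J1), Normalized E' Y a ∧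
      CloseAt a m δ E.coeff E'.coeff ∧
      (∀ i, VanishesAt a (d + 1) fun x => Y i x - X i x) ∧
      (∀ i j, VanishesAt a (d + 1) fun x => brk Y (![0, 1] i) (![2, 3] j) 4 x -
        (brk X (![0, 1] i) (![2, 3] j) 4 x + t * polyFun X a (p i j) x)) ∧
      (∀ i j, VanishesAt a (d + 1) fun x => brk Y (![2, 3] i) (![0, 1] j) 4 x -
        (brk X (![2, 3] i) (![0, 1] j) 4 x + t * polyFun X a (q i j) x)) ∧
      VanishesAt a d fun x => brkTrace Y x - brkTrace X x := by
  have sX := hX.smooth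
  set F := perturbPoly p q with hFdef
  have hs : ∀ i, SmoothAt (polyFun X a (F i)) a := fun i => polyFun_smooth _
  have pl := fun i j => (sX i).pluck (sX j)
  -- With all four polynomials scaled by t, `pluck_expand` makes the new coefficients quadratic in t
  -- with the old ones at t = 0, so closeness of the derivatives at `a` is continuity in t.
  have hcl := eventually_closeAt (pl 0 1)
    (((((hs 2).smul (pl 0 2)).add ((hs 3).smul (pl 0 3))).sub ((hs 0).smul (pl 1 2))).sub
      ((hs 1).smul (pl 1 3)))
    ((((hs 0).mul (hs 3)).sub ((hs 1).mul (hs 2))).smul (pl 2 3)) m hδ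
  filter_upwards [hcl] with t ht
  have hp' : ∀ i j, IsTame 0 1 2 3 d (MvPolynomial.C t * p i j) := fun i j => (hp i j).C_mul t
  have hq' : ∀ i j, IsTame 2 3 0 1 d (MvPolynomial.C t * q i j) := fun i j => (hq i j).C_mul t
  have hF := perturbPoly_homogeneous (fun i j => (hp' i j).1) (fun i j => (hq' i j).1)
  obtain ⟨E', Y, hY, hc, hYX, hb⟩ := exists_perturbed_poly hX hF
  obtain ⟨l1, l2⟩ := pderiv_leadingPoly hp' hq'
  refine ⟨E', Y, hY, fun n hn => ?_, hYX, fun i j => ?_, fun i j => ?_, ?_⟩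
  · have e1 : iteratedFDeriv ℝ n E.coeff a =
        iteratedFDeriv ℝ n (fun y => pluck (X 0 y) (X 1 y)) a :=
      (EventuallyEq.iteratedFDeriv ℝ (hX.coeff_eq.mono fun y hy => hy.1) n).self_of_nhds
    have e2 : E'.coeff = fun y => pluck (X 0 y) (X 1 y) +
        (t • (polyFun X a (F 2) y • pluck (X 0 y) (X 2 y) +
            polyFun X a (F 3) y • pluck (X 0 y) (X 3 y) -
            polyFun X a (F 0) y • pluck (X 1 y) (X 2 y) -
            polyFun X a (F 1) y • pluck (X 1 y) (X 3 y)) +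
          t ^ 2 • (polyFun X a (F 0) y * polyFun X a (F 3) y -
            polyFun X a (F 1) y * polyFun X a (F 2) y) • pluck (X 2 y) (X 3 y)) := by
      rw [hc]
      funext y
      simp only [perturbPoly_smul, polyFun_mul, polyFun_C]
      rw [pluck_expand, add_assoc, hFdef]
      congr 2
      · module
      · module
    rw [e1, e2]
    exact ht n hn
  · have := hb (![0, 1] i) (![2, 3] j) (by fin_cases j <;> decide)
    rw [l1] at this
    simpa only [polyFun_mul, polyFun_C] using this
  · have := hb (![2, 3] i) (![0, 1] j) (by fin_cases j <;> decide)
    rw [l2] at this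
    simpa only [polyFun_mul, polyFun_C] using this
  -- The diagonal structure functions are not prescribed; their change is a polynomial of degree `d`
  -- plus a remainder of higher order, so only order `d` is claimed.
  · have key : ∀ i : Fin 5, i ≠ 4 → VanishesAt a d fun x => brk Y i i 4 x - brk X i i 4 x := by
      intro i hi
      refine ((hb i i hi).pred.add (polyFun_vanishesAt (X := X) (a := a)
        ((leadingPoly_homogeneous hF i).pderiv (i := i)))).congr (Eventually.of_forall fun x => ?_)
      ring
    refine ((((key 0 (by decide)).add (key 1 (by decide))).add (key 2 (by decide))).add
      (key 3 (by decide))).congr (Eventually.of_forall fun x => ?_)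
    simp only [brkTrace]
    ring

end

/-! ### Genericity in one-parameter families -/

/-- A polynomial function of `t` with non-zero leading coefficient has no zeros near `0` except
possibly `0`. -/
theorem eventually_ne_zero_of_leading {f G : ℝ → ℝ} (n : ℕ) (hf : ∀ t, AnalyticAt ℝ f t)
    (hG : Continuous G) (h : ∀ s, s ≠ 0 → f s⁻¹ * s ^ n = G s) (h0 : G 0 ≠ 0) :
    ∀ᶠ t in 𝓝[≠] 0, f t ≠ 0 := by
  refine (hf 0).eventually_eq_zero_or_eventually_ne_zero.resolve_left fun hz => h0 ?_
  -- By the identity theorem, zeros accumulating at 0 make `f` vanish identically. Then `G` vanishes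
  -- off 0, and by continuity so does its value at 0, the leading coefficient.
  have hf0 : ∀ t, f t = 0 := fun t =>
    AnalyticOnNhd.eqOn_zero_of_preconnected_of_eventuallyEq_zero (U := univ) (fun t _ => hf t)
      isPreconnected_univ (mem_univ 0) hz (mem_univ t)
  have hG0 : ∀ᶠ s in 𝓝[≠] (0 : ℝ), G s = 0 := by
    filter_upwards [self_mem_nhdsWithin] with s hs
    rw [← h s hs, hf0, zero_mul]
  exact tendsto_nhds_unique ((hG.tendsto 0).mono_left nhdsWithin_le_nhds)
    (tendsto_const_nhds.congr' (hG0.mono fun _ hs => hs.symm))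

/-- The determinant is a polynomial in t. Its coefficient of t³ is the upper left minor times `c * d
* e`, since the added entries occupy the last three rows and, up to an even permutation, the
diagonal of the complementary block. -/
theorem eventually_det_ne_zero {B : Matrix (Fin 5) (Fin 5) ℝ}
    (h : B 0 0 * B 1 1 - B 0 1 * B 1 0 ≠ 0) {c d e : ℝ} (hc : c ≠ 0) (hd : d ≠ 0) (he : e ≠ 0) :
    ∀ᶠ t : ℝ in 𝓝[≠] 0, (B + t • (!![0, 0, 0, 0, 0; 0, 0, 0, 0, 0; 0, 0, 0, 0, c; 0, 0, d, 0, 0;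
      0, 0, 0, e, 0] : Matrix (Fin 5) (Fin 5) ℝ)).det ≠ 0 := by
  set A : Matrix (Fin 5) (Fin 5) ℝ := !![0, 0, 0, 0, 0; 0, 0, 0, 0, 0; 0, 0, 0, 0, c;
    0, 0, d, 0, 0; 0, 0, 0, e, 0] with hA
  set W : ℝ → Matrix (Fin 5) (Fin 5) ℝ := fun s => Matrix.diagonal ![1, 1, s, s, s] * B + A with hW
  have hWc : Continuous W := by
    have hD : Continuous fun s : ℝ => (![1, 1, s, s, s] : Fin 5 → ℝ) := by
      refine continuous_pi fun i => ?_
      fin_cases i <;> simp <;> fun_prop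
    have hDB : Continuous fun s : ℝ => Matrix.diagonal (![1, 1, s, s, s] : Fin 5 → ℝ) * B :=
      hD.matrix_diagonal.matrix_mul continuous_const
    exact hDB.add continuous_const
  refine eventually_ne_zero_of_leading (G := fun s => (W s).det) 3 (fun t => ?_) hWc.matrix_det
    (fun s hs => ?_) ?_
  · simp only [Matrix.det_apply', Matrix.add_apply, Matrix.smul_apply, smul_eq_mul]
    refine Finset.analyticAt_fun_sum _ fun σ _ => analyticAt_const.mul ?_
    exact Finset.analyticAt_fun_prod _ fun i _ => by fun_prop
  · have e1 : W s = Matrix.diagonal ![1, 1, s, s, s] * (B + s⁻¹ • A) := by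
      have e2 : Matrix.diagonal ![1, 1, s, s, s] * s⁻¹ • A = A := by
        ext i j
        rw [Matrix.diagonal_mul, Matrix.smul_apply, smul_eq_mul]
        fin_cases i <;> fin_cases j <;> simp [hA, hs]
      rw [mul_add, e2]
    rw [e1, Matrix.det_mul, Matrix.det_diagonal, mul_comm]
    congr 1
    simp [Fin.prod_univ_five]
    ring
  · have e1 : W 0 = !![B 0 0, B 0 1, B 0 2, B 0 3, B 0 4; B 1 0, B 1 1, B 1 2, B 1 3, B 1 4;
        0, 0, 0, 0, c; 0, 0, d, 0, 0; 0, 0, 0, e, 0] := by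
      ext i j
      simp only [hW, Matrix.add_apply, Matrix.diagonal_mul]
      fin_cases i <;> fin_cases j <;> simp [hA]
    have e0 : (W 0).det = (B 0 0 * B 1 1 - B 0 1 * B 1 0) * c * d * e := by
      rw [e1]
      simp [Matrix.det_succ_row_zero, Fin.sum_univ_succ, Fin.succAbove]
      ring
    simp only [e0]
    exact mul_ne_zero (mul_ne_zero (mul_ne_zero h hc) hd) he

/-! ### Perturbation of the relative invariants -/

section

variable {E : HypEq} {X : Fin 5 → J1 → J1} {a : J1} {d : ℕ}

/-- The product of the two perturbations has order 2d, and `1 ≤ d` puts it among the neglected terms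
of order d + 1; freezing `u₀` and `v₀` at `a` gains one order as well. -/
theorem VanishesAt.mul_expand {u v u₀ v₀ α β : J1 → ℝ} (hd : 1 ≤ d)
    (hu : VanishesAt a (d + 1) fun x => u x - (u₀ x + α x))
    (hv : VanishesAt a (d + 1) fun x => v x - (v₀ x + β x)) (hα : VanishesAt a d α)
    (hβ : VanishesAt a d β) (su : SmoothAt u₀ a) (sv' : SmoothAt v a) (sv : SmoothAt v₀ a) :
    VanishesAt a (d + 1) fun x =>
      u x * v x - (u₀ x * v₀ x + (u₀ a * β x + v₀ a * α x)) := by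
  have h1 := hu.mul_smooth sv'
  have h2 := VanishesAt.smooth_mul (su.add hα.smooth) hv
  have hz : ∀ {w : J1 → ℝ}, SmoothAt w a → VanishesAt a 1 fun x => w x - w a := fun hw =>
    .of_smooth_of_eq_zero (hw.sub (.const _)) (sub_self _)
  have h3 := hβ.mul (hz su)
  have h4 := hα.mul (hz sv)
  have h5 := (hα.mul hβ).mono (by omega : d + 1 ≤ d + d)
  refine ((((h1.add h2).add h3).add h4).add h5).congr (Eventually.of_forall fun x => ?_)
  ring

open MvPolynomial in
/-- Small perturbations with prescribed leading parts of the relative invariants. -/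
theorem eventually_exists_perturbed_Lam (hX : Normalized E X a) (hd : 1 ≤ d)
    {α₁ α β₂ β : MvPolynomial (Fin 5) ℝ} (hα₁ : IsTame 0 1 2 3 d α₁) (hα : IsTame 0 1 2 3 d α)
    (hβ₂ : IsTame 2 3 0 1 d β₂) (hβ : IsTame 2 3 0 1 d β)
    (hΘ : Lam12 X a ^ 2 - 4 * Lam1 X a * Lam2 X a ≠ 0) (m : ℕ) {δ : ℝ} (hδ : 0 < δ) :
    ∀ᶠ t : ℝ in 𝓝 0, ∃ (E' : HypEq) (Y : Fin 5 → J1 → J1), Normalized E' Y a ∧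
      CloseAt a m δ E.coeff E'.coeff ∧
      (∀ i, VanishesAt a (d + 1) fun x => Y i x - X i x) ∧
      (VanishesAt a d fun x => brkTrace Y x - brkTrace X x) ∧
      (VanishesAt a (d + 1) fun x => Lam1 Y x - (Lam1 X x + t * polyFun X a α₁ x)) ∧
      (VanishesAt a (d + 1) fun x => Lam2 Y x - (Lam2 X x + t * polyFun X a β₂ x)) ∧
      VanishesAt a (d + 1) fun x => Lam12 Y x - (Lam12 X x + t * polyFun X a (α + β) x) := by
  set Θ := Lam12 X a ^ 2 - 4 * Lam1 X a * Lam2 X a with hΘd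
  set P : Fin 2 → Fin 2 → ℝ := fun i j => brk X (![0, 1] i) (![2, 3] j) 4 a with hP
  set Q : Fin 2 → Fin 2 → ℝ := fun i j => brk X (![2, 3] i) (![0, 1] j) 4 a with hQ
  have L1 : Lam1 X a = P 1 0 * P 0 1 - P 0 0 * P 1 1 := rfl
  have L2 : Lam2 X a = Q 1 0 * Q 0 1 - Q 0 0 * Q 1 1 := rfl
  have L12 : Lam12 X a = Q 0 0 * P 0 0 + Q 1 0 * P 0 1 + Q 0 1 * P 1 0 + Q 1 1 * P 1 1 := rfl
  -- The changes are sought as δP = ξ P + η adj(Q) and δQ = ζ Q + κ adj(P). To first order they give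
  -- δΛ₁ = 2Λ₁ξ - Λ₁₂η, δΛ₂ = 2Λ₂ζ - Λ₁₂κ and δΛ₁₂ = (Λ₁₂ξ - 2Λ₂η) + (Λ₁₂ζ - 2Λ₁κ). Each pair is a
  -- linear system of determinant Θ; α and β are the parts of δΛ₁₂ due to P and to Q.
  set ξ : MvPolynomial (Fin 5) ℝ :=
    C Θ⁻¹ * (C (-2 * Lam2 X a) * α₁ + C (Lam12 X a) * α) with hξ
  set η : MvPolynomial (Fin 5) ℝ :=
    C Θ⁻¹ * (C (-Lam12 X a) * α₁ + C (2 * Lam1 X a) * α) with hη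
  set ζ : MvPolynomial (Fin 5) ℝ :=
    C Θ⁻¹ * (C (-2 * Lam1 X a) * β₂ + C (Lam12 X a) * β) with hζ
  set κ : MvPolynomial (Fin 5) ℝ :=
    C Θ⁻¹ * (C (-Lam12 X a) * β₂ + C (2 * Lam2 X a) * β) with hκ
  set p : Fin 2 → Fin 2 → MvPolynomial (Fin 5) ℝ := fun i j =>
    C (P i j) * ξ + C (!![Q 1 1, -Q 0 1; -Q 1 0, Q 0 0] i j) * η with hp
  set q : Fin 2 → Fin 2 → MvPolynomial (Fin 5) ℝ := fun i j =>
    C (Q i j) * ζ + C (!![P 1 1, -P 0 1; -P 1 0, P 0 0] i j) * κ with hq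
  have tξ : IsTame 0 1 2 3 d ξ := ((hα₁.C_mul _).add (hα.C_mul _)).C_mul _
  have tη : IsTame 0 1 2 3 d η := ((hα₁.C_mul _).add (hα.C_mul _)).C_mul _
  have tζ : IsTame 2 3 0 1 d ζ := ((hβ₂.C_mul _).add (hβ.C_mul _)).C_mul _
  have tκ : IsTame 2 3 0 1 d κ := ((hβ₂.C_mul _).add (hβ.C_mul _)).C_mul _
  have tp : ∀ i j, IsTame 0 1 2 3 d (p i j) := fun i j => (tξ.C_mul _).add (tη.C_mul _)
  have tq : ∀ i j, IsTame 2 3 0 1 d (q i j) := fun i j => (tζ.C_mul _).add (tκ.C_mul _)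
  filter_upwards [eventually_exists_perturbed hX tp tq m hδ] with t ⟨E', Y, hY, hc, hYX, hbp, hbq, ht⟩
  have vp : ∀ i j, VanishesAt a d fun x => t * polyFun X a (p i j) x := fun i j =>
    (polyFun_vanishesAt (tp i j).1).const_mul t
  have vq : ∀ i j, VanishesAt a d fun x => t * polyFun X a (q i j) x := fun i j =>
    (polyFun_vanishesAt (tq i j).1).const_mul t
  have sX := fun i j => hX.smooth_brk i j 4
  have sY := fun i j => hY.smooth_brk i j 4
  have pp := fun i j k l => VanishesAt.mul_expand hd (hbp i j) (hbp k l) (vp i j) (vp k l)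
    (sX _ _) (sY _ _) (sX _ _)
  have qq := fun i j k l => VanishesAt.mul_expand hd (hbq i j) (hbq k l) (vq i j) (vq k l)
    (sX _ _) (sY _ _) (sX _ _)
  have qp := fun i j k l => VanishesAt.mul_expand hd (hbq i j) (hbp k l) (vq i j) (vp k l)
    (sX _ _) (sY _ _) (sX _ _)
  have ep : ∀ i j x, polyFun X a (p i j) x = P i j * polyFun X a ξ x +
      !![Q 1 1, -Q 0 1; -Q 1 0, Q 0 0] i j * polyFun X a η x := fun i j x => by
    simp only [hp, polyFun_add, polyFun_mul, polyFun_C]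
  have eq : ∀ i j x, polyFun X a (q i j) x = Q i j * polyFun X a ζ x +
      !![P 1 1, -P 0 1; -P 1 0, P 0 0] i j * polyFun X a κ x := fun i j x => by
    simp only [hq, polyFun_add, polyFun_mul, polyFun_C]
  have eξ : ∀ x, Θ * polyFun X a ξ x = -2 * Lam2 X a * polyFun X a α₁ x +
      Lam12 X a * polyFun X a α x := fun x => by
    simp only [hξ, polyFun_add, polyFun_mul, polyFun_C, mul_inv_cancel_left₀ hΘ]
  have eη : ∀ x, Θ * polyFun X a η x = -Lam12 X a * polyFun X a α₁ x +
      2 * Lam1 X a * polyFun X a α x := fun x => by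
    simp only [hη, polyFun_add, polyFun_mul, polyFun_C, mul_inv_cancel_left₀ hΘ]
  have eζ : ∀ x, Θ * polyFun X a ζ x = -2 * Lam1 X a * polyFun X a β₂ x +
      Lam12 X a * polyFun X a β x := fun x => by
    simp only [hζ, polyFun_add, polyFun_mul, polyFun_C, mul_inv_cancel_left₀ hΘ]
  have eκ : ∀ x, Θ * polyFun X a κ x = -Lam12 X a * polyFun X a β₂ x +
      2 * Lam2 X a * polyFun X a β x := fun x => by
    simp only [hκ, polyFun_add, polyFun_mul, polyFun_C, mul_inv_cancel_left₀ hΘ]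
  have s1 : ∀ x, 2 * Lam1 X a * polyFun X a ξ x - Lam12 X a * polyFun X a η x =
      polyFun X a α₁ x := fun x => mul_left_cancel₀ hΘ (by
    linear_combination 2 * Lam1 X a * eξ x - Lam12 X a * eη x - polyFun X a α₁ x * hΘd)
  have s2 : ∀ x, Lam12 X a * polyFun X a ξ x - 2 * Lam2 X a * polyFun X a η x =
      polyFun X a α x := fun x => mul_left_cancel₀ hΘ (by
    linear_combination Lam12 X a * eξ x - 2 * Lam2 X a * eη x - polyFun X a α x * hΘd)
  have s3 : ∀ x, 2 * Lam2 X a * polyFun X a ζ x - Lam12 X a * polyFun X a κ x =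
      polyFun X a β₂ x := fun x => mul_left_cancel₀ hΘ (by
    linear_combination 2 * Lam2 X a * eζ x - Lam12 X a * eκ x - polyFun X a β₂ x * hΘd)
  have s4 : ∀ x, Lam12 X a * polyFun X a ζ x - 2 * Lam1 X a * polyFun X a κ x =
      polyFun X a β x := fun x => mul_left_cancel₀ hΘ (by
    linear_combination Lam12 X a * eζ x - 2 * Lam1 X a * eκ x - polyFun X a β x * hΘd)
  refine ⟨E', Y, hY, hc, hYX, ht, ?_, ?_, ?_⟩
  · refine ((pp 1 0 0 1).sub (pp 0 0 1 1)).congr (Eventually.of_forall fun x => ?_)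
    beta_reduce
    rw [← s1 x, L1, L12]
    simp only [ep, Lam1, Matrix.of_apply, Matrix.cons_val, hP]
    ring
  · refine ((qq 1 0 0 1).sub (qq 0 0 1 1)).congr (Eventually.of_forall fun x => ?_)
    beta_reduce
    rw [← s3 x, L2, L12]
    simp only [eq, Lam2, Matrix.of_apply, Matrix.cons_val, hQ]
    ring
  · refine ((((qp 0 0 0 0).add (qp 1 0 0 1)).add (qp 0 1 1 0)).add (qp 1 1 1 1)).congr
      (Eventually.of_forall fun x => ?_)
    beta_reduce
    rw [polyFun_add, ← s2 x, ← s4 x, L1, L2, L12]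
    simp only [ep, eq, Lam12, Matrix.of_apply, Matrix.cons_val, hP, hQ]
    ring

end

/-! ### The three successive perturbations. -/

theorem IsTame.X {i j k l n : Fin 5} (hk : n ≠ k) (hl : n ≠ l) :
    IsTame i j k l 1 (MvPolynomial.X n) := by
  have h2 : ∀ p q : Fin 5, MvPolynomial.pderiv p
      (MvPolynomial.pderiv q (MvPolynomial.X n : MvPolynomial (Fin 5) ℝ)) = 0 := fun p q => by
    rw [MvPolynomial.pderiv_X, Pi.single_apply]
    split_ifs <;> simp
  exact ⟨MvPolynomial.isHomogeneous_X _ _, MvPolynomial.pderiv_X_of_ne hk,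
    MvPolynomial.pderiv_X_of_ne hl, h2 _ _, h2 _ _, h2 _ _, h2 _ _⟩

theorem IsTame.X_mul {i j k l n : Fin 5} {d : ℕ} {φ : MvPolynomial (Fin 5) ℝ}
    (hφ : IsTame i j k l d φ) (hi : n ≠ i) (hj : n ≠ j) (hk : n ≠ k) (hl : n ≠ l) :
    IsTame i j k l (d + 1) (MvPolynomial.X n * φ) := by
  have h : ∀ p : Fin 5, n ≠ p → ∀ ψ : MvPolynomial (Fin 5) ℝ, MvPolynomial.pderiv p
      (MvPolynomial.X n * ψ) = MvPolynomial.X n * MvPolynomial.pderiv p ψ := fun p hp ψ => by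
    rw [MvPolynomial.pderiv_mul, MvPolynomial.pderiv_X_of_ne hp, zero_mul, zero_add]
  refine ⟨add_comm 1 d ▸ (MvPolynomial.isHomogeneous_X ℝ n).mul hφ.1, ?_, ?_, ?_, ?_, ?_, ?_⟩ <;>
    simp only [h _ hi, h _ hj, h _ hk, h _ hl, hφ.2, hφ.3, hφ.4, hφ.5, hφ.6, hφ.7, mul_zero]

section

variable {E : HypEq} {X : Fin 5 → J1 → J1} {a : J1} {d : ℕ}

/-- The relative invariants can be made non-zero by a small perturbation. -/
theorem exists_perturbed_Lam_ne_zero (hX : Normalized E X a) (m : ℕ) {δ : ℝ} (hδ : 0 < δ) :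
    ∃ (E' : HypEq) (Y : Fin 5 → J1 → J1), Normalized E' Y a ∧
      CloseAt a m δ E.coeff E'.coeff ∧ Lam1 Y a ≠ 0 ∧ Lam2 Y a ≠ 0 ∧ Lam12 Y a ≠ 0 ∧
      Lam12 Y a ^ 2 - 4 * Lam1 Y a * Lam2 Y a ≠ 0 := by
  set L1 : ℝ → ℝ := fun t => brk X 1 2 4 a * brk X 0 3 4 a -
    (brk X 0 2 4 a + t) * (brk X 1 3 4 a + t) with hL1
  set L2 : ℝ → ℝ := fun t => brk X 3 0 4 a * brk X 2 1 4 a -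
    (brk X 2 0 4 a + t) * (brk X 3 1 4 a + t * 2) with hL2
  set L12 : ℝ → ℝ := fun t => (brk X 2 0 4 a + t) * (brk X 0 2 4 a + t) +
    brk X 3 0 4 a * brk X 0 3 4 a + brk X 2 1 4 a * brk X 1 2 4 a +
    (brk X 3 1 4 a + t * 2) * (brk X 1 3 4 a + t) with hL12
  set G1 : ℝ → ℝ := fun s => brk X 1 2 4 a * brk X 0 3 4 a * s ^ 2 -
    (brk X 0 2 4 a * s + 1) * (brk X 1 3 4 a * s + 1) with hG1
  set G2 : ℝ → ℝ := fun s => brk X 3 0 4 a * brk X 2 1 4 a * s ^ 2 -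
    (brk X 2 0 4 a * s + 1) * (brk X 3 1 4 a * s + 2) with hG2
  set G12 : ℝ → ℝ := fun s => (brk X 2 0 4 a * s + 1) * (brk X 0 2 4 a * s + 1) +
    brk X 3 0 4 a * brk X 0 3 4 a * s ^ 2 + brk X 2 1 4 a * brk X 1 2 4 a * s ^ 2 +
    (brk X 3 1 4 a * s + 2) * (brk X 1 3 4 a * s + 1) with hG12
  have g1 : ∀ s, s ≠ 0 → L1 s⁻¹ * s ^ 2 = G1 s := fun s hs => by
    simp only [hL1, hG1]; field_simp
  have g2 : ∀ s, s ≠ 0 → L2 s⁻¹ * s ^ 2 = G2 s := fun s hs => by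
    simp only [hL2, hG2]; field_simp
  have g12 : ∀ s, s ≠ 0 → L12 s⁻¹ * s ^ 2 = G12 s := fun s hs => by
    simp only [hL12, hG12]; field_simp
  have c1 : Continuous G1 := by fun_prop
  have c2 : Continuous G2 := by fun_prop
  have c12 : Continuous G12 := by fun_prop
  have a1 : ∀ t, AnalyticAt ℝ L1 t := fun t => by fun_prop
  have a2 : ∀ t, AnalyticAt ℝ L2 t := fun t => by fun_prop
  have a12 : ∀ t, AnalyticAt ℝ L12 t := fun t => by fun_prop
  have e1 := eventually_ne_zero_of_leading 2 a1 c1 g1 (by simp [hG1])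
  have e2 := eventually_ne_zero_of_leading 2 a2 c2 g2 (by simp [hG2])
  have e12 := eventually_ne_zero_of_leading 2 a12 c12 g12 (by norm_num [hG12])
  have e := eventually_ne_zero_of_leading (f := fun t => L12 t ^ 2 - 4 * L1 t * L2 t)
    (G := fun s => G12 s ^ 2 - 4 * G1 s * G2 s) 4 (fun t => by fun_prop) (by fun_prop)
    (fun s hs => by rw [← g1 s hs, ← g2 s hs, ← g12 s hs]; ring) (by norm_num [hG1, hG2, hG12])
  -- Θ is the discriminant of the characteristic polynomial of QP. The directions I and diag(1, 2)
  -- give QP distinct eigenvalues to leading order, with leading coefficients -1, -2, 3 of Λ₁, Λ₂,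
  -- Λ₁₂ and 9 - 8 = 1 of Θ; taking I twice would give 0.
  have hp := eventually_exists_perturbed hX
    (p := fun i j => MvPolynomial.C ((1 : Matrix (Fin 2) (Fin 2) ℝ) i j))
    (q := fun i j => MvPolynomial.C ((!![1, 0; 0, 2] : Matrix (Fin 2) (Fin 2) ℝ) i j))
    (fun _ _ => .const _) (fun _ _ => .const _) m hδ
  obtain ⟨t, ⟨E', Y, hY, hc, -, bp, bq, -⟩, h1, h2, h12, h⟩ :=
    ((hp.filter_mono nhdsWithin_le_nhds).and (e1.and (e2.and (e12.and e)))).exists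
  have bp' := fun i j => sub_eq_zero.1 (bp i j).self
  have bq' := fun i j => sub_eq_zero.1 (bq i j).self
  simp only [polyFun_C] at bp' bq'
  have p00 := bp' 0 0
  have p01 := bp' 0 1
  have p10 := bp' 1 0
  have p11 := bp' 1 1
  have q00 := bq' 0 0
  have q01 := bq' 0 1
  have q10 := bq' 1 0
  have q11 := bq' 1 1
  simp at p00 p01 p10 p11 q00 q01 q10 q11
  have i1 : Lam1 Y a = L1 t := by rw [Lam1, p00, p01, p10, p11]
  have i2 : Lam2 Y a = L2 t := by rw [Lam2, q00, q01, q10, q11]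
  have i12 : Lam12 Y a = L12 t := by rw [Lam12, p00, p01, p10, p11, q00, q01, q10, q11]
  refine ⟨E', Y, hY, hc, ?_⟩
  rw [i1, i2, i12]
  exact ⟨h1, h2, h12, h⟩

/-- The numerator of `sqInv`, before squaring. -/
def relDeriv (X : Fin 5 → J1 → J1) (L : J1 → ℝ) (x : J1) : ℝ :=
  fderiv ℝ L x (X 4 x) + L x * brkTrace X x

theorem Adapted.smooth_relDeriv (h : Adapted E X a) {L : J1 → ℝ} (hL : SmoothAt L a) :
    SmoothAt (relDeriv X L) a :=
  (hL.fderiv_apply (h.smooth 4)).add (hL.mul h.smooth_brkTrace)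

theorem eq_of_vanishesAt {f g : J1 → ℝ} {φ : MvPolynomial (Fin 5) ℝ} {t : ℝ}
    (h : VanishesAt a (d + 1) fun x => f x - (g x + t * polyFun X a φ x))
    (h0 : MvPolynomial.eval 0 φ = 0) : f a = g a := by
  have := h.self
  rw [polyFun_self, h0, mul_zero, add_zero] at this
  exact sub_eq_zero.1 this

theorem fderiv_eq_of_vanishesAt {f g : J1 → ℝ} {φ : MvPolynomial (Fin 5) ℝ} {t : ℝ}
    (hX : frameDet X a ≠ 0) (hf : SmoothAt f a) (hg : SmoothAt g a)
    (h : VanishesAt a (d + 2) fun x => f x - (g x + t * polyFun X a φ x)) (m : Fin 5) :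
    fderiv ℝ f a (X m a) =
      fderiv ℝ g a (X m a) + t * MvPolynomial.eval 0 (MvPolynomial.pderiv m φ) := by
  have hφ : DifferentiableAt ℝ (polyFun X a φ) a := (polyFun_hasFDerivAt φ a).differentiableAt
  have h1 := h.fderiv_eq_zero
  rw [fderiv_fun_sub hf.differentiableAt (hg.differentiableAt.fun_add (hφ.const_mul t)),
    fderiv_fun_add hg.differentiableAt (hφ.const_mul t), fderiv_const_mul hφ, sub_eq_zero] at h1
  rw [h1]
  simp only [add_apply, smul_apply, smul_eq_mul,
    fderiv_polyFun, coords_frame hX, polyFun_self]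
  simp [Pi.single_apply]

/-- X₅ differentiates the leading polynomial like ∂₄. The term Lβ contributes nothing new: the
polynomial itself and the change of the trace already vanish to order d + 1. -/
theorem relDeriv_perturbed {E' : HypEq} {Y : Fin 5 → J1 → J1} (hX : Adapted E X a)
    (hY : Adapted E' Y a) {f g : J1 → ℝ} {φ : MvPolynomial (Fin 5) ℝ} {t : ℝ}
    (hf : SmoothAt f a) (hg : SmoothAt g a) (hφ : φ.IsHomogeneous (d + 1))
    (h : VanishesAt a (d + 2) fun x => f x - (g x + t * polyFun X a φ x))
    (hYX : VanishesAt a (d + 2) fun x => Y 4 x - X 4 x)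
    (ht : VanishesAt a (d + 1) fun x => brkTrace Y x - brkTrace X x) :
    VanishesAt a (d + 1) fun x => relDeriv Y f x -
      (relDeriv X g x + t * polyFun X a (MvPolynomial.pderiv 4 φ) x) := by
  have sφ : SmoothAt (fun x => t * polyFun X a φ x) a :=
    ((polyFun_vanishesAt hφ).const_mul t).smooth
  have h1 := h.fderiv_apply (hY.smooth 4)
  have h2 := (VanishesAt.fderiv_along (hg.add sφ) hYX).pred
  have h3 := (fderiv_polyFun_frame hX.smooth hX.frameDet_ne hφ 4).const_mul t
  have h4 := (h.mul_smooth hY.smooth_brkTrace).pred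
  have h5 := ((polyFun_vanishesAt (X := X) (a := a) hφ).const_mul t).mul_smooth hY.smooth_brkTrace
  have h6 := VanishesAt.smooth_mul hg ht
  refine (((((h1.add h2).add h3).add h4).add h5).add h6).congr ?_
  filter_upwards [hf, hg, sφ] with x ef eg eφ
  have df := ef.differentiableAt (by simp)
  have dg := eg.differentiableAt (by simp)
  have dφ := eφ.differentiableAt (by simp)
  have dp : DifferentiableAt ℝ (polyFun X a φ) x := (polyFun_hasFDerivAt φ x).differentiableAt
  rw [fderiv_fun_sub df (dg.fun_add dφ), fderiv_fun_add dg dφ, fderiv_const_mul dp]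
  simp only [relDeriv, add_apply, sub_apply,
    smul_apply, smul_eq_mul, map_sub]
  ring

end

/-- The numerator of the derivative of `Lam12 X / L` along `X m`. -/
def quotDeriv (X : Fin 5 → J1 → J1) (L : J1 → ℝ) (a : J1) (m : Fin 5) : ℝ :=
  L a * fderiv ℝ (Lam12 X) a (X m a) - Lam12 X a * fderiv ℝ L a (X m a)

/-- The conditions on the frame `X` that make the invariant coframe independent, and the
differentials of the last three invariants sensitive to the second derivatives of the relative
invariants. -/
structure CoframeGeneric (X : Fin 5 → J1 → J1) (a : J1) : Prop where
  lam1 : Lam1 X a ≠ 0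
  lam2 : Lam2 X a ≠ 0
  theta : Lam12 X a ^ 2 - 4 * Lam1 X a * Lam2 X a ≠ 0
  wedge1 : quotDeriv X (Lam1 X) a 0 * quotDeriv X (Lam2 X) a 1 -
    quotDeriv X (Lam1 X) a 1 * quotDeriv X (Lam2 X) a 0 ≠ 0
  wedge2 : quotDeriv X (Lam1 X) a 2 * quotDeriv X (Lam2 X) a 3 -
    quotDeriv X (Lam1 X) a 3 * quotDeriv X (Lam2 X) a 2 ≠ 0
  five1 : quotDeriv X (Lam1 X) a 4 ≠ 0
  five2 : quotDeriv X (Lam2 X) a 4 ≠ 0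
  rel1 : relDeriv X (Lam1 X) a ≠ 0
  rel2 : relDeriv X (Lam2 X) a ≠ 0
  rel12 : relDeriv X (Lam12 X) a ≠ 0

section

variable {E : HypEq} {X : Fin 5 → J1 → J1} {a : J1}

/-- The leading coefficients in t are, in order, l12 l2, -l1 l12, l1 - l12 c, l2 - l12 c, c, c, 1.
The first two come with t², the others with t. -/
theorem eventually_coframe_conditions {l1 l2 l12 c : ℝ} (b : ℝ) (d1 d2 d12 : Fin 5 → ℝ)
    (h1 : l1 ≠ 0) (h2 : l2 ≠ 0) (h12 : l12 ≠ 0) (hc0 : c ≠ 0) (k1 : l1 - l12 * c ≠ 0)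
    (k2 : l2 - l12 * c ≠ 0) : ∀ᶠ t in 𝓝[≠] (0 : ℝ),
    (l1 * (d12 0 + t) - l12 * d1 0) * (l2 * d12 1 - l12 * d2 1) -
      (l1 * d12 1 - l12 * (d1 1 + t)) * (l2 * (d12 0 + t) - l12 * d2 0) ≠ 0 ∧
    (l1 * (d12 2 + t) - l12 * d1 2) * (l2 * d12 3 - l12 * (d2 3 + t)) -
      (l1 * d12 3 - l12 * d1 3) * (l2 * (d12 2 + t) - l12 * d2 2) ≠ 0 ∧
    l1 * (d12 4 + t) - l12 * (d1 4 + t * c) ≠ 0 ∧ l2 * (d12 4 + t) - l12 * (d2 4 + t * c) ≠ 0 ∧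
    d1 4 + t * c + l1 * b ≠ 0 ∧ d2 4 + t * c + l2 * b ≠ 0 ∧ d12 4 + t + l12 * b ≠ 0 := by
  have f1 := eventually_ne_zero_of_leading (G := fun s =>
      (l1 * (d12 0 * s + 1) - l12 * (d1 0 * s)) * (l2 * (d12 1 * s) - l12 * (d2 1 * s)) -
      (l1 * (d12 1 * s) - l12 * (d1 1 * s + 1)) * (l2 * (d12 0 * s + 1) - l12 * (d2 0 * s)))
    (f := fun t => (l1 * (d12 0 + t) - l12 * d1 0) * (l2 * d12 1 - l12 * d2 1) -
      (l1 * d12 1 - l12 * (d1 1 + t)) * (l2 * (d12 0 + t) - l12 * d2 0))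
    2 (fun t => by fun_prop) (by fun_prop) (fun s hs => by field_simp) (by simp [h12, h2])
  have f2 := eventually_ne_zero_of_leading (G := fun s =>
      (l1 * (d12 2 * s + 1) - l12 * (d1 2 * s)) * (l2 * (d12 3 * s) - l12 * (d2 3 * s + 1)) -
      (l1 * (d12 3 * s) - l12 * (d1 3 * s)) * (l2 * (d12 2 * s + 1) - l12 * (d2 2 * s)))
    (f := fun t => (l1 * (d12 2 + t) - l12 * d1 2) * (l2 * d12 3 - l12 * (d2 3 + t)) -
      (l1 * d12 3 - l12 * d1 3) * (l2 * (d12 2 + t) - l12 * d2 2))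
    2 (fun t => by fun_prop) (by fun_prop) (fun s hs => by field_simp) (by simp [h12, h1])
  have f3 := eventually_ne_zero_of_leading (G := fun s =>
      l1 * (d12 4 * s + 1) - l12 * (d1 4 * s + c))
    (f := fun t => l1 * (d12 4 + t) - l12 * (d1 4 + t * c))
    1 (fun t => by fun_prop) (by fun_prop) (fun s hs => by field_simp) (by simpa using k1)
  have f4 := eventually_ne_zero_of_leading (G := fun s =>
      l2 * (d12 4 * s + 1) - l12 * (d2 4 * s + c))
    (f := fun t => l2 * (d12 4 + t) - l12 * (d2 4 + t * c))
    1 (fun t => by fun_prop) (by fun_prop) (fun s hs => by field_simp) (by simpa using k2)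
  have f5 := eventually_ne_zero_of_leading (G := fun s => d1 4 * s + c + l1 * b * s)
    (f := fun t => d1 4 + t * c + l1 * b)
    1 (fun t => by fun_prop) (by fun_prop) (fun s hs => by field_simp) (by simpa using hc0)
  have f6 := eventually_ne_zero_of_leading (G := fun s => d2 4 * s + c + l2 * b * s)
    (f := fun t => d2 4 + t * c + l2 * b)
    1 (fun t => by fun_prop) (by fun_prop) (fun s hs => by field_simp) (by simpa using hc0)
  have f7 := eventually_ne_zero_of_leading (G := fun s => d12 4 * s + 1 + l12 * b * s)
    (f := fun t => d12 4 + t + l12 * b)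
    1 (fun t => by fun_prop) (by fun_prop) (fun s hs => by field_simp) (by simp)
  exact f1.and (f2.and (f3.and (f4.and (f5.and (f6.and f7)))))

open MvPolynomial in
theorem exists_perturbed_coframeGeneric (hX : Normalized E X a) (h1 : Lam1 X a ≠ 0)
    (h2 : Lam2 X a ≠ 0) (h12 : Lam12 X a ≠ 0)
    (hΘ : Lam12 X a ^ 2 - 4 * Lam1 X a * Lam2 X a ≠ 0) (m : ℕ) {δ : ℝ} (hδ : 0 < δ) :
    ∃ (E' : HypEq) (Y : Fin 5 → J1 → J1), Normalized E' Y a ∧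
      CloseAt a m δ E.coeff E'.coeff ∧ CoframeGeneric Y a := by
  -- The three excluded values are the zeros of the leading coefficients of the conditions involving
  -- X₅.
  obtain ⟨c, hc⟩ := Set.Infinite.exists_notMem_finset (Set.infinite_univ (α := ℝ))
    {0, Lam1 X a / Lam12 X a, Lam2 X a / Lam12 X a}
  simp only [mem_univ, Finset.mem_insert, Finset.mem_singleton, not_or, true_and] at hc
  obtain ⟨hc0, hc1, hc2⟩ := hc
  have k1 : Lam1 X a - Lam12 X a * c ≠ 0 := fun h => hc1 (by
    rw [eq_div_iff h12]; linarith)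
  have k2 : Lam2 X a - Lam12 X a * c ≠ 0 := fun h => hc2 (by
    rw [eq_div_iff h12]; linarith)
  -- The linear changes are x₁ + c x₄ for Λ₁, x₃ + c x₄ for Λ₂ and x₀ + x₂ + x₄ for Λ₁₂. They make
  -- the 2 × 2 minors along D¹ and D² and the derivatives along X₅ non-degenerate, while respecting
  -- tameness of the parts due to P and Q.
  have hp := eventually_exists_perturbed_Lam hX le_rfl
    (α₁ := MvPolynomial.X 1 + C c * MvPolynomial.X 4) (α := MvPolynomial.X 0 + MvPolynomial.X 4)
    (β₂ := MvPolynomial.X 3 + C c * MvPolynomial.X 4) (β := MvPolynomial.X 2)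
    ((IsTame.X (by decide) (by decide)).add ((IsTame.X (by decide) (by decide)).C_mul c))
    ((IsTame.X (by decide) (by decide)).add (IsTame.X (by decide) (by decide)))
    ((IsTame.X (by decide) (by decide)).add ((IsTame.X (by decide) (by decide)).C_mul c))
    (IsTame.X (by decide) (by decide)) hΘ m hδ
  obtain ⟨t, ⟨E', Y, hY, hcl, hYX, ht, v1, v2, v12⟩, g1, g2, g3, g4, g5, g6, g7⟩ :=
    ((hp.filter_mono nhdsWithin_le_nhds).and
      (eventually_coframe_conditions (brkTrace X a) (fun m => fderiv ℝ (Lam1 X) a (X m a))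
        (fun m => fderiv ℝ (Lam2 X) a (X m a)) (fun m => fderiv ℝ (Lam12 X) a (X m a))
        h1 h2 h12 hc0 k1 k2)).exists
  have eY : ∀ i, Y i a = X i a := fun i => sub_eq_zero.1 (hYX i).self
  have eb : brkTrace Y a = brkTrace X a := sub_eq_zero.1 ht.self
  have e1 : Lam1 Y a = Lam1 X a := eq_of_vanishesAt v1 (by simp)
  have e2 : Lam2 Y a = Lam2 X a := eq_of_vanishesAt v2 (by simp)
  have e12 : Lam12 Y a = Lam12 X a := eq_of_vanishesAt v12 (by simp)
  have w1 := fderiv_eq_of_vanishesAt hX.frameDet_ne hY.smooth_Lam1 hX.smooth_Lam1 v1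
  have w2 := fderiv_eq_of_vanishesAt hX.frameDet_ne hY.smooth_Lam2 hX.smooth_Lam2 v2
  have w12 := fderiv_eq_of_vanishesAt hX.frameDet_ne hY.smooth_Lam12 hX.smooth_Lam12 v12
  refine ⟨E', Y, hY, hcl, ?_⟩
  constructor
  · rw [e1]; exact h1
  · rw [e2]; exact h2
  · rw [e1, e2, e12]; exact hΘ
  · convert g1 using 2 <;>
    simp [quotDeriv, e1, e2, e12, eY, w1, w2, w12, pderiv_X]
  · convert g2 using 2 <;>
    simp [quotDeriv, e1, e2, e12, eY, w1, w2, w12, pderiv_X]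
  · convert g3 using 2
    simp [quotDeriv, e1, e12, eY, w1, w12, pderiv_X]
  · convert g4 using 2
    simp [quotDeriv, e2, e12, eY, w2, w12, pderiv_X]
  · convert g5 using 2
    simp [relDeriv, e1, eb, eY, w1, pderiv_X]
  · convert g6 using 2
    simp [relDeriv, e2, eb, eY, w2, pderiv_X]
  · convert g7 using 2
    simp [relDeriv, e12, eb, eY, w12, pderiv_X]

/-- Second derivatives of the relative invariants enter only through the first summand, with a
factor proportional to `relDeriv`; hence the non-vanishing required in `CoframeGeneric`. The
derivative of |u|⁻³ stays implicit, as the last perturbation leaves that summand unchanged. -/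
theorem fderiv_sqInv (hX : Adapted E X a) (h1 : Lam1 X a ≠ 0) {L : J1 → ℝ} (hL : SmoothAt L a)
    (v : J1) : fderiv ℝ (sqInv X L) a v =
      2 * relDeriv X L a / |Lam1 X a| ^ 3 * fderiv ℝ (relDeriv X L) a v +
      relDeriv X L a ^ 2 * deriv (fun u => (|u| ^ 3)⁻¹) (Lam1 X a) * fderiv ℝ (Lam1 X) a v := by
  have hr : HasFDerivAt (relDeriv X L) (fderiv ℝ (relDeriv X L) a) a :=
    (hX.smooth_relDeriv hL).differentiableAt.hasFDerivAt
  have hg : DifferentiableAt ℝ (fun u : ℝ => (|u| ^ 3)⁻¹) (Lam1 X a) :=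
    ((differentiableAt_abs h1).pow 3).inv (pow_ne_zero 3 (abs_ne_zero.2 h1))
  have hc := hg.hasDerivAt.comp_hasFDerivAt a hX.smooth_Lam1.differentiableAt.hasFDerivAt
  have hm := (hr.pow 2).mul hc
  have e : sqInv X L = fun x => relDeriv X L x ^ 2 * (|Lam1 X x| ^ 3)⁻¹ := by
    funext x
    rw [← div_eq_mul_inv]
    rfl
  rw [e]
  refine (congrArg (fun M : J1 →L[ℝ] ℝ => M v) hm.fderiv).trans ?_
  simp
  ring

theorem fderiv_div {f g : J1 → ℝ} (hf : SmoothAt f a) (hg : SmoothAt g a) (h : g a ≠ 0)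
    (v : J1) : fderiv ℝ (fun x => f x / g x) a v =
      (g a ^ 2)⁻¹ * (g a * fderiv ℝ f a v - f a * fderiv ℝ g a v) := by
  have hi := (hasDerivAt_inv h).comp_hasFDerivAt a hg.differentiableAt.hasFDerivAt
  have hm := hf.differentiableAt.hasFDerivAt.mul hi
  refine (congrArg (fun M : J1 →L[ℝ] ℝ => M v) hm.fderiv).trans ?_
  simp
  field_simp
  ring

theorem dInv_eq (hX : Adapted E X a) (j : Fin 5) :
    E.dInv j a = (fderiv ℝ (fun x => frameInv X x j) a).toLinearMap := by
  rw [HypEq.dInv]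
  congr 1
  have h : (fun x => E.basicInv x j) =ᶠ[𝓝 a] fun x => frameInv X x j :=
    hX.basicInv_eventuallyEq.mono fun x hx => congrFun hx j
  exact h.fderiv_eq

end

section

variable {E : HypEq} {X : Fin 5 → J1 → J1} {a : J1}

theorem Adapted.dInv_frameInv (hX : Adapted E X a) (h1 : Lam1 X a ≠ 0) (h2 : Lam2 X a ≠ 0)
    (v : J1) :
    E.dInv 0 a v = (Lam1 X a ^ 2)⁻¹ *
      (Lam1 X a * fderiv ℝ (Lam12 X) a v - Lam12 X a * fderiv ℝ (Lam1 X) a v) ∧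
    E.dInv 1 a v = (Lam2 X a ^ 2)⁻¹ *
      (Lam2 X a * fderiv ℝ (Lam12 X) a v - Lam12 X a * fderiv ℝ (Lam2 X) a v) ∧
    E.dInv 2 a v = fderiv ℝ (sqInv X (Lam1 X)) a v ∧
    E.dInv 3 a v = fderiv ℝ (sqInv X (Lam2 X)) a v ∧
    E.dInv 4 a v = fderiv ℝ (sqInv X (Lam12 X)) a v := by
  refine ⟨?_, ?_, ?_, ?_, ?_⟩ <;> rw [dInv_eq hX]
  · exact fderiv_div hX.smooth_Lam12 hX.smooth_Lam1 h1 v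
  · exact fderiv_div hX.smooth_Lam12 hX.smooth_Lam2 h2 v
  · rfl
  · rfl
  · rfl

open MvPolynomial in
theorem exists_perturbed_generic (hX : Normalized E X a) (hg : CoframeGeneric X a) (m : ℕ) {δ : ℝ}
    (hδ : 0 < δ) :
    ∃ E' : HypEq, E'.GenericAt a ∧ CloseAt a m δ E.coeff E'.coeff := by
  -- The quadratic changes x₄², x₄x₂, x₄x₃ of Λ₁, Λ₂, Λ₁₂ leave values and first derivatives at `a`
  -- untouched, hence also the first two differentials. After ∂₄ they become 2x₄, x₂, x₃, so the
  -- last three differentials move in the directions dual to X₅, X₃, X₄.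
  have hp := eventually_exists_perturbed_Lam hX (d := 2) (by norm_num)
    (α₁ := MvPolynomial.X 4 * MvPolynomial.X 4) (α := 0)
    (β₂ := MvPolynomial.X 4 * MvPolynomial.X 2) (β := MvPolynomial.X 4 * MvPolynomial.X 3)
    ((IsTame.X (by decide) (by decide)).X_mul (by decide) (by decide) (by decide) (by decide))
    .zero
    ((IsTame.X (by decide) (by decide)).X_mul (by decide) (by decide) (by decide) (by decide))
    ((IsTame.X (by decide) (by decide)).X_mul (by decide) (by decide) (by decide) (by decide))
    hg.theta m hδ
  have i1 := inv_ne_zero (pow_ne_zero 2 hg.lam1)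
  have i2 := inv_ne_zero (pow_ne_zero 2 hg.lam2)
  have i3 : |Lam1 X a| ^ 3 ≠ 0 := pow_ne_zero 3 (abs_ne_zero.2 hg.lam1)
  have hB : E.dInv 0 a (X 0 a) * E.dInv 1 a (X 1 a) -
      E.dInv 0 a (X 1 a) * E.dInv 1 a (X 0 a) ≠ 0 := by
    have e0 := hX.dInv_frameInv hg.lam1 hg.lam2 (X 0 a)
    have e1 := hX.dInv_frameInv hg.lam1 hg.lam2 (X 1 a)
    rw [e0.1, e0.2.1, e1.1, e1.2.1]
    convert mul_ne_zero (mul_ne_zero i1 i2) hg.wedge1 using 1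
    simp only [quotDeriv]
    ring
  -- The minor of dI¹, dI² along X₁, X₂ complements these three directions. The factor 2 in `c` is
  -- the derivative of x₄².
  have hdet := eventually_det_ne_zero (B := Matrix.of fun j m => E.dInv j a (X m a)) hB
    (c := 2 * relDeriv X (Lam1 X) a / |Lam1 X a| ^ 3 * 2)
    (d := 2 * relDeriv X (Lam2 X) a / |Lam1 X a| ^ 3)
    (e := 2 * relDeriv X (Lam12 X) a / |Lam1 X a| ^ 3)
    (mul_ne_zero (div_ne_zero (mul_ne_zero two_ne_zero hg.rel1) i3) two_ne_zero)
    (div_ne_zero (mul_ne_zero two_ne_zero hg.rel2) i3)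
    (div_ne_zero (mul_ne_zero two_ne_zero hg.rel12) i3)
  obtain ⟨t, ⟨E', Y, hY, hcl, hYX, ht, v1, v2, v12⟩, hdet⟩ :=
    ((hp.filter_mono nhdsWithin_le_nhds).and hdet).exists
  refine ⟨E', ?_, hcl⟩
  have eY : ∀ i, Y i a = X i a := fun i => sub_eq_zero.1 (hYX i).self
  have e1 : Lam1 Y a = Lam1 X a := eq_of_vanishesAt v1 (by simp)
  have e2 : Lam2 Y a = Lam2 X a := eq_of_vanishesAt v2 (by simp)
  have e12 : Lam12 Y a = Lam12 X a := eq_of_vanishesAt v12 (by simp)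
  have w1 : ∀ m, fderiv ℝ (Lam1 Y) a (X m a) = fderiv ℝ (Lam1 X) a (X m a) := fun m =>
    (fderiv_eq_of_vanishesAt hX.frameDet_ne hY.smooth_Lam1 hX.smooth_Lam1 v1 m).trans (by
      simp)
  have w2 : ∀ m, fderiv ℝ (Lam2 Y) a (X m a) = fderiv ℝ (Lam2 X) a (X m a) := fun m =>
    (fderiv_eq_of_vanishesAt hX.frameDet_ne hY.smooth_Lam2 hX.smooth_Lam2 v2 m).trans (by
      simp)
  have w12 : ∀ m, fderiv ℝ (Lam12 Y) a (X m a) = fderiv ℝ (Lam12 X) a (X m a) := fun m =>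
    (fderiv_eq_of_vanishesAt hX.frameDet_ne hY.smooth_Lam12 hX.smooth_Lam12 v12 m).trans (by
      simp)
  have hh : ∀ i j : Fin 5, (MvPolynomial.X i * MvPolynomial.X j :
      MvPolynomial (Fin 5) ℝ).IsHomogeneous 2 := fun i j => by
    exact (isHomogeneous_X ℝ i).mul (isHomogeneous_X ℝ j)
  have r1 := relDeriv_perturbed hX.toAdapted hY.toAdapted (d := 1) hY.smooth_Lam1 hX.smooth_Lam1
    (hh _ _) v1 (hYX 4) ht
  have r2 := relDeriv_perturbed hX.toAdapted hY.toAdapted (d := 1) hY.smooth_Lam2 hX.smooth_Lam2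
    (hh _ _) v2 (hYX 4) ht
  have r12 := relDeriv_perturbed hX.toAdapted hY.toAdapted (d := 1) hY.smooth_Lam12
    hX.smooth_Lam12 ((zero_add (MvPolynomial.X 4 * MvPolynomial.X 3 : MvPolynomial (Fin 5) ℝ)).symm ▸
      hh 4 3) v12 (hYX 4) ht
  have s1 : relDeriv Y (Lam1 Y) a = relDeriv X (Lam1 X) a := eq_of_vanishesAt r1 (by
    simp)
  have s2 : relDeriv Y (Lam2 Y) a = relDeriv X (Lam2 X) a := eq_of_vanishesAt r2 (by
    simp)
  have s12 : relDeriv Y (Lam12 Y) a = relDeriv X (Lam12 X) a := eq_of_vanishesAt r12 (by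
    simp)
  have u1 := fderiv_eq_of_vanishesAt (d := 0) hX.frameDet_ne
    (hY.smooth_relDeriv hY.smooth_Lam1) (hX.smooth_relDeriv hX.smooth_Lam1) r1
  have u2 := fderiv_eq_of_vanishesAt (d := 0) hX.frameDet_ne
    (hY.smooth_relDeriv hY.smooth_Lam2) (hX.smooth_relDeriv hX.smooth_Lam2) r2
  have u12 := fderiv_eq_of_vanishesAt (d := 0) hX.frameDet_ne
    (hY.smooth_relDeriv hY.smooth_Lam12) (hX.smooth_relDeriv hX.smooth_Lam12) r12
  have n1 : Lam1 Y a ≠ 0 := fun h => hg.lam1 (e1.symm.trans h)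
  have n2 : Lam2 Y a ≠ 0 := fun h => hg.lam2 (e2.symm.trans h)
  have D : ∀ m, E'.dInv 0 a (X m a) = E.dInv 0 a (X m a) ∧
      E'.dInv 1 a (X m a) = E.dInv 1 a (X m a) ∧
      E'.dInv 2 a (X m a) = E.dInv 2 a (X m a) + t * (2 * relDeriv X (Lam1 X) a / |Lam1 X a| ^ 3 *
        eval 0 (pderiv m (pderiv 4 (MvPolynomial.X 4 * MvPolynomial.X 4)))) ∧
      E'.dInv 3 a (X m a) = E.dInv 3 a (X m a) + t * (2 * relDeriv X (Lam2 X) a / |Lam1 X a| ^ 3 *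
        eval 0 (pderiv m (pderiv 4 (MvPolynomial.X 4 * MvPolynomial.X 2)))) ∧
      E'.dInv 4 a (X m a) = E.dInv 4 a (X m a) + t * (2 * relDeriv X (Lam12 X) a / |Lam1 X a| ^ 3 *
        eval 0 (pderiv m (pderiv 4 (0 + MvPolynomial.X 4 * MvPolynomial.X 3)))) := fun m => by
    obtain ⟨y0, y1, y2, y3, y4⟩ := hY.dInv_frameInv n1 n2 (X m a)
    obtain ⟨x0, x1, x2, x3, x4⟩ := hX.dInv_frameInv hg.lam1 hg.lam2 (X m a)
    rw [y0, y1, y2, y3, y4, x0, x1, x2, x3, x4, fderiv_sqInv hY.toAdapted n1 hY.smooth_Lam1,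
      fderiv_sqInv hY.toAdapted n1 hY.smooth_Lam2, fderiv_sqInv hY.toAdapted n1 hY.smooth_Lam12,
      fderiv_sqInv hX.toAdapted hg.lam1 hX.smooth_Lam1,
      fderiv_sqInv hX.toAdapted hg.lam1 hX.smooth_Lam2,
      fderiv_sqInv hX.toAdapted hg.lam1 hX.smooth_Lam12, e1, e2, e12, w1, w2, w12, s1, s2, s12,
      u1, u2, u12]
    refine ⟨rfl, rfl, ?_, ?_, ?_⟩ <;> ring
  have Q : ∀ m, E.dInv 0 a (X m a) = (Lam1 X a ^ 2)⁻¹ * quotDeriv X (Lam1 X) a m ∧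
      E.dInv 1 a (X m a) = (Lam2 X a ^ 2)⁻¹ * quotDeriv X (Lam2 X) a m := fun m =>
    ⟨(hX.dInv_frameInv hg.lam1 hg.lam2 _).1, (hX.dInv_frameInv hg.lam1 hg.lam2 _).2.1⟩
  rw [hY.genericAt_iff]
  simp only [eY]
  refine ⟨n1, n2, ?_, ?_, ?_, ?_, ?_⟩
  · rw [(D 0).1, (D 0).2.1, (D 1).1, (D 1).2.1]
    exact hB
  · rw [(D 2).1, (D 2).2.1, (D 3).1, (D 3).2.1, (Q 2).1, (Q 2).2, (Q 3).1, (Q 3).2]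
    convert mul_ne_zero (mul_ne_zero i1 i2) hg.wedge2 using 1
    ring
  · rw [(D 4).1, (Q 4).1]
    exact mul_ne_zero i1 hg.five1
  · rw [(D 4).2.1, (Q 4).2]
    exact mul_ne_zero i2 hg.five2
  · convert hdet using 2
    ext j m
    have Dm := D m
    fin_cases j
    · refine Dm.1.trans ?_
      fin_cases m <;> simp
    · refine Dm.2.1.trans ?_
      fin_cases m <;> simp
    · refine Dm.2.2.1.trans ?_
      fin_cases m <;> simp [pderiv_X, one_add_one_eq_two]
      exact Or.inl (Or.inl (map_ofNat constantCoeff 2))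
    · refine Dm.2.2.2.1.trans ?_
      fin_cases m <;> simp [pderiv_X]
    · refine Dm.2.2.2.2.trans ?_
      fin_cases m <;> simp [pderiv_X]

end

/-- Generic equations are dense in the `C^m` topology at a point, for all `m`. -/
theorem exists_generic_near (E : HypEq) (a : J1) (ha : a ∈ E.dom) (m : ℕ) (δ : ℝ) (hδ : 0 < δ) :
    ∃ E' : HypEq, E'.GenericAt a ∧
      ∀ n ≤ m, ‖iteratedFDeriv ℝ n E'.coeff a - iteratedFDeriv ℝ n E.coeff a‖ < δ := by
  obtain ⟨X, hX⟩ := exists_normalized ha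
  -- One third for each of the perturbations of degree 0, 1 and 2; the later ones keep the values,
  -- and the last also the first derivatives, of the relative invariants at `a`.
  have h3 : 0 < δ / 3 := by positivity
  obtain ⟨E₁, X₁, hX₁, c₁, l1, l2, l12, hΘ⟩ := exists_perturbed_Lam_ne_zero hX m h3
  obtain ⟨E₂, X₂, hX₂, c₂, hg⟩ := exists_perturbed_coframeGeneric hX₁ l1 l2 l12 hΘ m h3
  obtain ⟨E₃, hE₃, c₃⟩ := exists_perturbed_generic hX₂ hg m h3
  refine ⟨E₃, hE₃, ?_⟩
  have := (c₁.trans c₂).trans c₃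
  rwa [show δ / 3 + δ / 3 + δ / 3 = δ by ring] at this

end MongeAmpere

end

theorem mainTheorem1 :
    (∀ (E : HypEq) (a : J1), a ∈ E.dom → ∀ (m : ℕ) (δ : ℝ), 0 < δ →
      ∃ E' : HypEq, E'.GenericAt a ∧
        ∀ n ≤ m, ‖iteratedFDeriv ℝ n E'.coeff a - iteratedFDeriv ℝ n E.coeff a‖ < δ) ∧
    (∀ (E : HypEq) (a : J1), E.GenericAt a →
      ∃ Φ : OpenPartialHomeomorph J1 (Fin 5 → ℝ),
        a ∈ Φ.source ∧ Set.EqOn Φ E.basicInv Φ.source ∧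
        ContDiffOn ℝ ∞ Φ Φ.source ∧ ContDiffOn ℝ ∞ Φ.symm Φ.target ∧
        (∀ x ∈ Φ.source, E.GenericAt x) ∧
        ∀ k : Fin 2, ∃ w : Fin 5 → Fin 5 → (Fin 5 → ℝ) → ℝ,
          (∀ i j, ContDiffOn ℝ ∞ (w i j) Φ.target) ∧
          (∀ x ∈ Φ.source, ∀ i, E.coframe k x i = ∑ j, w i j (E.basicInv x) • E.dInv j x) ∧
          ∀ w' : Fin 5 → Fin 5 → (Fin 5 → ℝ) → ℝ,
            (∀ x ∈ Φ.source, ∀ i,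
              E.coframe k x i = ∑ j, w' i j (E.basicInv x) • E.dInv j x) →
            ∀ i j, Set.EqOn (w' i j) (w i j) Φ.target) ∧
    (∀ (k : Fin 2) (E E' : HypEq) (a a' : J1), E.GenericAt a → E'.GenericAt a' →
      (ContactEquiv E a E' a' ↔
        SameCoeffFunctions k E a E' a' ∨ SameCoeffFunctions k E a E'.neg a')) := by
  exact ⟨exists_generic_near, exists_coordinates, contactEquiv_iff⟩
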